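/- \textbf{Theorem 5.} A symmetric fractional hedonic game is given by a finite undirected simple graph $G=(V,E)$ with $n=|V|$ and nonzero integer edge weights $w_{uv}$. The utility of a vertex $v$ in a coalition $C\subseteq V$ with $v\in C$ is $U(v,C)=\frac{1}{|C|}\sum_{u\in C,\,uv\in E} w_{uv}$, and the utilitarian welfare of a partition $\mathcal C$ of $V$ into coalitions is $\sum_{C\in\mathcal C}\sum_{v\in C}U(v,C)$. Utilitarian Welfare Maximization asks, given such a game, for a partition of $V$ of maximum utilitarian welfare. There is an algorithm (on a random access machine whose unit-cost arithmetic operations are addition and subtraction) that solves Utilitarian Welfare Maximization on every such game, and that runs in time $(nW)^{O(\omega)}$ whenever $G$ has at least one edge, where $\omega$ is the treewidth of $G$ and $W=\max_{uv\in E}|w_{uv}|$; neither $\omega$ nor a tree decomposition is part of the input. (On graphs without edges it runs in time polynomial in $n$.) In particular, in the unweighted case (all weights equal to $1$) the algorithm runs in time $n^{O(\omega)}$ whenever $G$ has at least one edge, and its output also solves Dense Graph Partitioning, that is, it maximizes $\sum_{C\in\mathcal C}|E(C)|/|C|$ over all partitions $\mathcal C$ of $V$, where $E(C)$ is the set of edges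 of $G$ with both endpoints in $C$. -/

import Mathlib

/-! Tree decompositions and treewidth. -/

/-- A tree decomposition of a graph `G` whose tree has the nodes `0, …, nodes - 1`. -/
structure TreeDecomposition {V : Type*} (G : SimpleGraph V) where
  nodes : ℕ
  tree : SimpleGraph (Fin nodes)
  isTree : tree.IsTree
  bag : Fin nodes → Finset V
  vertex_mem : ∀ v : V, ∃ t, v ∈ bag t
  edge_mem : ∀ u v : V, G.Adj u v → ∃ t, u ∈ bag t ∧ v ∈ bag t
  connected : ∀ v : V, (tree.induce {t | v ∈ bag t}).Connected

/-- The size of a largest bag minus one (`0` if all bags are empty, i.e. for the graph without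
vertices). -/
def TreeDecomposition.width {V : Type*} {G : SimpleGraph V} (D : TreeDecomposition G) : ℕ :=
  (Finset.univ.sup fun t => (D.bag t).card) - 1

/-- The minimum width of a tree decomposition. -/
noncomputable def treewidth {V : Type*} (G : SimpleGraph V) : ℕ :=
  sInf (Set.range fun D : TreeDecomposition G => D.width)

/-! Symmetric fractional hedonic games. -/

/-- A symmetric fractional hedonic game on `n` agents with integer weights. No edge has weight
`0`; the weight of a pair that is not an edge is `0` by convention. -/
structure FractionalHedonicGame (n : ℕ) where
  graph : SimpleGraph (Fin n)
  weight : Fin n → Fin n → ℤ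
  weight_symm : ∀ u v, weight u v = weight v u
  weight_ne_zero_iff : ∀ u v, weight u v ≠ 0 ↔ graph.Adj u v

/-- A coalition structure: a partition of the set of all agents into nonempty coalitions. -/
abbrev CoalitionStructure (n : ℕ) := Finpartition (Finset.univ : Finset (Fin n))

namespace FractionalHedonicGame

variable {n : ℕ}

/-- The maximum absolute value of an edge weight (`0` if there is no edge). -/
def maxAbsWeight (g : FractionalHedonicGame n) : ℕ :=
  Finset.univ.sup fun p : Fin n × Fin n => (g.weight p.1 p.2).natAbs

open Classical in
/-- The utility of agent `v` in coalition `C`. -/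
noncomputable def utility (g : FractionalHedonicGame n) (v : Fin n) (C : Finset (Fin n)) : ℚ :=
  (∑ u ∈ C with g.graph.Adj v u, (g.weight v u : ℚ)) / (C.card : ℚ)

/-- The utilitarian welfare of a coalition structure. -/
noncomputable def utilitarianWelfare (g : FractionalHedonicGame n)
    (P : CoalitionStructure n) : ℚ :=
  ∑ C ∈ P.parts, ∑ v ∈ C, g.utility v C

/-- `P` maximizes the utilitarian welfare among all coalition structures. -/
def IsMaxUtilitarian (g : FractionalHedonicGame n) (P : CoalitionStructure n) : Prop :=
  ∀ Q : CoalitionStructure n, g.utilitarianWelfare Q ≤ g.utilitarianWelfare P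

open Classical in
/-- The simple (unweighted) game of a graph: every edge has weight `1`. -/
noncomputable def simple (G : SimpleGraph (Fin n)) : FractionalHedonicGame n where
  graph := G
  weight u v := if G.Adj u v then 1 else 0
  weight_symm u v := by simp only [G.adj_comm]
  weight_ne_zero_iff u v := by simp

end FractionalHedonicGame

/-- The objective function of Dense Graph Partitioning: the sum of the densities `|E(C)| / |C|`
of the parts `C`. -/
noncomputable def totalDensity {n : ℕ} (G : SimpleGraph (Fin n)) (P : CoalitionStructure n) : ℚ :=
  ∑ C ∈ P.parts, ((G.induce (C : Set (Fin n))).edgeSet.ncard : ℚ) / (C.card : ℚ)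

/-! The machine model: a unit-cost random access machine, programmed in structured form. It has
integer registers and integer arrays (indirect addressing). The only arithmetic operations are
addition and subtraction, so that in `t` steps bit lengths grow by at most `O(t)` and the running
time is polynomially related to that of a Turing machine. -/

namespace RAM

/-- The memory: registers `reg x`, and arrays `arr a` with cells `arr a i`. -/
structure State where
  reg : ℕ → ℤ
  arr : ℕ → ℤ → ℤ

/-- Integer expressions: constants, registers, array cells `a[i]`, sums and differences. -/
inductive Expr where
  | const (k : ℤ)
  | reg (x : ℕ)
  | get (a : ℕ) (i : Expr)
  | add (e₁ e₂ : Expr)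
  | sub (e₁ e₂ : Expr)

def Expr.eval (s : State) : Expr → ℤ
  | .const k => k
  | .reg x => s.reg x
  | .get a i => s.arr a (i.eval s)
  | .add e₁ e₂ => e₁.eval s + e₂.eval s
  | .sub e₁ e₂ => e₁.eval s - e₂.eval s

/-- The number of operations needed to evaluate an expression. -/
def Expr.cost : Expr → ℕ
  | .const _ => 1
  | .reg _ => 1
  | .get _ i => i.cost + 1
  | .add e₁ e₂ => e₁.cost + e₂.cost + 1
  | .sub e₁ e₂ => e₁.cost + e₂.cost + 1

/-- Tests: comparisons and their Boolean combinations. -/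
inductive Test where
  | le (e₁ e₂ : Expr)
  | eq (e₁ e₂ : Expr)
  | not (b : Test)
  | and (b₁ b₂ : Test)

def Test.Holds (s : State) : Test → Prop
  | .le e₁ e₂ => e₁.eval s ≤ e₂.eval s
  | .eq e₁ e₂ => e₁.eval s = e₂.eval s
  | .not b => ¬ b.Holds s
  | .and b₁ b₂ => b₁.Holds s ∧ b₂.Holds s

/-- The number of operations needed to evaluate a test. -/
def Test.cost : Test → ℕ
  | .le e₁ e₂ => e₁.cost + e₂.cost + 1
  | .eq e₁ e₂ => e₁.cost + e₂.cost + 1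
  | .not b => b.cost + 1
  | .and b₁ b₂ => b₁.cost + b₂.cost + 1

/-- Programs: `reg x := e`, `a[i] := e`, sequencing, branching and loops. -/
inductive Program where
  | skip
  | assign (x : ℕ) (e : Expr)
  | store (a : ℕ) (i e : Expr)
  | seq (p q : Program)
  | ite (b : Test) (p q : Program)
  | loop (b : Test) (p : Program)

def State.setReg (s : State) (x : ℕ) (v : ℤ) : State :=
  { s with reg := Function.update s.reg x v }

def State.setCell (s : State) (a : ℕ) (i v : ℤ) : State :=
  { s with arr := Function.update s.arr a (Function.update (s.arr a) i v) }

/-- `Exec p s t s'`: program `p`, started in memory `s`, halts in memory `s'` after exactly `t`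
steps. The command `loop b p` repeats `p` as long as `b` holds. -/
inductive Exec : Program → State → ℕ → State → Prop
  | skip (s : State) : Exec .skip s 1 s
  | assign (x : ℕ) (e : Expr) (s : State) :
      Exec (.assign x e) s (e.cost + 1) (s.setReg x (e.eval s))
  | store (a : ℕ) (i e : Expr) (s : State) :
      Exec (.store a i e) s (i.cost + e.cost + 1) (s.setCell a (i.eval s) (e.eval s))
  | seq {p q : Program} {s₁ s₂ s₃ : State} {t₁ t₂ : ℕ} :
      Exec p s₁ t₁ s₂ → Exec q s₂ t₂ s₃ → Exec (.seq p q) s₁ (t₁ + t₂) s₃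
  | ite_true {b : Test} {p q : Program} {s s' : State} {t : ℕ} :
      b.Holds s → Exec p s t s' → Exec (.ite b p q) s (b.cost + t) s'
  | ite_false {b : Test} {p q : Program} {s s' : State} {t : ℕ} :
      ¬ b.Holds s → Exec q s t s' → Exec (.ite b p q) s (b.cost + t) s'
  | loop_stop {b : Test} {p : Program} {s : State} :
      ¬ b.Holds s → Exec (.loop b p) s b.cost s
  | loop_step {b : Test} {p : Program} {s₁ s₂ s₃ : State} {t₁ t₂ : ℕ} :
      b.Holds s₁ → Exec p s₁ t₁ s₂ → Exec (.loop b p) s₂ t₂ s₃ →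
      Exec (.loop b p) s₁ (b.cost + t₁ + t₂) s₃

end RAM

/-- The initial memory for the game `g`: register `0` holds the number `n` of agents and array `0`
holds the `n × n` weight matrix in row-major order (the weight of the pair `(u, v)` is in cell
`u * n + v`, and is `0` if `u` and `v` are not adjacent); everything else is `0`. -/
def FractionalHedonicGame.input {n : ℕ} (g : FractionalHedonicGame n) : RAM.State where
  reg x := if x = 0 then (n : ℤ) else 0
  arr a i :=
    if h : a = 0 ∧ 0 ≤ i ∧ i.toNat < n * n then
      g.weight (Fin.divNat ⟨i.toNat, h.2.2⟩) (Fin.modNat ⟨i.toNat, h.2.2⟩)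
    else 0

/-- The memory `s` encodes `P` as an output: in array `1`, the cells of two agents have equal
contents if and only if the agents are in the same coalition. -/
def RAM.State.Outputs {n : ℕ} (s : RAM.State) (P : CoalitionStructure n) : Prop :=
  ∀ u v : Fin n, s.arr 1 (u : ℕ) = s.arr 1 (v : ℕ) ↔ P.part u = P.part v

/-!
The algorithm is a dynamic program that needs no tree decomposition. A *configuration* (`Cfg`)
consists of at most `K` boundary vertices and of a set of components of the graph without the
boundary, the *pending* vertices; for every boundary vertex it records the name of its coalition,
the claimed size of this coalition, and a budget, the number of pending vertices that may still
join it. A step either passes to the next vertex, or takes the component `C` of the least pending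
vertex, moves some vertex of `C` to the boundary, where it replaces a vertex that has no neighbours
in `C`, and treats the rest of `C` and the remaining components separately. Both parts only interact
through the boundary, so the recursion computes the maximum total value of the pairs that meet the
pending vertices. With `M` exceeding `n` and all weights, there are `B = M ^ (4 K + 2)`
configurations, and everything is computed by loops of length at most `B`.

*Enough slots.* Order the vertices by the depth of the top nodes of their subtrees in a rooted tree
decomposition of width `ω`. The vertices that precede a connected set and are adjacent to it lie in
one bag, together with the first vertex of the set (`TreeDecomposition.exists_rank`). Hence all
vertices can be placed on a boundary with `ω + 1` slots (`Cfg.good_of_rank`). The program tries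
`K = 1, 2, …` and detects, by the same recursion without coalition data, when `K` suffices.

*Correctness.* The computed value is attained by a choice of coalitions whose claimed sizes are at
least the true sizes (`Cfg.attains_iterate`), and it is an upper bound for all such choices
(`Cfg.pairSum_le_iterate`). Claimed sizes too large only lose welfare if the coalition has positive
weight. To avoid connectivity conditions, coalitions of a relaxed optimum are split into the
components of the graph of their edges: a component of negative weight could be dissolved with
profit (`class_weight_nonneg`), so the components with their true sizes are at least as good
(`relaxedWelfare_le_classes`), hence optimal.

*Reconstruction.* The value of a pair `(u, v)` in a coalition of size `m` is taken to be
`w(u, v) * (n! / m) * 2 ^ (n²) + 2 ^ (n u + v)`. The integer `n! / m` avoids division, and the last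
`n²` bits of the optimum mark the edges within coalitions without affecting the comparison of
welfares. The components of the marked graph are the output.

*The machine.* A function of the readable memory and of local variables is `CompZ` if for every
choice of registers some program computes it in time polynomial in the loop bounds `n`, `B`, `M`,
`K`. This notion is closed under sums, case distinctions, bounded loops and bounded quantifiers, so
the functions of the dynamic program satisfy it by construction. Only the loops that fill the tables
and increase `K` are written as programs (`RAM.exists_program`).
-/

namespace RAM

/-! ### Time-bounded execution -/

/-- Program `p`, started in `s`, halts within `T` steps in a memory with property `Q`. -/
def Runs (p : Program) (s : State) (T : ℕ) (Q : State → Prop) : Prop :=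
  ∃ t s', Exec p s t s' ∧ t ≤ T ∧ Q s'

theorem Runs.mono {p : Program} {s : State} {T T' : ℕ} {Q Q' : State → Prop}
    (h : Runs p s T Q) (hT : T ≤ T') (hQ : ∀ s', Q s' → Q' s') : Runs p s T' Q' := by
  obtain ⟨t, s', h1, h2, h3⟩ := h
  exact ⟨t, s', h1, h2.trans hT, hQ _ h3⟩

theorem Runs.seq {p q : Program} {s : State} {T₁ T₂ : ℕ} {Q₁ Q₂ : State → Prop}
    (hp : Runs p s T₁ Q₁) (hq : ∀ s', Q₁ s' → Runs q s' T₂ Q₂) :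
    Runs (.seq p q) s (T₁ + T₂) Q₂ := by
  obtain ⟨t, s', h1, h2, h3⟩ := hp
  obtain ⟨t', s'', h1', h2', h3'⟩ := hq s' h3
  exact ⟨t + t', s'', .seq h1 h1', add_le_add h2 h2', h3'⟩

theorem Runs.skip {s : State} {Q : State → Prop} (h : Q s) : Runs .skip s 1 Q :=
  ⟨1, s, .skip s, le_rfl, h⟩

theorem Runs.assign {x : ℕ} {e : Expr} {s : State} {Q : State → Prop}
    (h : Q (s.setReg x (e.eval s))) : Runs (.assign x e) s (e.cost + 1) Q :=
  ⟨_, _, .assign x e s, le_rfl, h⟩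

theorem Runs.store {a : ℕ} {i e : Expr} {s : State} {Q : State → Prop}
    (h : Q (s.setCell a (i.eval s) (e.eval s))) :
    Runs (.store a i e) s (i.cost + e.cost + 1) Q :=
  ⟨_, _, .store a i e s, le_rfl, h⟩

theorem Runs.ite {b : Test} {p q : Program} {s : State} {T₁ T₂ : ℕ} {Q : State → Prop}
    (hp : b.Holds s → Runs p s T₁ Q) (hq : ¬ b.Holds s → Runs q s T₂ Q) :
    Runs (.ite b p q) s (b.cost + (T₁ + T₂)) Q := by
  by_cases h : b.Holds s
  · obtain ⟨t, s', h1, h2, h3⟩ := hp h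
    exact ⟨_, s', .ite_true h h1, by omega, h3⟩
  · obtain ⟨t, s', h1, h2, h3⟩ := hq h
    exact ⟨_, s', .ite_false h h1, by omega, h3⟩

/-- A loop whose test holds exactly during the first `N` rounds. -/
theorem Runs.loop {b : Test} {p : Program} {T N : ℕ} (I : ℕ → State → Prop)
    (hb : ∀ i s, I i s → i ≤ N → (b.Holds s ↔ i < N))
    (hp : ∀ i s, I i s → i < N → Runs p s T (I (i + 1))) {s : State} (h0 : I 0 s) :
    Runs (.loop b p) s (N * (b.cost + T) + b.cost) (I N) := by
  suffices H : ∀ k i s, i + k = N → I i s →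
      Runs (.loop b p) s (k * (b.cost + T) + b.cost) (I N) from H N 0 s (by simp) h0
  intro k
  induction k with
  | zero =>
    intro i s hi h
    refine ⟨b.cost, s, Exec.loop_stop ?_, by simp, ?_⟩
    · rw [hb i s h (by omega)]; omega
    · simpa [← hi] using h
  | succ k ih =>
    intro i s hi h
    obtain ⟨t, s', h1, h2, h3⟩ := hp i s h (by omega)
    obtain ⟨t', s'', h1', h2', h3'⟩ := ih (i + 1) s' (by omega) h3
    refine ⟨_, s'', .loop_step ((hb i s h (by omega)).2 (by omega)) h1 h1', ?_, h3'⟩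
    rw [Nat.succ_mul]; omega

@[simp] theorem setReg_reg (s : State) (x : ℕ) (v : ℤ) :
    (s.setReg x v).reg = Function.update s.reg x v := rfl

@[simp] theorem setReg_arr (s : State) (x : ℕ) (v : ℤ) : (s.setReg x v).arr = s.arr := rfl

@[simp] theorem setCell_reg (s : State) (a : ℕ) (i v : ℤ) : (s.setCell a i v).reg = s.reg := rfl

@[simp] theorem setCell_arr (s : State) (a : ℕ) (i v : ℤ) :
    (s.setCell a i v).arr = Function.update s.arr a (Function.update (s.arr a) i v) := rfl

/-! ### Polynomially bounded running times -/

/-- `T` is bounded by a polynomial. -/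
def PolyBounded (T : ℕ → ℕ) : Prop := ∃ c e, ∀ S, T S ≤ c * (S + 1) ^ e

namespace PolyBounded

theorem const (c : ℕ) : PolyBounded fun _ => c := ⟨c, 0, by simp⟩

theorem id : PolyBounded fun S => S := ⟨1, 1, by simp⟩

theorem add {T T' : ℕ → ℕ} (h : PolyBounded T) (h' : PolyBounded T') :
    PolyBounded fun S => T S + T' S := by
  obtain ⟨c, e, h⟩ := h
  obtain ⟨c', e', h'⟩ := h'
  refine ⟨c + c', e + e', fun S => ?_⟩
  have h1 : (S + 1) ^ e ≤ (S + 1) ^ (e + e') := Nat.pow_le_pow_right (by omega) (by omega)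
  have h2 : (S + 1) ^ e' ≤ (S + 1) ^ (e + e') := Nat.pow_le_pow_right (by omega) (by omega)
  calc T S + T' S ≤ c * (S + 1) ^ e + c' * (S + 1) ^ e' := add_le_add (h S) (h' S)
    _ ≤ c * (S + 1) ^ (e + e') + c' * (S + 1) ^ (e + e') := by gcongr
    _ = _ := by ring

theorem mul {T T' : ℕ → ℕ} (h : PolyBounded T) (h' : PolyBounded T') :
    PolyBounded fun S => T S * T' S := by
  obtain ⟨c, e, h⟩ := h
  obtain ⟨c', e', h'⟩ := h'
  refine ⟨c * c', e + e', fun S => ?_⟩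
  calc T S * T' S ≤ (c * (S + 1) ^ e) * (c' * (S + 1) ^ e') := Nat.mul_le_mul (h S) (h' S)
    _ = _ := by ring

end PolyBounded

/-! ### Computable functions of typed contexts -/

/-- The part of the memory that computations may read: the weights `w` (array `0`), two tables
`G` and `H` (arrays `2` and `3`), and four numbers (registers `0` to `3`), which are the
only admissible bounds of loops. -/
structure Base where
  w : ℤ → ℤ
  G : ℤ → ℤ
  H : ℤ → ℤ
  sz : Fin 4 → ℕ

/-- The readable part of a memory. -/
def State.base (s : State) : Base := ⟨s.arr 0, s.arr 2, s.arr 3, fun k => (s.reg k).toNat⟩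

/-- The parameter in which running times are measured: the sum of the loop bounds. -/
def Base.size (b : Base) : ℕ := ∑ k, b.sz k

theorem Base.sz_le_size (b : Base) (k : Fin 4) : b.sz k ≤ b.size :=
  Finset.single_le_sum (f := b.sz) (fun _ _ => Nat.zero_le _) (Finset.mem_univ k)

theorem State.base_congr {s s' : State} (ha : s'.arr = s.arr)
    (hr : ∀ x < 8, s'.reg x = s.reg x) : s'.base = s.base := by
  simp only [State.base, ha]
  congr 1
  funext k
  rw [hr _ (by omega)]

/-- Contexts in which functions are evaluated: `Base`, extended by local variables. A place of a
context says which registers hold the local variables. -/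
class Ctx (Γ : Type) where
  Place : Type
  read : Place → State → Γ
  bound : Place → ℕ
  eight_le : ∀ π, 8 ≤ bound π
  read_congr : ∀ (π : Place) {s s' : State}, s'.base = s.base →
    (∀ x < bound π, s'.reg x = s.reg x) → read π s' = read π s

open Ctx

instance : Ctx Base where
  Place := Unit
  read _ s := s.base
  bound _ := 8
  eight_le _ := le_rfl
  read_congr _ _ _ h _ := h

/-- Types of local variables, with the value of a variable whose register holds a given integer. -/
class LocalVar (α : Type) where
  ofInt : ℤ → α

instance : LocalVar ℕ := ⟨Int.toNat⟩

instance : LocalVar ℤ := ⟨id⟩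

instance {Γ α : Type} [Ctx Γ] [LocalVar α] : Ctx (Γ × α) where
  Place := Place Γ × ℕ
  read π s := (read π.1 s, LocalVar.ofInt (s.reg π.2))
  bound π := max (bound π.1) (π.2 + 1)
  eight_le π := (eight_le π.1).trans (le_max_left _ _)
  read_congr π s s' hb hr := by
    rw [read_congr π.1 hb fun x hx => hr x (lt_of_lt_of_le hx (le_max_left _ _)),
      hr π.2 (lt_of_lt_of_le (Nat.lt_succ_self _) (le_max_right _ _))]

variable {Γ α : Type} [Ctx Γ] [LocalVar α]

/-- The memories `s` and `s'` agree in the arrays and in the registers below `r`. -/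
def Keeps (r : ℕ) (s s' : State) : Prop := s'.arr = s.arr ∧ ∀ x < r, s'.reg x = s.reg x

theorem Keeps.refl (r : ℕ) (s : State) : Keeps r s s := ⟨rfl, fun _ _ => rfl⟩

theorem Keeps.trans {r r' : ℕ} {s s' s'' : State} (h : Keeps r s s') (h' : Keeps r' s' s'')
    (hr : r ≤ r') : Keeps r s s'' :=
  ⟨h'.1.trans h.1, fun x hx => (h'.2 x (by omega)).trans (h.2 x hx)⟩

theorem Keeps.base {r : ℕ} {s s' : State} (h : Keeps r s s') (hr : 8 ≤ r) : s'.base = s.base :=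
  State.base_congr h.1 fun x hx => h.2 x (by omega)

theorem Keeps.read {r : ℕ} {s s' : State} (h : Keeps r s s') {π : Place Γ} (hr : bound π ≤ r) :
    Ctx.read π s' = Ctx.read π s :=
  read_congr π (h.base ((eight_le π).trans hr)) fun x hx => h.2 x (by omega)

theorem Keeps.setReg {r x : ℕ} {s s' : State} (h : Keeps r s s') (hx : r ≤ x) (v : ℤ) :
    Keeps r s (s'.setReg x v) :=
  ⟨h.1, fun y hy => by rw [setReg_reg, Function.update_of_ne (by omega), h.2 y hy]⟩

/-- `f` is computable in time polynomial in the loop bounds: for every place of the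
context and every register `r` above it there is a program that writes the value of `f` to `r`
and changes no array and no register below `r`. -/
def CompZ (f : Γ → ℤ) : Prop :=
  ∃ T, PolyBounded T ∧ ∀ (π : Place Γ) (r : ℕ), bound π ≤ r → ∃ p, ∀ s,
    Runs p s (T s.base.size) fun s' => Keeps r s s' ∧ s'.reg r = f (read π s)

/-- Computability of a function with values in `ℕ`. -/
def CompN (f : Γ → ℕ) : Prop := CompZ fun γ => (f γ : ℤ)

open Classical in
/-- Decidability of a predicate by a program. -/
def CompP (P : Γ → Prop) : Prop := CompZ fun γ => if P γ then 1 else 0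

/-- `β` is the projection of a context to `Base`. -/
def IsBase (β : Γ → Base) : Prop := ∀ π s, β (read π s) = s.base

theorem CompZ.congr {f g : Γ → ℤ} (hf : CompZ f) (h : ∀ γ, f γ = g γ) : CompZ g := by
  rwa [← funext h]

theorem CompZ.ofExpr {f : Γ → ℤ} (e : Place Γ → Expr) (c : ℕ) (hc : ∀ π, (e π).cost ≤ c)
    (he : ∀ π s, (e π).eval s = f (read π s)) : CompZ f := by
  refine ⟨fun _ => c + 1, .const _, fun π r hr => ⟨.assign r (e π), fun s => ?_⟩⟩
  refine (Runs.assign (Q := fun s' => Keeps r s s' ∧ s'.reg r = f (read π s)) ?_).mono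
    (Nat.succ_le_succ (hc π)) fun _ h => h
  exact ⟨(Keeps.refl r s).setReg le_rfl _, by simp [he]⟩

theorem CompZ.const (k : ℤ) : CompZ fun _ : Γ => k :=
  .ofExpr (fun _ => .const k) 1 (fun _ => le_rfl) fun _ _ => rfl

/-- Post-processing of a value by a fixed program. -/
theorem CompZ.bind {f g : Γ → ℤ} (hf : CompZ f) (p : ℕ → Program) (c : ℕ)
    (hp : ∀ (π : Place Γ) r s, bound π ≤ r → s.reg r = f (read π s) →
      Runs (p r) s c fun s' => Keeps r s s' ∧ s'.reg r = g (read π s)) : CompZ g := by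
  obtain ⟨T, hT, h⟩ := hf
  refine ⟨fun S => T S + c, hT.add (.const c), fun π r hr => ?_⟩
  obtain ⟨q, hq⟩ := h π r hr
  refine ⟨.seq q (p r), fun s => (hq s).seq fun s' hs' => ?_⟩
  have hread := hs'.1.read hr
  refine (hp π r s' hr (by rw [hread, hs'.2])).mono le_rfl fun s'' hs'' => ?_
  exact ⟨hs'.1.trans hs''.1 le_rfl, by rw [hs''.2, hread]⟩

/-- Post-processing of two values by a fixed program. -/
theorem CompZ.bind₂ {f₁ f₂ g : Γ → ℤ} (h₁ : CompZ f₁) (h₂ : CompZ f₂) (p : ℕ → Program) (c : ℕ)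
    (hp : ∀ (π : Place Γ) r s, bound π ≤ r → s.reg r = f₁ (read π s) →
      s.reg (r + 1) = f₂ (read π s) →
      Runs (p r) s c fun s' => Keeps r s s' ∧ s'.reg r = g (read π s)) : CompZ g := by
  obtain ⟨T₁, hT₁, h₁⟩ := h₁
  obtain ⟨T₂, hT₂, h₂⟩ := h₂
  refine ⟨fun S => T₁ S + (T₂ S + c), hT₁.add (hT₂.add (.const c)), fun π r hr => ?_⟩
  obtain ⟨q₁, hq₁⟩ := h₁ π r hr
  obtain ⟨q₂, hq₂⟩ := h₂ π (r + 1) (by omega)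
  refine ⟨.seq q₁ (.seq q₂ (p r)), fun s => (hq₁ s).seq fun s' hs' => ?_⟩
  rw [← hs'.1.base ((eight_le π).trans hr)]
  refine (hq₂ s').seq fun s'' hs'' => ?_
  have hread' := hs'.1.read hr
  have hk : Keeps r s s'' := hs'.1.trans hs''.1 (by omega)
  have hread := hk.read hr
  refine (hp π r s'' hr ?_ ?_).mono le_rfl fun s''' hs''' => ?_
  · rw [hs''.1.2 r (by omega), hs'.2, hread]
  · rw [hs''.2, hread', hread]
  · exact ⟨hk.trans hs'''.1 le_rfl, by rw [hs'''.2, hread]⟩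

theorem CompZ.add {f g : Γ → ℤ} (hf : CompZ f) (hg : CompZ g) : CompZ fun γ => f γ + g γ := by
  refine hf.bind₂ hg (fun r => .assign r (.add (.reg r) (.reg (r + 1)))) 4
    fun π r s hr h1 h2 => ?_
  refine Runs.assign ⟨(Keeps.refl r s).setReg le_rfl _, ?_⟩
  simp [Expr.eval, h1, h2]

theorem CompZ.sub {f g : Γ → ℤ} (hf : CompZ f) (hg : CompZ g) : CompZ fun γ => f γ - g γ := by
  refine hf.bind₂ hg (fun r => .assign r (.sub (.reg r) (.reg (r + 1)))) 4
    fun π r s hr h1 h2 => ?_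
  refine Runs.assign ⟨(Keeps.refl r s).setReg le_rfl _, ?_⟩
  simp [Expr.eval, h1, h2]

theorem CompZ.getW {β : Γ → Base} {f : Γ → ℤ} (hβ : IsBase β) (hf : CompZ f) :
    CompZ fun γ => (β γ).w (f γ) := by
  refine hf.bind (fun r => .assign r (.get 0 (.reg r))) 3 fun π r s hr h1 => ?_
  refine Runs.assign ⟨(Keeps.refl r s).setReg le_rfl _, ?_⟩
  simp [Expr.eval, h1, hβ π s, State.base]

theorem CompZ.getG {β : Γ → Base} {f : Γ → ℤ} (hβ : IsBase β) (hf : CompZ f) :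
    CompZ fun γ => (β γ).G (f γ) := by
  refine hf.bind (fun r => .assign r (.get 2 (.reg r))) 3 fun π r s hr h1 => ?_
  refine Runs.assign ⟨(Keeps.refl r s).setReg le_rfl _, ?_⟩
  simp [Expr.eval, h1, hβ π s, State.base]

theorem CompZ.getH {β : Γ → Base} {f : Γ → ℤ} (hβ : IsBase β) (hf : CompZ f) :
    CompZ fun γ => (β γ).H (f γ) := by
  refine hf.bind (fun r => .assign r (.get 3 (.reg r))) 3 fun π r s hr h1 => ?_
  refine Runs.assign ⟨(Keeps.refl r s).setReg le_rfl _, ?_⟩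
  simp [Expr.eval, h1, hβ π s, State.base]

theorem CompN.sz {β : Γ → Base} (hβ : IsBase β) (k : Fin 4) : CompN fun γ => (β γ).sz k := by
  have : CompZ fun γ => (0 : ℤ) + (β γ).sz k := by
    refine (CompZ.const 0).bind (fun r => .ite (.le (.const 0) (.reg k))
      (.assign r (.reg k)) .skip) 7 fun π r s hr h1 => ?_
    refine (Runs.ite (T₁ := 2) (T₂ := 1) (fun h => Runs.assign ?_) fun h => .skip ?_).mono
      (by simp [Test.cost, Expr.cost]) fun _ h => h
    · refine ⟨(Keeps.refl r s).setReg le_rfl _, ?_⟩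
      simp only [Test.Holds, Expr.eval] at h
      simp [Expr.eval, hβ π s, State.base, h]
    · refine ⟨Keeps.refl r s, ?_⟩
      simp only [Test.Holds, Expr.eval] at h
      simp only [h1, hβ π s, State.base]
      omega
  simpa [CompN] using this

theorem CompZ.ite {P : Γ → Prop} [∀ γ, Decidable (P γ)] {f g : Γ → ℤ} (hP : CompP P)
    (hf : CompZ f) (hg : CompZ g) : CompZ fun γ => if P γ then f γ else g γ := by
  obtain ⟨T, hT, h⟩ := hP
  obtain ⟨T₁, hT₁, h₁⟩ := hf
  obtain ⟨T₂, hT₂, h₂⟩ := hg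
  refine ⟨fun S => T S + (4 + (T₁ S + T₂ S)), hT.add ((PolyBounded.const 4).add (hT₁.add hT₂)),
    fun π r hr => ?_⟩
  obtain ⟨q, hq⟩ := h π r hr
  obtain ⟨q₁, hq₁⟩ := h₁ π r hr
  obtain ⟨q₂, hq₂⟩ := h₂ π r hr
  refine ⟨.seq q (.ite (.not (.eq (.reg r) (.const 0))) q₁ q₂), fun s =>
    (hq s).seq fun s' hs' => ?_⟩
  rw [← hs'.1.base ((eight_le π).trans hr)]
  have hread := hs'.1.read hr
  refine Runs.ite (fun hb => ?_) (fun hb => ?_)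
  · simp only [Test.Holds, Expr.eval, hs'.2] at hb
    have hP : P (Ctx.read π s) := by by_contra hn; simp [hn] at hb
    refine (hq₁ s').mono le_rfl fun s'' hs'' => ⟨hs'.1.trans hs''.1 le_rfl, ?_⟩
    simp only [hs''.2, hread, if_pos hP]
  · simp only [Test.Holds, Expr.eval, hs'.2] at hb
    have hP : ¬ P (Ctx.read π s) := by intro hn; simp [hn] at hb
    refine (hq₂ s').mono le_rfl fun s'' hs'' => ⟨hs'.1.trans hs''.1 le_rfl, ?_⟩
    simp only [hs''.2, hread, if_neg hP]

theorem CompP.le {f g : Γ → ℤ} (hf : CompZ f) (hg : CompZ g) : CompP fun γ => f γ ≤ g γ := by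
  refine hf.bind₂ hg (fun r => .ite (.le (.reg r) (.reg (r + 1))) (.assign r (.const 1))
    (.assign r (.const 0))) 7 fun π r s hr h1 h2 => ?_
  refine Runs.ite (fun hb => Runs.assign ?_) (fun hb => Runs.assign ?_) <;>
    refine ⟨(Keeps.refl r s).setReg le_rfl _, ?_⟩ <;>
    simp only [Test.Holds, Expr.eval, h1, h2] at hb <;> simp [Expr.eval, hb]

theorem CompP.eq {f g : Γ → ℤ} (hf : CompZ f) (hg : CompZ g) : CompP fun γ => f γ = g γ := by
  refine hf.bind₂ hg (fun r => .ite (.eq (.reg r) (.reg (r + 1))) (.assign r (.const 1))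
    (.assign r (.const 0))) 7 fun π r s hr h1 h2 => ?_
  refine Runs.ite (fun hb => Runs.assign ?_) (fun hb => Runs.assign ?_) <;>
    refine ⟨(Keeps.refl r s).setReg le_rfl _, ?_⟩ <;>
    simp only [Test.Holds, Expr.eval, h1, h2] at hb <;> simp [Expr.eval, hb]

theorem CompP.congr {P Q : Γ → Prop} (hP : CompP P) (h : ∀ γ, P γ ↔ Q γ) : CompP Q := by
  have : P = Q := funext fun γ => propext (h γ)
  rwa [← this]

theorem CompP.not {P : Γ → Prop} (hP : CompP P) : CompP fun γ => ¬ P γ := by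
  classical
  exact (CompZ.ite hP (.const 0) (.const 1)).congr fun γ => by
    by_cases h : P γ <;> simp [h]

theorem CompP.and {P Q : Γ → Prop} (hP : CompP P) (hQ : CompP Q) : CompP fun γ => P γ ∧ Q γ := by
  classical
  exact (CompZ.ite hP hQ (.const 0)).congr fun γ => by
    by_cases h : P γ <;> simp [h]

theorem CompP.or {P Q : Γ → Prop} (hP : CompP P) (hQ : CompP Q) : CompP fun γ => P γ ∨ Q γ :=
  (hP.not.and hQ.not).not.congr fun γ => by tauto

theorem CompP.imp {P Q : Γ → Prop} (hP : CompP P) (hQ : CompP Q) : CompP fun γ => P γ → Q γ :=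
  (hP.and hQ.not).not.congr fun γ => by tauto

theorem CompN.const (k : ℕ) : CompN fun _ : Γ => k := CompZ.const _

theorem CompN.add {f g : Γ → ℕ} (hf : CompN f) (hg : CompN g) : CompN fun γ => f γ + g γ :=
  (CompZ.add hf hg).congr fun γ => by push_cast; rfl

theorem CompN.ite {P : Γ → Prop} [∀ γ, Decidable (P γ)] {f g : Γ → ℕ} (hP : CompP P)
    (hf : CompN f) (hg : CompN g) : CompN fun γ => if P γ then f γ else g γ :=
  (CompZ.ite hP hf hg).congr fun γ => by dsimp only; split_ifs <;> rfl

theorem CompP.leN {f g : Γ → ℕ} (hf : CompN f) (hg : CompN g) : CompP fun γ => f γ ≤ g γ :=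
  (CompP.le hf hg).congr fun γ => by simp

theorem CompP.ltN {f g : Γ → ℕ} (hf : CompN f) (hg : CompN g) : CompP fun γ => f γ < g γ :=
  (CompP.leN (hf.add (.const 1)) hg).congr fun γ => by simp

theorem CompP.eqN {f g : Γ → ℕ} (hf : CompN f) (hg : CompN g) : CompP fun γ => f γ = g γ :=
  (CompP.eq hf hg).congr fun γ => by simp

theorem CompN.sub {f g : Γ → ℕ} (hf : CompN f) (hg : CompN g) : CompN fun γ => f γ - g γ :=
  (CompZ.ite (CompP.leN hg hf) (CompZ.sub hf hg) (.const 0)).congr fun γ => by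
    dsimp only; split_ifs <;> omega

/-- The last local variable, if it is a natural number. -/
theorem CompN.last : CompN fun p : Γ × ℕ => p.2 := by
  have : CompZ fun p : Γ × ℕ => (0 : ℤ) + p.2 := by
    refine ⟨fun _ => 2 + 7, .const _, fun π r hr =>
      ⟨.seq (.assign r (.const 0)) (.ite (.le (.const 0) (.reg π.2))
        (.assign r (.reg π.2)) .skip), fun s => ?_⟩⟩
    have hlt : π.2 < r := lt_of_lt_of_le (Nat.lt_succ_self _) ((le_max_right _ _).trans hr)
    refine (Runs.assign (Q := fun s' => s' = s.setReg r 0) rfl).seq ?_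
    rintro _ rfl
    refine (Runs.ite (T₁ := 2) (T₂ := 1) (fun h => Runs.assign ?_) fun h => .skip ?_).mono
      (by simp [Test.cost, Expr.cost]) fun _ h => h
    · refine ⟨((Keeps.refl r s).setReg le_rfl _).setReg le_rfl _, ?_⟩
      simp only [Test.Holds, Expr.eval, setReg_reg, Function.update_of_ne hlt.ne] at h
      simp [Expr.eval, Ctx.read, LocalVar.ofInt, Function.update_of_ne hlt.ne, h]
    · refine ⟨(Keeps.refl r s).setReg le_rfl _, ?_⟩
      simp only [Test.Holds, Expr.eval, setReg_reg, Function.update_of_ne hlt.ne] at h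
      simp only [setReg_reg, Function.update_self, Ctx.read, LocalVar.ofInt]
      omega
  simpa [CompN] using this

/-- The last local variable, if it is an integer. -/
theorem CompZ.last : CompZ fun p : Γ × ℤ => p.2 :=
  .ofExpr (fun π => .reg π.2) 1 (fun _ => le_rfl) fun _ _ => rfl

theorem CompZ.weaken {f : Γ → ℤ} (hf : CompZ f) : CompZ fun p : Γ × α => f p.1 := by
  obtain ⟨T, hT, h⟩ := hf
  exact ⟨T, hT, fun π r hr => h π.1 r ((le_max_left _ _).trans hr)⟩

theorem CompN.weaken {f : Γ → ℕ} (hf : CompN f) : CompN fun p : Γ × α => f p.1 :=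
  CompZ.weaken hf

theorem IsBase.id : IsBase fun b : Base => b := fun _ _ => rfl

theorem IsBase.weaken {β : Γ → Base} (h : IsBase β) : IsBase fun p : Γ × α => β p.1 :=
  fun π s => h π.1 s

/-- Iteration: the value after `N` rounds of `acc ↦ f i acc`, `i = 0, …, N - 1`. -/
def fold {α : Type*} (N : ℕ) (a : α) (f : ℕ → α → α) : α := Nat.rec a f N

@[simp] theorem fold_zero {α : Type*} (a : α) (f : ℕ → α → α) : fold 0 a f = a := rfl

@[simp] theorem fold_succ {α : Type*} (N : ℕ) (a : α) (f : ℕ → α → α) :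
    fold (N + 1) a f = f N (fold N a f) := rfl

theorem CompZ.fold {β : Γ → Base} (hβ : IsBase β) {k : Fin 4} {a : Γ → ℤ} {f : Γ → ℕ → ℤ → ℤ}
    (ha : CompZ a) (hf : CompZ fun p : (Γ × ℕ) × ℤ => f p.1.1 p.1.2 p.2) :
    CompZ fun γ => fold ((β γ).sz k) (a γ) (f γ) := by
  obtain ⟨T, hT, h⟩ := ha
  obtain ⟨T', hT', h'⟩ := hf
  refine ⟨fun S => T S + (2 + (S * (4 + (T' S + (2 + 4))) + 4)),
    hT.add ((PolyBounded.const 2).add ((PolyBounded.id.mul ((PolyBounded.const 4).add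
      (hT'.add (.const _)))).add (.const 4))), fun π r hr => ?_⟩
  obtain ⟨q, hq⟩ := h π r hr
  have hbd : bound (Γ := (Γ × ℕ) × ℤ) ((π, r + 1), r) ≤ r + 2 := by
    change max (max (bound π) (r + 1 + 1)) (r + 1) ≤ r + 2
    omega
  obtain ⟨q', hq'⟩ := h' ((π, r + 1), r) (r + 2) hbd
  have h8 := (eight_le π).trans hr
  have hk := k.2
  refine ⟨.seq q (.seq (.assign (r + 1) (.const 0)) (.loop (.not (.le (.reg k) (.reg (r + 1))))
    (.seq q' (.seq (.assign r (.reg (r + 2)))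
      (.assign (r + 1) (.add (.reg (r + 1)) (.const 1))))))), fun s => (hq s).seq fun s' hs' => ?_⟩
  refine (Runs.assign (Q := fun s'' => s'' = s'.setReg (r + 1) 0) rfl).seq ?_
  rintro _ rfl
  set γ := Ctx.read π s with hγ
  refine (Runs.loop (N := (β γ).sz k) (T := T' s.base.size + (2 + 4))
    (I := fun i s'' => Keeps r s s'' ∧
      s''.reg r = RAM.fold i (a γ) (f γ) ∧ s''.reg (r + 1) = i) ?_ ?_ ?_).mono ?_ ?_
  · rintro i s'' ⟨h1, h2, h3⟩ hi
    simp only [Test.Holds, Expr.eval, h3, h1.2 k (by omega), hγ, hβ π s, State.base]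
    omega
  · rintro i s'' ⟨h1, h2, h3⟩ hi
    rw [← h1.base h8]
    refine (hq' s'').seq fun s₃ h₃ => ?_
    have hread : Ctx.read (Γ := (Γ × ℕ) × ℤ) ((π, r + 1), r) s''
        = ((γ, i), RAM.fold i (a γ) (f γ)) := by
      change ((Ctx.read π s'', (s''.reg (r + 1)).toNat), s''.reg r) = _
      rw [h1.read hr, h2, h3]; simp [hγ]
    rw [hread] at h₃
    refine (Runs.assign (Q := fun s₄ => s₄ = s₃.setReg r (s₃.reg (r + 2))) rfl).seq ?_
    rintro _ rfl
    refine Runs.assign ⟨?_, ?_, ?_⟩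
    · exact ((h1.trans h₃.1 (by omega)).setReg le_rfl _).setReg (by omega) _
    · simp [h₃.2]
    · have := h₃.1.2 (r + 1) (by omega)
      simp [Expr.eval, this, h3]
  · exact ⟨hs'.1.setReg (by omega) _, by simpa using hs'.2, by simp⟩
  · have : (β γ).sz k ≤ s.base.size := by rw [hγ, hβ π s]; exact Base.sz_le_size _ _
    have := Nat.mul_le_mul_right (4 + (T' s.base.size + (2 + 4))) this
    change _ * (4 + _) + 4 ≤ _
    omega
  · rintro s'' ⟨h1, h2, -⟩
    exact ⟨h1, h2⟩

theorem CompZ.ofNatVar {f : Γ × ℕ → ℤ} (hf : CompZ f) :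
    CompZ fun p : Γ × ℤ => f (p.1, p.2.toNat) := by
  obtain ⟨T, hT, h⟩ := hf
  exact ⟨T, hT, fun π r hr => h π r hr⟩

theorem CompN.fold {β : Γ → Base} (hβ : IsBase β) {k : Fin 4} {a : Γ → ℕ} {f : Γ → ℕ → ℕ → ℕ}
    (ha : CompN a) (hf : CompN fun p : (Γ × ℕ) × ℕ => f p.1.1 p.1.2 p.2) :
    CompN fun γ => RAM.fold ((β γ).sz k) (a γ) (f γ) := by
  refine (CompZ.fold hβ (k := k) (f := fun γ i z => (f γ i z.toNat : ℤ)) ha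
    (CompZ.ofNatVar hf)).congr fun γ => ?_
  beta_reduce
  generalize (β γ).sz k = N
  induction N with
  | zero => rfl
  | succ N ih => simp [ih]

theorem CompZ.sum {β : Γ → Base} (hβ : IsBase β) {k : Fin 4} {f : Γ → ℕ → ℤ}
    (hf : CompZ fun p : Γ × ℕ => f p.1 p.2) :
    CompZ fun γ => ∑ i ∈ Finset.range ((β γ).sz k), f γ i := by
  refine (CompZ.fold hβ (k := k) (f := fun γ i acc => acc + f γ i) (.const 0)
    (CompZ.add .last (CompZ.weaken hf))).congr fun γ => ?_
  generalize (β γ).sz k = N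
  induction N with
  | zero => rfl
  | succ N ih => rw [Finset.sum_range_succ, fold_succ, ih]

theorem CompN.sum {β : Γ → Base} (hβ : IsBase β) {k : Fin 4} {f : Γ → ℕ → ℕ}
    (hf : CompN fun p : Γ × ℕ => f p.1 p.2) :
    CompN fun γ => ∑ i ∈ Finset.range ((β γ).sz k), f γ i :=
  (CompZ.sum hβ (k := k) (f := fun γ i => (f γ i : ℤ)) hf).congr fun γ => by push_cast; rfl

theorem CompP.exists {β : Γ → Base} (hβ : IsBase β) {k : Fin 4} {P : Γ → ℕ → Prop}
    (hP : CompP fun p : Γ × ℕ => P p.1 p.2) :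
    CompP fun γ => ∃ i < (β γ).sz k, P γ i := by
  classical
  refine (CompZ.fold hβ (k := k) (f := fun γ i acc => if P γ i then 1 else acc) (.const 0)
    (CompZ.ite (CompZ.weaken hP) (.const 1) .last)).congr fun γ => ?_
  suffices H : ∀ N, RAM.fold N (0 : ℤ) (fun i acc => if P γ i then 1 else acc) =
      if ∃ i < N, P γ i then 1 else 0 by
    refine (H _).trans ?_
    congr
  intro N
  induction N with
  | zero => simp
  | succ N ih =>
    rw [fold_succ, ih]
    by_cases h : P γ N
    · rw [if_pos h, if_pos ⟨N, by omega, h⟩]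
    · rw [if_neg h]
      congr 1
      refine propext ⟨fun ⟨i, hi, h'⟩ => ⟨i, by omega, h'⟩, fun ⟨i, hi, h'⟩ => ⟨i, ?_, h'⟩⟩
      rcases (show i < N ∨ i = N by omega) with h1 | rfl
      · exact h1
      · exact absurd h' h

theorem CompP.forall {β : Γ → Base} (hβ : IsBase β) {k : Fin 4} {P : Γ → ℕ → Prop}
    (hP : CompP fun p : Γ × ℕ => P p.1 p.2) :
    CompP fun γ => ∀ i < (β γ).sz k, P γ i :=
  (CompP.exists hβ (k := k) (P := fun γ i => ¬ P γ i) (CompP.not hP)).not.congr fun γ => by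
    push Not; rfl

theorem CompN.szMul {β : Γ → Base} (hβ : IsBase β) (k : Fin 4) {f : Γ → ℕ} (hf : CompN f) :
    CompN fun γ => (β γ).sz k * f γ :=
  (CompN.sum hβ (k := k) (f := fun γ _ => f γ) (CompZ.weaken hf)).congr fun γ => by simp

/-- The maximum of `0` and of the values `f i`, `i < N`. -/
def maxUpto (N : ℕ) (f : ℕ → ℤ) : ℤ := fold N 0 fun i acc => if acc ≤ f i then f i else acc

theorem maxUpto_nonneg (N : ℕ) (f : ℕ → ℤ) : 0 ≤ maxUpto N f := by
  induction N with
  | zero => exact le_rfl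
  | succ N ih =>
    rw [maxUpto, fold_succ]; rw [maxUpto] at ih
    split_ifs with h
    · exact ih.trans h
    · exact ih

theorem le_maxUpto {N : ℕ} (f : ℕ → ℤ) {i : ℕ} (hi : i < N) : f i ≤ maxUpto N f := by
  induction N with
  | zero => omega
  | succ N ih =>
    rw [maxUpto, fold_succ]; rw [maxUpto] at ih
    rcases (show i < N ∨ i = N by omega) with h | rfl
    · have := ih h
      split_ifs with h'
      · exact this.trans h'
      · exact this
    · split_ifs with h'
      · exact le_rfl
      · omega

theorem maxUpto_eq (N : ℕ) (f : ℕ → ℤ) : maxUpto N f = 0 ∨ ∃ i < N, maxUpto N f = f i := by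
  induction N with
  | zero => exact .inl rfl
  | succ N ih =>
    rw [maxUpto, fold_succ]; rw [maxUpto] at ih
    split_ifs with h'
    · exact .inr ⟨N, by omega, rfl⟩
    · rcases ih with h | ⟨i, hi, h⟩
      · exact .inl h
      · exact .inr ⟨i, by omega, h⟩

theorem CompZ.maxUpto {β : Γ → Base} (hβ : IsBase β) {k : Fin 4} {f : Γ → ℕ → ℤ}
    (hf : CompZ fun p : Γ × ℕ => f p.1 p.2) :
    CompZ fun γ => maxUpto ((β γ).sz k) (f γ) :=
  CompZ.fold hβ (k := k) (f := fun γ i acc => if acc ≤ f γ i then f γ i else acc) (.const 0)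
    (CompZ.ite (CompP.le .last (CompZ.weaken hf)) (CompZ.weaken hf) .last)

end RAM

/-! ### Configurations of the dynamic program -/

/-- A configuration of the dynamic program: `K` boundary slots, where slot `l` holds the vertex
`v` if `s l = v + 1` and is empty if `s l = 0`. A vertex in slot `l` belongs to the coalition with
name `a l`, whose size is at most `m l`, and `b l` further members of this coalition may be
chosen. The pending vertices are those of the components, adjacent to the vertex in slot `i` and
with least vertex at least `j`, of the graph without the boundary. -/
structure Cfg where
  i : ℕ
  j : ℕ
  s : ℕ → ℕ
  a : ℕ → ℕ
  m : ℕ → ℕ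
  b : ℕ → ℕ

/-- `adj` is the adjacency relation of a simple graph on the vertices `0, …, n - 1`. -/
structure IsAdj (n : ℕ) (adj : ℕ → ℕ → Prop) : Prop where
  symm : ∀ {u v}, adj u v → adj v u
  irrefl : ∀ u, ¬ adj u u
  left_lt : ∀ {u v}, adj u v → u < n

namespace Cfg

/-- `v` is a boundary vertex. -/
def InS (K : ℕ) (X : Cfg) (v : ℕ) : Prop := ∃ l < K, X.s l = v + 1

/-- `p` and `q` are connected by a path that avoids the boundary. -/
def Conn (n K : ℕ) (adj : ℕ → ℕ → Prop) (X : Cfg) (p q : ℕ) : Prop :=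
  p < n ∧ q < n ∧
    Relation.ReflTransGen (fun u v => adj u v ∧ ¬ X.InS K u ∧ ¬ X.InS K v) p q

/-- `v` is a pending vertex. The relation `R` stands for `Cfg.Conn`; it is a parameter because
the program uses a computed version of it. -/
def InD (n K : ℕ) (adj : ℕ → ℕ → Prop) (R : Cfg → ℕ → ℕ → Prop) (X : Cfg) (v : ℕ) : Prop :=
  v < n ∧ ¬ X.InS K v ∧
    (∀ l < K, l = X.i → ∀ u < n, X.s l = u + 1 → ∃ v₀ < n, adj u v₀ ∧ R X v₀ v) ∧
    ∀ w < n, w < X.j → ¬ R X v w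

/-- The two configurations have the same boundary. -/
def SameS (K : ℕ) (X Z : Cfg) : Prop := Z.i = X.i ∧ ∀ l < K, Z.s l = X.s l

/-- `X.j` is not the least vertex of a pending component, and `Z` passes to the next vertex. -/
def Skip (n K : ℕ) (adj : ℕ → ℕ → Prop) (R : Cfg → ℕ → ℕ → Prop) (X Z : Cfg) : Prop :=
  X.j < n ∧ ¬ InD n K adj R X X.j ∧ SameS K X Z ∧ Z.j = X.j + 1

/-- `X.j` is the least vertex of a pending component. In `Y` a vertex of this component has been
added to the boundary; it replaces a vertex not adjacent to the component. The configuration `Z`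
takes care of the other pending components. -/
def Branch (n K : ℕ) (adj : ℕ → ℕ → Prop) (R : Cfg → ℕ → ℕ → Prop) (X Y Z : Cfg) : Prop :=
  X.j < n ∧ InD n K adj R X X.j ∧ Y.i < K ∧ Y.j = 0 ∧
    (∃ u < n, Y.s Y.i = u + 1 ∧ R X X.j u) ∧ (∀ l < K, l ≠ Y.i → Y.s l = X.s l) ∧
    (∀ t < n, X.s Y.i = t + 1 → ∀ v < n, R X X.j v → ¬ adj t v) ∧
    SameS K X Z ∧ Z.j = X.j + 1

/-- The coalition data of the boundary do not change, and the budgets do not increase. -/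
def SkipB (K : ℕ) (X Z : Cfg) : Prop :=
  ∀ l < K, Z.a l = X.a l ∧ Z.m l = X.m l ∧ Z.b l ≤ X.b l

/-- The new boundary vertex of `Y` either joins the coalition of a boundary vertex of `X` or
founds a coalition, which is named after it, and the budgets of `X` suffice for the new vertex and
for the budgets of `Y` and `Z`. -/
def BranchB (n K : ℕ) (X Y Z : Cfg) : Prop :=
  SkipB K X Z ∧
  (∀ l < K, l ≠ Y.i → Y.a l = X.a l ∧ Y.m l = X.m l) ∧
  (∀ l < K, X.s l ≠ 0 → ∀ l' < K, Y.s l' ≠ 0 → Y.a l' = X.a l →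
    Y.b l' + Z.b l + (if Y.a Y.i = X.a l then 1 else 0) ≤ X.b l) ∧
  ((Y.a Y.i + 1 = Y.s Y.i ∧ Y.b Y.i + 1 ≤ Y.m Y.i ∧ Y.m Y.i ≤ n) ∨
    ∃ l < K, X.s l ≠ 0 ∧ X.a l = Y.a Y.i ∧ X.m l = Y.m Y.i)

section
variable {n K : ℕ} {adj : ℕ → ℕ → Prop} {X Y Z : Cfg} {u v w p q : ℕ}

theorem SameS.inS (h : SameS K X Z) : Z.InS K v ↔ X.InS K v := by
  unfold InS
  exact exists_congr fun l => and_congr_right fun hl => by rw [h.2 l hl]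

theorem SameS.conn (h : SameS K X Z) : Z.Conn n K adj p q ↔ X.Conn n K adj p q := by
  unfold Conn
  simp only [h.inS]

theorem Conn.symm (ha : IsAdj n adj) (h : X.Conn n K adj p q) : X.Conn n K adj q p := by
  refine ⟨h.2.1, h.1, ?_⟩
  exact Relation.ReflTransGen.mono (fun _ _ h => ⟨ha.symm h.1, h.2.2, h.2.1⟩) _ _ h.2.2.swap

theorem Conn.trans (h : X.Conn n K adj p q) (h' : X.Conn n K adj q v) : X.Conn n K adj p v :=
  ⟨h.1, h'.2.1, h.2.2.trans h'.2.2⟩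

theorem Conn.refl (h : p < n) : X.Conn n K adj p p := ⟨h, h, .refl⟩

theorem Conn.of_adj (ha : IsAdj n adj) (h : adj p q) (hp : ¬ X.InS K p) (hq : ¬ X.InS K q) :
    X.Conn n K adj p q := ⟨ha.left_lt h, ha.left_lt (ha.symm h), .single ⟨h, hp, hq⟩⟩

theorem Conn.not_inS (h : X.Conn n K adj p q) (hp : ¬ X.InS K p) : ¬ X.InS K q := by
  rcases h.2.2.cases_tail with h | ⟨r, -, h⟩
  · rwa [h]
  · exact h.2.2

local notation "D[" X "]" => InD n K adj (Conn n K adj) X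

theorem InD.of_conn (h : D[X] v) (h' : X.Conn n K adj v w) : D[X] w := by
  refine ⟨h'.2.1, h'.not_inS h.2.1, fun l hl hli u hu hs => ?_, fun t ht htj hw => ?_⟩
  · obtain ⟨v₀, hv₀, h1, h2⟩ := h.2.2.1 l hl hli u hu hs
    exact ⟨v₀, hv₀, h1, h2.trans h'⟩
  · exact h.2.2.2 t ht htj (h'.trans hw)

theorem InD.of_adj (ha : IsAdj n adj) (h : D[X] v) (h' : adj v w) (hw : ¬ X.InS K w) : D[X] w :=
  h.of_conn (.of_adj ha h' h.2.1 hw)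

theorem SameS.inD_iff (h : SameS K X Z) (hj : Z.j = X.j + 1) (hn : X.j < n) :
    D[Z] v ↔ D[X] v ∧ ¬ X.Conn n K adj v X.j := by
  unfold InD
  rw [h.inS, h.1, hj]
  simp only [h.conn]
  constructor
  · rintro ⟨h1, h2, h3, h4⟩
    refine ⟨⟨h1, h2, fun l hl hli u hu hs => ?_, fun w hw hwj => h4 w hw (by omega)⟩,
      h4 _ hn (by omega)⟩
    exact h3 l hl hli u hu (by rw [h.2 l hl, hs])
  · rintro ⟨⟨h1, h2, h3, h4⟩, h5⟩
    refine ⟨h1, h2, fun l hl hli u hu hs => ?_, fun w hw hwj => ?_⟩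
    · exact h3 l hl hli u hu (by rw [← h.2 l hl, hs])
    · rcases (show w < X.j ∨ w = X.j by omega) with h | rfl
      · exact h4 w hw h
      · exact h5

theorem Skip.inD_iff (h : Skip n K adj (Conn n K adj) X Z) :
    D[Z] v ↔ D[X] v := by
  rw [h.2.2.1.inD_iff h.2.2.2 h.1, and_iff_left_iff_imp]
  exact fun h1 h2 => h.2.1 (h1.of_conn h2)

/-- No vertex is pending once `X.j` has passed all vertices. -/
theorem not_inD_of_le (hj : n ≤ X.j) : ¬ D[X] v := fun h =>
  h.2.2.2 v h.1 (h.1.trans_le hj) (.refl h.1)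

variable (ha : IsAdj n adj) (h : Branch n K adj (Conn n K adj) X Y Z)
include ha h

/-- The pending components of `X` are those of `Z` and the component of `X.j`. -/
theorem Branch.inD_iff : D[X] v ↔ D[Z] v ∨ X.Conn n K adj X.j v := by
  rw [h.2.2.2.2.2.2.2.1.inD_iff h.2.2.2.2.2.2.2.2 h.1]
  constructor
  · intro h1
    by_cases h2 : X.Conn n K adj v X.j
    · exact .inr (h2.symm ha)
    · exact .inl ⟨h1, h2⟩
  · rintro (h1 | h1)
    · exact h1.1
    · exact h.2.1.of_conn h1

theorem Branch.not_both (h1 : D[Z] v) (h2 : X.Conn n K adj X.j v) : False := by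
  rw [h.2.2.2.2.2.2.2.1.inD_iff h.2.2.2.2.2.2.2.2 h.1] at h1
  exact h1.2 (h2.symm ha)

omit ha in
theorem Branch.not_inD_new (hu : Y.s Y.i = u + 1) : ¬ D[Y] u :=
  fun h1 => h1.2.1 ⟨_, h.2.2.1, hu⟩

omit ha in
theorem Branch.conn_new (hu : Y.s Y.i = u + 1) : X.Conn n K adj X.j u := by
  obtain ⟨u', hu', h1, h2⟩ := h.2.2.2.2.1
  rwa [show u = u' by omega]

/-- A vertex adjacent to the component of `X.j` lies in it or on the boundary of `Y`. -/
theorem Branch.conn_or_inS (hp : X.Conn n K adj X.j p) (hq : adj p q) (hY : ¬ Y.InS K q) :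
    X.Conn n K adj X.j q := by
  have hjS := h.2.1.2.1
  by_cases hqS : X.InS K q
  · obtain ⟨l, hl, h1⟩ := hqS
    by_cases hli : l = Y.i
    · subst hli
      exact absurd (ha.symm hq)
        (h.2.2.2.2.2.2.1 q (ha.left_lt (ha.symm hq)) h1 p (ha.left_lt hq) hp)
    · exact absurd ⟨l, hl, by rw [h.2.2.2.2.2.1 l hl hli, h1]⟩ hY
  · exact hp.trans (.of_adj ha hq (hp.not_inS hjS) hqS)

/-- The component of `X.j` consists of the new boundary vertex and the pending vertices of
`Y`. -/
theorem Branch.conn_iff (hu : Y.s Y.i = u + 1) :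
    X.Conn n K adj X.j v ↔ v = u ∨ D[Y] v := by
  have hju := h.conn_new hu
  have hjS := h.2.1.2.1
  have hY0 : ∀ w < n, w < Y.j → ¬ Y.Conn n K adj v w := by
    intro w _ hw; rw [h.2.2.2.1] at hw; omega
  constructor
  · intro hv
    have huv := ((hju.symm ha).trans hv).2.2
    clear hv hY0
    induction huv with
    | refl => exact .inl rfl
    | @tail x y hux hxy ih =>
      have hxC : X.Conn n K adj X.j x := hju.trans ⟨hju.2.1, ha.left_lt hxy.1, hux⟩
      have hyn := ha.left_lt (ha.symm hxy.1)
      by_cases hyu : y = u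
      · exact .inl hyu
      right
      have hyY : ¬ Y.InS K y := by
        rintro ⟨l, hl, h1⟩
        by_cases hli : l = Y.i
        · subst hli; omega
        · rw [h.2.2.2.2.2.1 l hl hli] at h1
          exact hxy.2.2 ⟨l, hl, h1⟩
      rcases ih with rfl | ih
      · refine ⟨hyn, hyY, fun l hl hli u' hu' hs => ⟨y, hyn, ?_, .refl hyn⟩, ?_⟩
        · rw [hli, hu] at hs
          obtain rfl : u' = x := by omega
          exact hxy.1
        · intro w _ hw; rw [h.2.2.2.1] at hw; omega
      · exact ih.of_adj ha hxy.1 hyY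
  · rintro (rfl | hv)
    · exact hju
    · obtain ⟨v₀, hv₀, h1, h2⟩ := hv.2.2.1 _ h.2.2.1 rfl u hju.2.1 hu
      have hv₀S : ¬ Y.InS K v₀ := (h2.symm ha).not_inS hv.2.1
      have h3 := h.conn_or_inS ha hju h1 hv₀S
      have h4 := h2.2.2
      clear h2 hv hY0
      induction h4 with
      | refl => exact h3
      | @tail x y hux hxy ih =>
        exact h.conn_or_inS ha ih hxy.1 hxy.2.2

end

end Cfg

/-! ### The value of a choice of coalitions -/

namespace Cfg

open Classical in
/-- The total value of the ordered pairs of adjacent vertices in the same coalition that meet `D`,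
where `c v` is the name of the coalition of `v`, and `μ q` is the claimed size of coalition `q`. -/
noncomputable def pairSum (n : ℕ) (adj : ℕ → ℕ → Prop) (val : ℕ → ℕ → ℕ → ℤ) (D : ℕ → Prop)
    (c μ : ℕ → ℕ) : ℤ :=
  ∑ u ∈ Finset.range n, ∑ v ∈ Finset.range n,
    if adj u v ∧ c u = c v ∧ (D u ∨ D v) then val u v (μ (c u)) else 0

open Classical in
/-- The number of vertices in `D` that belong to coalition `q`. -/
noncomputable def count (n : ℕ) (D : ℕ → Prop) (c : ℕ → ℕ) (q : ℕ) : ℕ :=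
  ∑ v ∈ Finset.range n, if D v ∧ c v = q then 1 else 0

open Classical in
/-- The value of the pairs formed by the new boundary vertex of `Y` and the members of its
coalition on the boundary of `X`. -/
noncomputable def gain (n K : ℕ) (adj : ℕ → ℕ → Prop) (val : ℕ → ℕ → ℕ → ℤ) (X Y : Cfg) : ℤ :=
  ∑ u ∈ Finset.range n, ∑ v ∈ Finset.range n,
    if Y.s Y.i = u + 1 ∧ adj u v ∧ ∃ l < K, X.s l = v + 1 ∧ X.a l = Y.a Y.i then
      val u v (Y.m Y.i) + val v u (Y.m Y.i) else 0

section
variable {n K : ℕ} {adj : ℕ → ℕ → Prop} {val : ℕ → ℕ → ℕ → ℤ} {X Y Z : Cfg} {c μ : ℕ → ℕ}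
  {D : ℕ → Prop} {u v q : ℕ}

theorem count_eq_zero (h : ∀ v, D v → c v ≠ q) : count n D c q = 0 := by
  refine Finset.sum_eq_zero fun v _ => if_neg ?_
  rintro ⟨h1, h2⟩
  exact h v h1 h2

theorem count_congr {c' : ℕ → ℕ} (h : ∀ v, D v → c v = c' v) : count n D c q = count n D c' q := by
  refine Finset.sum_congr rfl fun v _ => ?_
  by_cases hv : D v
  · rw [h v hv]
  · simp [hv]

theorem count_mono {D' : ℕ → Prop} (h : ∀ v, D v → D' v) : count n D c q ≤ count n D' c q := by
  refine Finset.sum_le_sum fun v _ => ?_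
  split_ifs with h1 h2
  · exact le_rfl
  · exact absurd ⟨h v h1.1, h1.2⟩ h2
  · exact Nat.zero_le _
  · exact le_rfl

local notation "D[" X "]" => InD n K adj (Conn n K adj) X

/-- The pending vertices of `X` are those of `Z`, the new boundary vertex, and those of `Y`. -/
theorem Branch.count_eq (ha : IsAdj n adj) (h : Branch n K adj (Conn n K adj) X Y Z)
    (hu : Y.s Y.i = u + 1) :
    count n D[X] c q = count n D[Z] c q + (if c u = q then 1 else 0) + count n D[Y] c q := by
  classical
  have hun := (h.conn_new hu).2.1
  have : (if c u = q then 1 else 0) = ∑ v ∈ Finset.range n, if v = u ∧ c v = q then 1 else 0 := by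
    rw [Finset.sum_eq_single u]
    · simp
    · rintro v - hv; simp [hv]
    · intro h; exact absurd (Finset.mem_range.2 hun) h
  rw [this]
  simp only [count]
  rw [← Finset.sum_add_distrib, ← Finset.sum_add_distrib]
  refine Finset.sum_congr rfl fun v _ => ?_
  have h1 := h.inD_iff ha (v := v)
  have h2 := h.not_both ha (v := v)
  have h3 := h.conn_iff ha (v := v) hu
  have h4 := h.not_inD_new hu
  by_cases hv : v = u
  · subst hv
    by_cases hq : c v = q <;> grind
  · by_cases hq : c v = q <;> grind

/-- A pair that meets the pending vertices of `X` either consists of the new boundary vertex and a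
boundary vertex of `X`, or meets the pending vertices of exactly one of `Y` and `Z`, since no edge
joins them. -/
theorem Branch.pairSum_eq (ha : IsAdj n adj) (h : Branch n K adj (Conn n K adj) X Y Z)
    (hu : Y.s Y.i = u + 1) (hc : ∀ l < K, ∀ t, X.s l = t + 1 → (c t = c u ↔ X.a l = Y.a Y.i))
    (hμ : μ (c u) = Y.m Y.i) :
    pairSum n adj val D[X] c μ =
      gain n K adj val X Y + pairSum n adj val D[Y] c μ + pairSum n adj val D[Z] c μ := by
  classical
  have hun := (h.conn_new hu).2.1
  have hgain : gain n K adj val X Y = ∑ p ∈ Finset.range n, ∑ r ∈ Finset.range n,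
      ((if p = u then if adj p r ∧ X.InS K r ∧ c r = c u then val p r (μ (c p)) else 0 else 0) +
        if r = u then if adj p r ∧ X.InS K p ∧ c p = c u then val p r (μ (c p)) else 0 else 0) := by
    have e1 : ∀ p ∈ Finset.range n, ∀ r ∈ Finset.range n, (adj p r →
        ((∃ l < K, X.s l = r + 1 ∧ X.a l = Y.a Y.i) ↔ X.InS K r ∧ c r = c u)) := by
      rintro p - r - -
      constructor
      · rintro ⟨l, hl, h1, h2⟩
        exact ⟨⟨l, hl, h1⟩, (hc l hl r h1).2 h2⟩
      · rintro ⟨⟨l, hl, h1⟩, h2⟩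
        exact ⟨l, hl, h1, (hc l hl r h1).1 h2⟩
    simp only [Finset.sum_add_distrib]
    rw [Finset.sum_comm (f := fun p r =>
      if r = u then if adj p r ∧ X.InS K p ∧ c p = c u then val p r (μ (c p)) else 0 else 0)]
    rw [← Finset.sum_add_distrib]
    refine Finset.sum_congr rfl fun p hp => ?_
    rw [← Finset.sum_add_distrib]
    refine Finset.sum_congr rfl fun r hr => ?_
    by_cases hpu : p = u
    · subst hpu
      by_cases hA : adj p r
      · have hE := e1 p hp r hr hA
        by_cases hB : X.InS K r ∧ c r = c p
        · have h2 : adj r p := ha.symm hA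
          rw [if_pos ⟨hu, hA, hE.2 hB⟩, if_pos rfl, if_pos rfl, if_pos ⟨hA, hB⟩,
            if_pos ⟨h2, hB⟩, hB.2, hμ]
        · rw [if_neg (fun hh => hB (hE.1 hh.2.2)), if_pos rfl, if_pos rfl,
            if_neg (fun hh => hB hh.2), if_neg (fun hh => hB hh.2), add_zero]
      · have h2 : ¬ adj r p := fun h => hA (ha.symm h)
        simp [hA, h2]
    · rw [if_neg (by omega), if_neg hpu, if_neg hpu, add_zero]
  rw [hgain]
  simp only [pairSum]
  simp only [← Finset.sum_add_distrib]
  refine Finset.sum_congr rfl fun p _ => Finset.sum_congr rfl fun r _ => ?_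
  by_cases hA : adj p r
  swap
  · simp [hA]
  by_cases hB : c p = c r
  swap
  · have hB' : ¬ c r = c p := fun h => hB h.symm
    simp only [hA, hB, false_and, and_false, if_false, add_zero]
    by_cases hpu : p = u
    · subst hpu; simp [hB']; rintro rfl; exact absurd rfl hB
    · by_cases hru : r = u
      · subst hru; simp [hB]
        exact fun h => absurd h hpu
      · simp [hpu, hru]
  have hA' := ha.symm hA
  have hpr : p ≠ r := by rintro rfl; exact ha.irrefl _ hA
  simp only [hA, hB, true_and]
  -- each endpoint is the new vertex, a pending vertex of `Y` or of `Z`, or not pending in `X`; the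
  -- facts `c1`, `c2`, `o1`, `o2` about edges leaving the component of `X.j` exclude all other cases
  have d1 := fun v => h.inD_iff ha (v := v)
  have d2 := fun v => h.not_both ha (v := v)
  have d3 := fun v => h.conn_iff ha (v := v) hu
  have d4 := h.not_inD_new hu
  have d5 : ∀ v, D[X] v → ¬ X.InS K v := fun v hv => hv.2.1
  have cross : ∀ {p r}, adj p r → X.Conn n K adj X.j p → ¬ D[Z] r := by
    intro p r hpr hp hr
    have := hp.trans (.of_adj ha hpr (hp.not_inS h.2.1.2.1) (d5 r ((d1 r).2 (.inl hr))))
    exact d2 r hr this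
  have c1 := cross hA
  have c2 := cross hA'
  have out : ∀ {p r}, adj p r → X.Conn n K adj X.j p → ¬ D[X] r → X.InS K r := by
    intro p r hpr hp hr
    by_contra hS
    exact hr (((d1 p).2 (.inr hp)).of_adj ha hpr hS)
  have o1 := out hA
  have o2 := out hA'
  clear cross out hgain hc
  have p1 := d1 p; have p2 := d2 p; have p3 := d3 p; have p5 := d5 p
  have r1 := d1 r; have r2 := d2 r; have r3 := d3 r; have r5 := d5 r
  clear d1 d2 d3 d5
  by_cases hpu : p = u
  · subst hpu
    have hrp : ¬ r = p := fun h => hpr h.symm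
    simp only [if_true, hrp, if_false, add_zero]
    grind
  · by_cases hru : r = u
    · subst hru
      simp only [if_true, hpu, if_false, zero_add]
      grind
    · simp only [hpu, hru, if_false, zero_add]
      grind

end

end Cfg

/-! ### Computed values are attained -/

namespace Cfg

/-- The value `x` is attained by a choice of coalitions for the pending vertices of `X` that keeps
to the budgets: every choice `c`, `μ` of coalition names and sizes that agrees with `X` on the
boundary can be changed on the pending vertices so that they contribute `x`. New coalitions are
named after pending vertices. -/
def Attains (n K : ℕ) (adj : ℕ → ℕ → Prop) (val : ℕ → ℕ → ℕ → ℤ) (X : Cfg) (x : ℤ) : Prop :=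
  ∀ c₀ μ₀ : ℕ → ℕ,
    (∀ l < K, ∀ u, X.s l = u + 1 →
      c₀ u = X.a l ∧ μ₀ (X.a l) = X.m l ∧ ¬ InD n K adj (Conn n K adj) X (X.a l)) →
    (∀ q, μ₀ q ≤ n) →
    ∃ c μ : ℕ → ℕ,
      (∀ v, ¬ InD n K adj (Conn n K adj) X v → c v = c₀ v ∧ μ v = μ₀ v) ∧
      (∀ q, μ q ≤ n) ∧
      (∀ v, InD n K adj (Conn n K adj) X v →
        InD n K adj (Conn n K adj) X (c v) ∨ ∃ l < K, X.s l ≠ 0 ∧ c v = X.a l) ∧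
      (∀ l < K, X.s l ≠ 0 → count n (InD n K adj (Conn n K adj) X) c (X.a l) ≤ X.b l) ∧
      (∀ q, InD n K adj (Conn n K adj) X q →
        count n (InD n K adj (Conn n K adj) X) c q ≤ μ q) ∧
      pairSum n adj val (InD n K adj (Conn n K adj) X) c μ = x

section
variable {n K : ℕ} {adj : ℕ → ℕ → Prop} {val : ℕ → ℕ → ℕ → ℤ} {X Y Z : Cfg} {x y z : ℤ}
  {u v q : ℕ}

local notation "D[" X "]" => InD n K adj (Conn n K adj) X

/-- All pending vertices may form coalitions of their own. -/
theorem attains_zero (ha : IsAdj n adj) : Attains n K adj val X 0 := by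
  classical
  intro c₀ μ₀ h0 hn
  refine ⟨fun v => if D[X] v then v else c₀ v, fun v => if D[X] v then 1 else μ₀ v,
    fun v hv => by simp [hv], fun q => ?_, fun v hv => .inl (by simp [hv]), fun l hl hs => ?_,
    fun q hq => ?_, ?_⟩
  · dsimp only
    split_ifs with h
    · have := h.1; omega
    · exact hn q
  · obtain ⟨u, hu⟩ := Nat.exists_eq_succ_of_ne_zero hs
    rw [count_eq_zero]
    · exact Nat.zero_le _
    · intro v hv
      simp only [hv, if_true]
      rintro rfl
      exact (h0 l hl u hu).2.2 hv
  · simp only [hq, if_true, count]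
    rw [Finset.sum_eq_single q]
    · split_ifs <;> simp
    · intro v _ hvq
      rw [if_neg]
      rintro ⟨h1, h2⟩
      simp [h1] at h2
      exact hvq h2
    · intro h; exact absurd (Finset.mem_range.2 hq.1) h
  · refine Finset.sum_eq_zero fun p _ => Finset.sum_eq_zero fun r _ => if_neg ?_
    have key : ∀ p r, adj p r → D[X] p →
        (if D[X] p then p else c₀ p) ≠ (if D[X] r then r else c₀ r) := by
      intro p r hpr hp he
      rw [if_pos hp] at he
      by_cases hr : D[X] r
      · rw [if_pos hr] at he
        subst he
        exact ha.irrefl _ hpr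
      · rw [if_neg hr] at he
        by_cases hS : X.InS K r
        · obtain ⟨l, hl, h1⟩ := hS
          have := h0 l hl r h1
          rw [← this.1, ← he] at this
          exact this.2.2 hp
        · exact hr (hp.of_adj ha hpr hS)
    rintro ⟨h1, h2, h3 | h3⟩
    · exact key p r h1 h3 h2
    · exact key r p (ha.symm h1) h3 h2.symm

theorem Attains.skip (h : Skip n K adj (Conn n K adj) X Z) (hb : SkipB K X Z)
    (hz : Attains n K adj val Z x) : Attains n K adj val X x := by
  have hD : D[Z] = D[X] := funext fun v => propext h.inD_iff
  unfold Attains at hz ⊢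
  rw [hD] at hz
  intro c₀ μ₀ h0 hn
  obtain ⟨c, μ, h1, h2, h3, h4, h5, h6⟩ := hz c₀ μ₀ (fun l hl u hu => by
    rw [(hb l hl).1, (hb l hl).2.1]
    exact h0 l hl u (by rw [← h.2.2.1.2 l hl, hu])) hn
  refine ⟨c, μ, h1, h2, fun v hv => ?_, fun l hl hs => ?_, h5, h6⟩
  · refine (h3 v hv).imp_right ?_
    rintro ⟨l, hl, h7, h8⟩
    exact ⟨l, hl, by rwa [← h.2.2.1.2 l hl], by rw [h8, (hb l hl).1]⟩
  · have := h4 l hl (by rwa [h.2.2.1.2 l hl])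
    rw [(hb l hl).1] at this
    exact this.trans (hb l hl).2.2

/-- The choice for `X` puts the new boundary vertex into its coalition, and then makes the choices
for `Y` and `Z` one after the other. These do not interfere: the coalitions founded in `Y` and in
`Z` are named after different vertices, and the sizes of the old coalitions are controlled by the
budgets. -/
theorem Attains.branch (ha : IsAdj n adj) (h : Branch n K adj (Conn n K adj) X Y Z)
    (hb : BranchB n K X Y Z) (hy : Attains n K adj val Y y) (hz : Attains n K adj val Z z) :
    Attains n K adj val X (gain n K adj val X Y + y + z) := by
  intro c₀ μ₀ h0 hn
  obtain ⟨u, hun, hu, -⟩ := h.2.2.2.2.1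
  obtain ⟨hbZ, hbY, hbud, hnew⟩ := hb
  have hiK := h.2.2.1
  have hsY := h.2.2.2.2.2.1
  have hSS := h.2.2.2.2.2.2.2.1
  have hju := h.conn_new hu
  have huD : D[X] u := (h.inD_iff ha).2 (.inr hju)
  have huY : ¬ D[Y] u := h.not_inD_new hu
  have huZ : ¬ D[Z] u := fun h' => h.not_both ha h' hju
  have hYX : ∀ v, D[Y] v → D[X] v := fun v hv =>
    (h.inD_iff ha).2 (.inr ((h.conn_iff ha hu).2 (.inr hv)))
  have hZX : ∀ v, D[Z] v → D[X] v := fun v hv => (h.inD_iff ha).2 (.inl hv)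
  have hYZ : ∀ v, D[Y] v → ¬ D[Z] v := fun v hv hv' =>
    h.not_both ha hv' ((h.conn_iff ha hu).2 (.inr hv))
  -- the coalition of the new boundary vertex `u` is new and named `u`, or is one of `X`
  have hq : Y.a Y.i = u ∧ Y.b Y.i + 1 ≤ Y.m Y.i ∧ Y.m Y.i ≤ n ∨
      ¬ D[X] (Y.a Y.i) ∧ μ₀ (Y.a Y.i) = Y.m Y.i ∧ ∃ l < K, X.s l ≠ 0 ∧ Y.a Y.i = X.a l := by
    rcases hnew with ⟨h1, h2, h3⟩ | ⟨l, hl, h1, h2, h3⟩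
    · exact .inl ⟨by omega, h2, h3⟩
    · obtain ⟨t, ht⟩ := Nat.exists_eq_succ_of_ne_zero h1
      have := h0 l hl t ht
      rw [h2, h3] at this
      exact .inr ⟨this.2.2, this.2.1, l, hl, h1, h2.symm⟩
  set c₁ := Function.update c₀ u (Y.a Y.i) with hc₁
  set μ₁ := Function.update μ₀ (Y.a Y.i) (Y.m Y.i) with hμ₁
  have hμ1 : ∀ v, ¬ D[X] v → μ₁ v = μ₀ v := by
    intro v hv
    rw [hμ₁, Function.update_apply]
    split_ifs with he
    · subst he
      rcases hq with hq | hq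
      · rw [hq.1] at hv; exact absurd huD hv
      · exact hq.2.1.symm
    · rfl
  have hμn : ∀ q, μ₁ q ≤ n := by
    intro q
    rw [hμ₁, Function.update_apply]
    split_ifs with he
    · rcases hq with hq | hq
      · exact hq.2.2
      · rw [← hq.2.1]; exact hn _
    · exact hn q
  have hsS : ∀ l < K, ∀ t, X.s l = t + 1 → t ≠ u ∧ ¬ D[X] t := by
    intro l hl t ht
    have : ¬ D[X] t := fun h' => h'.2.1 ⟨l, hl, ht⟩
    exact ⟨fun e => this (e ▸ huD), this⟩
  obtain ⟨c₂, μ₂, y1, y2, y3, y4, y5, y6⟩ := hy c₁ μ₁ (fun l hl t ht => by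
    by_cases hli : l = Y.i
    · subst hli
      obtain rfl : t = u := by omega
      refine ⟨by simp [hc₁], by simp [hμ₁], fun h' => ?_⟩
      rcases hq with hq | hq
      · rw [hq.1] at h'; exact huY h'
      · exact hq.1 (hYX _ h')
    · rw [hsY l hl hli] at ht
      rw [(hbY l hl hli).1, (hbY l hl hli).2]
      obtain ⟨e1, e2, e3⟩ := h0 l hl t ht
      refine ⟨?_, ?_, fun h' => e3 (hYX _ h')⟩
      · rw [hc₁, Function.update_of_ne (hsS l hl t ht).1, e1]
      · rw [hμ1 _ e3, e2]) hμn
  obtain ⟨c₃, μ₃, z1, z2, z3, z4, z5, z6⟩ := hz c₂ μ₂ (fun l hl t ht => by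
    rw [hSS.2 l hl] at ht
    rw [(hbZ l hl).1, (hbZ l hl).2.1]
    obtain ⟨e1, e2, e3⟩ := h0 l hl t ht
    obtain ⟨e4, e5⟩ := hsS l hl t ht
    refine ⟨?_, ?_, fun h' => e3 (hZX _ h')⟩
    · rw [(y1 t fun h' => e5 (hYX _ h')).1, hc₁, Function.update_of_ne e4, e1]
    · rw [(y1 _ fun h' => e3 (hYX _ h')).2, hμ1 _ e3, e2]) y2
  have hcu : c₃ u = Y.a Y.i := by rw [(z1 u huZ).1, (y1 u huY).1]; simp [hc₁]
  have hqDY : ¬ D[Y] (Y.a Y.i) := fun h' => by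
    rcases hq with hq | hq
    · rw [hq.1] at h'; exact huY h'
    · exact hq.1 (hYX _ h')
  have hqDZ : ¬ D[Z] (Y.a Y.i) := fun h' => by
    rcases hq with hq | hq
    · rw [hq.1] at h'; exact huZ h'
    · exact hq.1 (hZX _ h')
  have hcY : ∀ v, D[Y] v → c₃ v = c₂ v := fun v hv => (z1 v (hYZ v hv)).1
  have haX : ∀ l < K, X.s l ≠ 0 → ¬ D[X] (X.a l) := fun l hl hs => by
    obtain ⟨t, ht⟩ := Nat.exists_eq_succ_of_ne_zero hs
    exact (h0 l hl t ht).2.2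
  -- names of coalitions of the pending vertices of `Y` and `Z`
  have nY : ∀ v, D[Y] v → D[Y] (c₃ v) ∨ c₃ v = Y.a Y.i ∨ ∃ l < K, X.s l ≠ 0 ∧ c₃ v = X.a l := by
    intro v hv
    rw [hcY v hv]
    rcases y3 v hv with h1 | ⟨l, hl, h1, h2⟩
    · exact .inl h1
    · by_cases hli : l = Y.i
      · subst hli; exact .inr (.inl h2)
      · rw [hsY l hl hli] at h1
        rw [(hbY l hl hli).1] at h2
        exact .inr (.inr ⟨l, hl, h1, h2⟩)
  have nZ : ∀ v, D[Z] v → D[Z] (c₃ v) ∨ ∃ l < K, X.s l ≠ 0 ∧ c₃ v = X.a l := by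
    intro v hv
    refine (z3 v hv).imp_right ?_
    rintro ⟨l, hl, h1, h2⟩
    exact ⟨l, hl, by rwa [← hSS.2 l hl], by rw [h2, (hbZ l hl).1]⟩
  refine ⟨c₃, μ₃, fun v hv => ?_, z2, fun v hv => ?_, fun l hl hs => ?_, fun q hqX => ?_, ?_⟩
  · have e1 : ¬ D[Y] v := fun h' => hv (hYX v h')
    have e2 : ¬ D[Z] v := fun h' => hv (hZX v h')
    rw [(z1 v e2).1, (z1 v e2).2, (y1 v e1).1, (y1 v e1).2, hμ1 v hv, hc₁,
      Function.update_of_ne (by rintro rfl; exact hv huD)]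
    exact ⟨rfl, rfl⟩
  · have hqX : D[X] (Y.a Y.i) ∨ ∃ l < K, X.s l ≠ 0 ∧ Y.a Y.i = X.a l := by
      rcases hq with hq | hq
      · rw [hq.1]; exact .inl huD
      · exact .inr hq.2.2
    rcases (h.inD_iff ha).1 hv with hv | hv
    · exact (nZ v hv).imp_left (hZX _)
    · rcases (h.conn_iff ha hu).1 hv with rfl | hv
      · rw [hcu]; exact hqX
      · rcases nY v hv with e | e | e
        · exact .inl (hYX _ e)
        · rw [e]; exact hqX
        · exact .inr e
  · rw [h.count_eq ha hu, hcu]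
    have e1 : count n D[Z] c₃ (X.a l) ≤ Z.b l := by
      have := z4 l hl (by rwa [hSS.2 l hl])
      rwa [(hbZ l hl).1] at this
    by_cases hl' : ∃ l' < K, Y.s l' ≠ 0 ∧ Y.a l' = X.a l
    · obtain ⟨l', hl', e2, e3⟩ := hl'
      have e4 := y4 l' hl' e2
      rw [e3, ← count_congr hcY] at e4
      have := hbud l hl hs l' hl' e2 e3
      omega
    · have e5 : Y.a Y.i ≠ X.a l := fun e => hl' ⟨Y.i, hiK, by omega, e⟩
      rw [if_neg e5, count_eq_zero (D := D[Y])]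
      · exact e1.trans (hbZ l hl).2.2
      · intro v hv e
        rw [hcY v hv] at e
        rcases y3 v hv with e' | ⟨l', hl'', e6, e7⟩
        · rw [e] at e'; exact haX l hl hs (hYX _ e')
        · exact hl' ⟨l', hl'', e6, by rw [← e7, e]⟩
  · rw [h.count_eq ha hu, hcu]
    rcases (h.inD_iff ha).1 hqX with hqZ | hqC
    · rw [if_neg (by rintro rfl; exact hqDZ hqZ), count_eq_zero (D := D[Y])]
      · exact z5 q hqZ
      · rintro v hv rfl
        rcases nY v hv with e | e | ⟨l, hl, e, e'⟩
        · exact hYZ _ e hqZ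
        · rw [e] at hqZ; exact hqDZ hqZ
        · rw [e'] at hqX; exact haX l hl e hqX
    · have hqZ : ¬ D[Z] q := fun h' => h.not_both ha h' hqC
      have e0 : count n D[Z] c₃ q = 0 := by
        refine count_eq_zero ?_
        rintro v hv rfl
        rcases nZ v hv with e | ⟨l, hl, e, e'⟩
        · exact hqZ e
        · rw [e'] at hqX; exact haX l hl e hqX
      rw [e0, zero_add, (z1 q hqZ).2]
      rcases (h.conn_iff ha hu).1 hqC with rfl | hqY
      · rw [(y1 q huY).2]
        by_cases e : Y.a Y.i = q
        · rcases hq with hq | hq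
          · have := y4 Y.i hiK (by omega)
            rw [e, ← count_congr hcY] at this
            rw [if_pos e, hμ₁, e, Function.update_self]
            omega
          · rw [e] at hq; exact absurd huD hq.1
        · rw [if_neg e, count_eq_zero]
          · exact Nat.zero_le _
          · rintro v hv e'
            rcases nY v hv with e1 | e1 | ⟨l, hl, e1, e2⟩
            · rw [e'] at e1; exact huY e1
            · exact e (by rw [← e1, e'])
            · rw [← e', e2] at hqX; exact haX l hl e1 hqX
      · rw [if_neg (by rintro rfl; exact hqDY hqY), zero_add, count_congr hcY]
        exact y5 q hqY
  · have hc : ∀ l < K, ∀ t, X.s l = t + 1 → c₃ t = X.a l := by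
      intro l hl t ht
      obtain ⟨e4, e5⟩ := hsS l hl t ht
      rw [(z1 t fun h' => e5 (hZX _ h')).1, (y1 t fun h' => e5 (hYX _ h')).1, hc₁,
        Function.update_of_ne e4, (h0 l hl t ht).1]
    rw [h.pairSum_eq ha hu (fun l hl t ht => by rw [hc l hl t ht, hcu])
      (by rw [hcu, (z1 _ hqDZ).2, (y1 _ hqDY).2]; simp [hμ₁]), z6]
    congr 2
    rw [← y6]
    have key : ∀ p r, adj p r → D[Y] p → c₃ r = c₂ r := by
      intro p r hpr hp
      refine (z1 r fun hr => ?_).1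
      have hpC := (h.conn_iff ha hu).2 (.inr hp)
      refine h.not_both ha hr (hpC.trans (.of_adj ha hpr (hpC.not_inS h.2.1.2.1) ?_))
      exact (hZX r hr).2.1
    have key2 : ∀ p, D[Y] p → μ₃ (c₃ p) = μ₂ (c₃ p) := by
      intro p hp
      refine (z1 _ fun hr => ?_).2
      rcases nY p hp with e | e | ⟨l, hl, e, e'⟩
      · exact hYZ _ e hr
      · rw [e] at hr; exact hqDZ hr
      · rw [e'] at hr; exact haX l hl e (hZX _ hr)
    classical
    refine Finset.sum_congr rfl fun p _ => Finset.sum_congr rfl fun r _ => ?_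
    by_cases hA : adj p r
    swap
    · simp [hA]
    have hA' := ha.symm hA
    have fin : D[Y] p ∨ D[Y] r → c₃ p = c₂ p → c₃ r = c₂ r →
        (c₂ p = c₂ r → μ₃ (c₂ p) = μ₂ (c₂ p)) →
        (if adj p r ∧ c₃ p = c₃ r ∧ (D[Y] p ∨ D[Y] r) then val p r (μ₃ (c₃ p)) else 0) =
          if adj p r ∧ c₂ p = c₂ r ∧ (D[Y] p ∨ D[Y] r) then val p r (μ₂ (c₂ p)) else 0 := by
      intro e0 e1 e2 e3
      by_cases e : c₂ p = c₂ r
      · rw [if_pos ⟨hA, by rw [e1, e2, e], e0⟩, if_pos ⟨hA, e, e0⟩, e1, e3 e]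
      · rw [if_neg (fun h => e (by rw [← e1, ← e2, h.2.1])), if_neg (fun h => e h.2.1)]
    by_cases hp : D[Y] p
    · exact fin (.inl hp) (hcY p hp) (key p r hA hp) fun _ => by
        rw [← hcY p hp]; exact key2 p hp
    · by_cases hr : D[Y] r
      · exact fin (.inr hr) (key r p hA' hr) (hcY r hr) fun e => by
          rw [e, ← hcY r hr]; exact key2 r hr
      · simp [hp, hr]

end

end Cfg

/-! ### The recursion and the optimality of its values -/

namespace Cfg

/-- One round of the computation of the configurations whose pending vertices can be placed one
by one on a boundary with `K` slots. The configurations are given by codes below `B`. -/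
def stepG (B n K : ℕ) (adj : ℕ → ℕ → Prop) (R : Cfg → ℕ → ℕ → Prop) (cfg : ℕ → Cfg)
    (g : ℕ → Prop) (x : ℕ) : Prop :=
  n ≤ (cfg x).j ∨ (∃ z < B, g z ∧ Skip n K adj R (cfg x) (cfg z)) ∨
    ∃ y < B, g y ∧ ∃ z < B, g z ∧ Branch n K adj R (cfg x) (cfg y) (cfg z)

open Classical in
/-- One round of the computation of the maximum values of the configurations. -/
noncomputable def stepH (B n K : ℕ) (adj : ℕ → ℕ → Prop) (val : ℕ → ℕ → ℕ → ℤ)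
    (R : Cfg → ℕ → ℕ → Prop) (cfg : ℕ → Cfg) (h : ℕ → ℤ) (x : ℕ) : ℤ :=
  max (RAM.maxUpto B fun z =>
      if Skip n K adj R (cfg x) (cfg z) ∧ SkipB K (cfg x) (cfg z) then h z else 0)
    (RAM.maxUpto B fun y => RAM.maxUpto B fun z =>
      if Branch n K adj R (cfg x) (cfg y) (cfg z) ∧ BranchB n K (cfg x) (cfg y) (cfg z) then
        gain n K adj val (cfg x) (cfg y) + h y + h z else 0)

section
variable {B n K M : ℕ} {adj : ℕ → ℕ → Prop} {val : ℕ → ℕ → ℕ → ℤ} {cfg : ℕ → Cfg}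
  {X X' Y Y' Z Z' : Cfg} {c μ : ℕ → ℕ}

local notation "D[" X "]" => InD n K adj (Conn n K adj) X

theorem attains_stepH (ha : IsAdj n adj) {h : ℕ → ℤ}
    (hh : ∀ x, Attains n K adj val (cfg x) (h x)) (x : ℕ) :
    Attains n K adj val (cfg x) (stepH B n K adj val (Conn n K adj) cfg h x) := by
  classical
  unfold stepH
  rcases max_choice (RAM.maxUpto B fun z =>
      if Skip n K adj (Conn n K adj) (cfg x) (cfg z) ∧ SkipB K (cfg x) (cfg z) then h z else 0)
    (RAM.maxUpto B fun y => RAM.maxUpto B fun z =>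
      if Branch n K adj (Conn n K adj) (cfg x) (cfg y) (cfg z) ∧
          BranchB n K (cfg x) (cfg y) (cfg z) then
        gain n K adj val (cfg x) (cfg y) + h y + h z else 0) with e | e <;> rw [e]
  · rcases RAM.maxUpto_eq B fun z =>
      if Skip n K adj (Conn n K adj) (cfg x) (cfg z) ∧ SkipB K (cfg x) (cfg z) then h z else 0
      with e | ⟨z, -, e⟩ <;> rw [e]
    · exact attains_zero ha
    · split_ifs with hc
      · exact (hh z).skip hc.1 hc.2
      · exact attains_zero ha
  · rcases RAM.maxUpto_eq B fun y => RAM.maxUpto B fun z =>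
      if Branch n K adj (Conn n K adj) (cfg x) (cfg y) (cfg z) ∧
          BranchB n K (cfg x) (cfg y) (cfg z) then
        gain n K adj val (cfg x) (cfg y) + h y + h z else 0 with e | ⟨y, -, e⟩ <;> rw [e]
    · exact attains_zero ha
    · rcases RAM.maxUpto_eq B fun z =>
        if Branch n K adj (Conn n K adj) (cfg x) (cfg y) (cfg z) ∧
            BranchB n K (cfg x) (cfg y) (cfg z) then
          gain n K adj val (cfg x) (cfg y) + h y + h z else 0 with e | ⟨z, -, e⟩ <;> rw [e]
      · exact attains_zero ha
      · split_ifs with hc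
        · exact (hh y).branch ha hc.1 hc.2 (hh z)
        · exact attains_zero ha

theorem attains_iterate (ha : IsAdj n adj) (t x : ℕ) :
    Attains n K adj val (cfg x) ((stepH B n K adj val (Conn n K adj) cfg)^[t] (fun _ => 0) x) := by
  induction t generalizing x with
  | zero => exact attains_zero ha
  | succ t ih =>
    rw [Function.iterate_succ_apply']
    exact attains_stepH ha ih x

theorem iterate_stepH_nonneg (R : Cfg → ℕ → ℕ → Prop) (t x : ℕ) :
    0 ≤ (stepH B n K adj val R cfg)^[t] (fun _ => 0) x := by
  cases t with
  | zero => exact le_rfl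
  | succ t =>
    rw [Function.iterate_succ_apply']
    exact (RAM.maxUpto_nonneg _ _).trans (le_max_left _ _)

/-- The two configurations differ at most in the data of the coalitions. -/
def Agree (K : ℕ) (X X' : Cfg) : Prop := X'.i = X.i ∧ X'.j = X.j ∧ ∀ l < K, X'.s l = X.s l

theorem Agree.sameS (h : Agree K X X') : SameS K X X' := ⟨h.1, h.2.2⟩

theorem Agree.conn (h : Agree K X X') : Conn n K adj X' = Conn n K adj X :=
  funext fun _ => funext fun _ => propext h.sameS.conn

theorem Agree.inD (h : Agree K X X') : D[X'] = D[X] := by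
  funext v
  unfold InD
  rw [h.sameS.inS, h.1, h.2.1, h.conn]
  refine propext (and_congr_right fun _ => and_congr_right fun _ => and_congr_left fun _ => ?_)
  refine forall_congr' fun l => forall_congr' fun hl => ?_
  rw [h.2.2 l hl]

theorem SameS.congr (h : SameS K X Z) (hX : Agree K X X') (hZ : Agree K Z Z') :
    SameS K X' Z' := by
  refine ⟨by rw [hX.1, hZ.1, h.1], fun l hl => ?_⟩
  rw [hX.2.2 l hl, hZ.2.2 l hl, h.2 l hl]

theorem Skip.congr (h : Skip n K adj (Conn n K adj) X Z) (hX : Agree K X X')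
    (hZ : Agree K Z Z') : Skip n K adj (Conn n K adj) X' Z' := by
  obtain ⟨h1, h2, h3, h4⟩ := h
  refine ⟨by rwa [hX.2.1], ?_, h3.congr hX hZ, by rw [hX.2.1, hZ.2.1, h4]⟩
  rwa [hX.inD, hX.2.1]

theorem Branch.congr (h : Branch n K adj (Conn n K adj) X Y Z) (hX : Agree K X X')
    (hY : Agree K Y Y') (hZ : Agree K Z Z') : Branch n K adj (Conn n K adj) X' Y' Z' := by
  obtain ⟨h1, h2, h3, h4, h5, h6, h7, h8, h9⟩ := h
  refine ⟨by rwa [hX.2.1], by rwa [hX.inD, hX.2.1], by rwa [hY.1], by rwa [hY.2.1], ?_,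
    fun l hl hli => ?_, ?_, h8.congr hX hZ, by rw [hX.2.1, hZ.2.1, h9]⟩
  · rwa [hY.1, hY.2.2 _ h3, hX.2.1, hX.conn]
  · rw [hX.2.2 l hl, hY.2.2 l hl, h6 l hl (by rwa [← hY.1])]
  · rwa [hY.1, hX.2.2 _ h3, hX.conn, hX.2.1]

/-- Whether the pending vertices can be placed does not depend on the data of the coalitions. -/
theorem stepG_iterate_congr {t x x' : ℕ} (h : Agree K (cfg x) (cfg x'))
    (hg : (stepG B n K adj (Conn n K adj) cfg)^[t] (fun _ => False) x) :
    (stepG B n K adj (Conn n K adj) cfg)^[t] (fun _ => False) x' := by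
  have refl : ∀ X, Agree K X X := fun X => ⟨rfl, rfl, fun _ _ => rfl⟩
  cases t with
  | zero => exact hg
  | succ t =>
    rw [Function.iterate_succ_apply'] at hg ⊢
    rcases hg with h1 | ⟨z, hz, h1, h2⟩ | ⟨y, hy, h1, z, hz, h2, h3⟩
    · exact .inl (by rwa [h.2.1])
    · exact .inr (.inl ⟨z, hz, h1, h2.congr h (refl _)⟩)
    · exact .inr (.inr ⟨y, hy, h1, z, hz, h2, h3.congr h (refl _) (refl _)⟩)

/-- The codes below `B` stand for all configurations with entries below `M`. -/
structure IsCoding (B K M : ℕ) (cfg : ℕ → Cfg) : Prop where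
  j_lt : ∀ x, (cfg x).j < M
  i_lt : ∀ x, (cfg x).i < M
  lt : ∀ x l, (cfg x).s l < M ∧ (cfg x).a l < M ∧ (cfg x).m l < M ∧ (cfg x).b l < M
  exists_code : ∀ X : Cfg, X.i < M → X.j < M →
    (∀ l < K, X.s l < M ∧ X.a l < M ∧ X.m l < M ∧ X.b l < M) →
    ∃ x < B, Agree K X (cfg x) ∧
      ∀ l < K, (cfg x).a l = X.a l ∧ (cfg x).m l = X.m l ∧ (cfg x).b l = X.b l

/-- On the boundary, `X` agrees with the coalitions given by names `c` and sizes `μ`, and its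
budgets allow all members of these coalitions among the pending vertices. -/
def Compat (n K : ℕ) (adj : ℕ → ℕ → Prop) (c μ : ℕ → ℕ) (X : Cfg) : Prop :=
  (∀ l < K, ∀ l' < K, ∀ t t', X.s l = t + 1 → X.s l' = t' + 1 →
    (X.a l = X.a l' ↔ c t = c t')) ∧
  ∀ l < K, ∀ t, X.s l = t + 1 →
    X.m l = μ (c t) ∧ count n (InD n K adj (Conn n K adj) X) c (c t) ≤ X.b l ∧
      ¬ InD n K adj (Conn n K adj) X (X.a l)

theorem count_le (D : ℕ → Prop) (q : ℕ) : count n D c q ≤ n := by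
  classical
  calc count n D c q ≤ ∑ _v ∈ Finset.range n, 1 :=
        Finset.sum_le_sum fun v _ => by split_ifs <;> simp
    _ = n := by simp

/-- The coalition data of a configuration to which `X` passes can be chosen in accordance with
`c` and `μ`. -/
theorem Compat.skip (hcod : IsCoding B K M cfg) (hX : Compat n K adj c μ X)
    (hlt : ∀ l < K, X.a l < M ∧ X.m l < M)
    {z : ℕ} (h : Skip n K adj (Conn n K adj) X (cfg z))
    (hbM : ∀ l < K, X.b l < M) :
    ∃ z' < B, Agree K (cfg z) (cfg z') ∧ SkipB K X (cfg z') ∧ Compat n K adj c μ (cfg z') := by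
  obtain ⟨z', hz', hA, hd⟩ := hcod.exists_code ⟨(cfg z).i, (cfg z).j, (cfg z).s, X.a, X.m, X.b⟩
    (hcod.i_lt z) (hcod.j_lt z)
    (fun l hl => ⟨(hcod.lt z l).1, (hlt l hl).1, (hlt l hl).2, hbM l hl⟩)
  have hA : Agree K (cfg z) (cfg z') := hA
  refine ⟨z', hz', hA, fun l hl => ⟨(hd l hl).1, (hd l hl).2.1, (hd l hl).2.2.le⟩, ?_⟩
  have hs : ∀ l < K, (cfg z').s l = X.s l := fun l hl => by
    rw [hA.2.2 l hl, h.2.2.1.2 l hl]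
  have hD : D[cfg z'] = D[X] := by
    rw [hA.inD]; exact funext fun v => propext h.inD_iff
  refine ⟨fun l hl l' hl' t t' ht ht' => ?_, fun l hl t ht => ?_⟩
  · rw [(hd l hl).1, (hd l' hl').1]
    exact hX.1 l hl l' hl' t t' (by rw [← hs l hl, ht]) (by rw [← hs l' hl', ht'])
  · rw [(hd l hl).2.1, (hd l hl).2.2, (hd l hl).1, hD]
    exact hX.2 l hl t (by rw [← hs l hl, ht])

/-- The coalition data of the configurations to which `X` branches can be chosen in accordance with
`c` and `μ`: the budgets are the numbers of pending vertices in the coalitions. -/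
theorem Compat.branch (ha : IsAdj n adj) (hcod : IsCoding B K M cfg) (hnM : n < M)
    (hc : ∀ q, μ q ≤ n) (hcμ : ∀ v < n, count n (fun _ => True) c (c v) ≤ μ (c v))
    (hX : Compat n K adj c μ X)
    (hlt : ∀ l < K, X.a l < M ∧ X.m l < M)
    {y z : ℕ} (h : Branch n K adj (Conn n K adj) X (cfg y) (cfg z)) :
    ∃ y' < B, ∃ z' < B, Agree K (cfg y) (cfg y') ∧ Agree K (cfg z) (cfg z') ∧
      BranchB n K X (cfg y') (cfg z') ∧ Compat n K adj c μ (cfg y') ∧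
      Compat n K adj c μ (cfg z') ∧
      pairSum n adj val D[X] c μ = gain n K adj val X (cfg y') +
        pairSum n adj val D[cfg y'] c μ + pairSum n adj val D[cfg z'] c μ := by
  classical
  obtain ⟨u, hun, hu, -⟩ := h.2.2.2.2.1
  have hiK := h.2.2.1
  have hju := h.conn_new hu
  have huD : D[X] u := (h.inD_iff ha).2 (.inr hju)
  -- the name of the coalition of `u`
  obtain ⟨q, hqM, hq, hqu⟩ : ∃ q < M, (∀ l < K, ∀ t, X.s l = t + 1 → (c t = c u ↔ X.a l = q)) ∧
      ((∃ l < K, ∃ t, X.s l = t + 1 ∧ X.a l = q ∧ c t = c u) ∨ q = u) := by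
    by_cases he : ∃ l < K, ∃ t, X.s l = t + 1 ∧ c t = c u
    · obtain ⟨l, hl, t, ht, e⟩ := he
      refine ⟨X.a l, (hlt l hl).1, fun l' hl' t' ht' => ?_, .inl ⟨l, hl, t, ht, rfl, e⟩⟩
      rw [hX.1 l' hl' l hl t' t ht' ht, e]
    · push Not at he
      refine ⟨u, by omega, fun l hl t ht => ?_, .inr rfl⟩
      refine iff_of_false (he l hl t ht) fun e => ?_
      exact (hX.2 l hl t ht).2.2 (e ▸ huD)
  obtain ⟨y', hy', hAy, hdy⟩ := hcod.exists_code ⟨(cfg y).i, (cfg y).j, (cfg y).s,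
      fun l => if l = (cfg y).i then q else X.a l,
      fun l => if l = (cfg y).i then μ (c u) else X.m l,
      fun l => count n D[cfg y] c (c ((cfg y).s l - 1))⟩ (hcod.i_lt y) (hcod.j_lt y)
    (fun l hl => ⟨(hcod.lt y l).1, by dsimp only; split_ifs <;> [exact hqM; exact (hlt l hl).1],
      by dsimp only; split_ifs <;> [exact (hc _).trans_lt hnM; exact (hlt l hl).2],
      (count_le _ _).trans_lt hnM⟩)
  have hAy : Agree K (cfg y) (cfg y') := hAy
  obtain ⟨z', hz', hAz, hdz⟩ := hcod.exists_code ⟨(cfg z).i, (cfg z).j, (cfg z).s,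
      X.a, X.m, fun l => min (X.b l) (count n D[cfg z] c (c ((cfg z).s l - 1)))⟩
      (hcod.i_lt z) (hcod.j_lt z)
    (fun l hl => ⟨(hcod.lt z l).1, (hlt l hl).1, (hlt l hl).2,
      (min_le_right _ _).trans_lt ((count_le _ _).trans_lt hnM)⟩)
  have hAz : Agree K (cfg z) (cfg z') := hAz
  dsimp only at hdy hdz
  have hs : ∀ l < K, (cfg z').s l = X.s l := fun l hl => by
    rw [hAz.2.2 l hl, h.2.2.2.2.2.2.2.1.2 l hl]
  have h' : Branch n K adj (Conn n K adj) X (cfg y') (cfg z') :=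
    h.congr ⟨rfl, rfl, fun _ _ => rfl⟩ hAy hAz
  have hu' : (cfg y').s (cfg y').i = u + 1 := by rw [hAy.1, hAy.2.2 _ hiK, hu]
  have hi : (cfg y').i = (cfg y).i := hAy.1
  have hai : (cfg y').a (cfg y').i = q := by rw [hi, (hdy _ hiK).1, if_pos rfl]
  have hmi : (cfg y').m (cfg y').i = μ (c u) := by rw [hi, (hdy _ hiK).2.1, if_pos rfl]
  have hYX : ∀ v, D[cfg y'] v → D[X] v := fun v hv =>
    (h'.inD_iff ha).2 (.inr ((h'.conn_iff ha hu').2 (.inr hv)))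
  have hZX : ∀ v, D[cfg z'] v → D[X] v := fun v hv => (h'.inD_iff ha).2 (.inl hv)
  -- the coalition data of the boundary of `cfg y'`
  have hy : ∀ l < K, ∀ t, (cfg y').s l = t + 1 → (cfg y').m l = μ (c t) ∧
      (cfg y').b l = count n D[cfg y'] c (c t) ∧
      ∀ l₁ < K, ∀ t₁, X.s l₁ = t₁ + 1 → (X.a l₁ = (cfg y').a l ↔ c t₁ = c t) := by
    intro l hl t ht
    refine ⟨?_, ?_, fun l₁ hl₁ t₁ ht₁ => ?_⟩
    · rw [(hdy l hl).2.1]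
      split_ifs with hli
      · rw [← hi] at hli; subst hli
        rw [show t = u by omega]
      · have ht' : X.s l = t + 1 := by
          rw [← h'.2.2.2.2.2.1 l hl (by rwa [hi]), ht]
        exact (hX.2 l hl t ht').1
    · rw [(hdy l hl).2.2, hAy.inD, ← hAy.2.2 l hl, ht]; rfl
    · by_cases hli : l = (cfg y').i
      · subst hli
        rw [show t = u by omega, hai]
        exact (hq l₁ hl₁ t₁ ht₁).symm
      · rw [(hdy l hl).1, if_neg (by rwa [← hi])]
        have ht' : X.s l = t + 1 := by
          rw [← h'.2.2.2.2.2.1 l hl hli, ht]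
        exact hX.1 l₁ hl₁ l hl t₁ t ht₁ ht'
  refine ⟨y', hy', z', hz', hAy, hAz, ⟨fun l hl => ?_, fun l hl hli => ?_, ?_, ?_⟩, ⟨?_, ?_⟩,
    ⟨?_, ?_⟩, ?_⟩
  · rw [(hdz l hl).1, (hdz l hl).2.1, (hdz l hl).2.2]
    exact ⟨rfl, rfl, min_le_left _ _⟩
  · rw [hi] at hli
    rw [(hdy l hl).1, (hdy l hl).2.1, if_neg hli, if_neg hli]
    exact ⟨rfl, rfl⟩
  · intro l hl hsl l' hl' hsl' hal
    obtain ⟨t, ht⟩ := Nat.exists_eq_succ_of_ne_zero hsl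
    obtain ⟨t', ht'⟩ := Nat.exists_eq_succ_of_ne_zero hsl'
    obtain ⟨-, e2, e3⟩ := hy l' hl' t' ht'
    have e4 := (e3 l hl t ht).1 hal.symm
    have e5 := h'.count_eq ha hu' (c := c) (q := c t)
    have e6 := (hX.2 l hl t ht).2.1
    have e7 : (cfg z').b l ≤ count n D[cfg z'] c (c t) := by
      rw [(hdz l hl).2.2, hAz.inD, ← hAz.2.2 l hl, hs l hl, ht]
      exact min_le_right _ _
    rw [e2, ← e4, hai]
    have e8 : (q = X.a l) ↔ (c u = c t) := by
      rw [eq_comm, ← hq l hl t ht, eq_comm]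
    by_cases e9 : c u = c t
    · rw [if_pos e9] at e5; rw [if_pos (e8.2 e9)]; omega
    · rw [if_neg e9] at e5; rw [if_neg fun h => e9 (e8.1 h)]; omega
  · rcases hqu with ⟨l, hl, t, ht, e1, e2⟩ | e
    · right
      refine ⟨l, hl, by omega, by rw [e1, hai], ?_⟩
      rw [hmi, (hX.2 l hl t ht).1, e2]
    · left
      refine ⟨by rw [hai, e, hu'], ?_, by rw [hmi]; exact hc _⟩
      rw [(hy _ h'.2.2.1 u hu').2.1, hmi]
      have e5 := h'.count_eq ha hu' (c := c) (q := c u)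
      have e6 : count n D[X] c (c u) ≤ _ := count_mono (D' := fun _ => True) fun _ _ => trivial
      have := hcμ u hun
      simp only [if_true] at e5
      omega
  · intro l hl l' hl' t t' ht ht'
    by_cases hli : l = (cfg y').i
    · by_cases hli' : l' = (cfg y').i
      · subst hli; subst hli'
        rw [show t = t' by omega]; simp
      · have ht'' : X.s l' = t' + 1 := by rw [← h'.2.2.2.2.2.1 l' hl' hli', ht']
        have := (hy l hl t ht).2.2 l' hl' t' ht''
        rw [← (hdy l' hl').1.trans (if_neg (by rwa [← hi]))] at this
        rw [eq_comm, this, eq_comm]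
    · have ht'' : X.s l = t + 1 := by rw [← h'.2.2.2.2.2.1 l hl hli, ht]
      have := (hy l' hl' t' ht').2.2 l hl t ht''
      rwa [← (hdy l hl).1.trans (if_neg (by rwa [← hi]))] at this
  · intro l hl t ht
    obtain ⟨e1, e2, -⟩ := hy l hl t ht
    refine ⟨e1, e2.ge, fun hD => ?_⟩
    by_cases hli : l = (cfg y').i
    · subst hli
      rw [hai] at hD
      rcases hqu with ⟨l, hl, t, ht, e1, e2⟩ | e
      · rw [← e1] at hD
        exact (hX.2 l hl t ht).2.2 (hYX _ hD)
      · rw [e] at hD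
        exact h'.not_inD_new hu' hD
    · have ht'' : X.s l = t + 1 := by rw [← h'.2.2.2.2.2.1 l hl hli, ht]
      rw [(hdy l hl).1, if_neg (by rwa [← hi])] at hD
      exact (hX.2 l hl t ht'').2.2 (hYX _ hD)
  · intro l hl l' hl' t t' ht ht'
    rw [(hdz l hl).1, (hdz l' hl').1]
    exact hX.1 l hl l' hl' t t' (by rw [← hs l hl, ht]) (by rw [← hs l' hl', ht'])
  · intro l hl t ht
    have ht' : X.s l = t + 1 := by rw [← hs l hl, ht]
    obtain ⟨e1, e2, e3⟩ := hX.2 l hl t ht'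
    rw [(hdz l hl).1, (hdz l hl).2.1, (hdz l hl).2.2]
    refine ⟨e1, le_min ?_ ?_, fun hD => e3 (hZX _ hD)⟩
    · exact (count_mono hZX).trans e2
    · rw [hAz.inD, ← hAz.2.2 l hl, ht]; exact le_rfl
  · exact h'.pairSum_eq ha hu' (by rw [hai]; exact hq) hmi.symm

/-- If the pending vertices of a configuration can be placed one by one on the boundary, then the
computed value is an upper bound for the values of all coalition structures. -/
theorem pairSum_le_iterate (ha : IsAdj n adj) (hcod : IsCoding B K M cfg) (hnM : n < M)
    (hc : ∀ q, μ q ≤ n) (hcμ : ∀ v < n, count n (fun _ => True) c (c v) ≤ μ (c v)) {t x : ℕ}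
    (hg : (stepG B n K adj (Conn n K adj) cfg)^[t] (fun _ => False) x)
    (hX : Compat n K adj c μ (cfg x)) :
    pairSum n adj val D[cfg x] c μ ≤
      (stepH B n K adj val (Conn n K adj) cfg)^[t] (fun _ => 0) x := by
  induction t generalizing x with
  | zero => exact hg.elim
  | succ t ih =>
    rw [Function.iterate_succ_apply'] at hg ⊢
    set h := (stepH B n K adj val (Conn n K adj) cfg)^[t] (fun _ => 0) with hh
    rcases hg with h1 | ⟨z, hz, h1, h2⟩ | ⟨y, hy, h1, z, hz, h2, h3⟩
    · have : pairSum n adj val D[cfg x] c μ = 0 := by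
        refine Finset.sum_eq_zero fun p _ => Finset.sum_eq_zero fun r _ => if_neg ?_
        rintro ⟨-, -, h | h⟩ <;> exact not_inD_of_le h1 h
      rw [this]
      exact (RAM.maxUpto_nonneg _ _).trans (le_max_left _ _)
    · obtain ⟨z', hz', e1, e2, e3⟩ := hX.skip hcod
        (fun l _ => ⟨(hcod.lt x l).2.1, (hcod.lt x l).2.2.1⟩) h2 (fun l _ => (hcod.lt x l).2.2.2)
      have h2' := h2.congr (X' := cfg x) ⟨rfl, rfl, fun _ _ => rfl⟩ e1
      have hD : D[cfg z'] = D[cfg x] := funext fun v => propext h2'.inD_iff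
      have e4 := ih (stepG_iterate_congr e1 h1) e3
      rw [hD] at e4
      refine e4.trans (le_trans ?_ (le_max_left _ _))
      refine le_trans ?_ (RAM.le_maxUpto _ hz')
      rw [if_pos ⟨h2', e2⟩]
    · obtain ⟨y', hy', z', hz', e1, e2, e3, e4, e5, e6⟩ := hX.branch (val := val) ha hcod hnM
        hc hcμ (fun l _ => ⟨(hcod.lt x l).2.1, (hcod.lt x l).2.2.1⟩) h3
      have h3' := h3.congr (X' := cfg x) ⟨rfl, rfl, fun _ _ => rfl⟩ e1 e2
      have e7 := ih (stepG_iterate_congr e1 h1) e4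
      have e8 := ih (stepG_iterate_congr e2 h2) e5
      rw [e6]
      refine le_trans ?_ (le_max_right _ _)
      refine le_trans ?_ (RAM.le_maxUpto _ hy')
      refine le_trans ?_ (RAM.le_maxUpto _ hz')
      rw [if_pos ⟨h3', e3⟩]
      linarith

end

end Cfg

/-! ### Elimination orders from tree decompositions -/

namespace SimpleGraph

variable {ι : Type*} {T : SimpleGraph ι} {ρ a b t : ι} {s : Set ι}

/-- In the tree `T` with root `ρ`, `b` is the parent of `a`, and both belong to `s`. -/
def UpIn (T : SimpleGraph ι) (ρ : ι) (s : Set ι) (a b : ι) : Prop :=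
  a ∈ s ∧ b ∈ s ∧ T.Adj a b ∧ T.dist ρ b + 1 = T.dist ρ a

theorem UpIn.mono {s' : Set ι} (h : s ⊆ s') (hab : T.UpIn ρ s a b) : T.UpIn ρ s' a b :=
  ⟨h hab.1, h hab.2.1, hab.2.2⟩

/-- Parents are unique. -/
theorem IsTree.upIn_unique (hT : T.IsTree) {c : ι} (h : T.UpIn ρ s a b)
    (h' : T.UpIn ρ Set.univ a c) : b = c := by
  obtain ⟨p, hp⟩ := (hT.connected ρ b).exists_walk_length_eq_dist
  obtain ⟨q, hq⟩ := (hT.connected ρ c).exists_walk_length_eq_dist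
  have hp1 : (p.concat h.2.2.1.symm).IsPath :=
    Walk.isPath_of_length_eq_dist _ (by rw [Walk.length_concat, hp, h.2.2.2])
  have hq1 : (q.concat h'.2.2.1.symm).IsPath :=
    Walk.isPath_of_length_eq_dist _ (by rw [Walk.length_concat, hq, h'.2.2.2])
  have e := (hT.existsUnique_path ρ a).unique hp1 hq1
  have := congrArg Walk.penultimate e
  simpa using this

theorem dist_le_of_upIn (h : Relation.ReflTransGen (T.UpIn ρ s) a b) :
    T.dist ρ b ≤ T.dist ρ a := by
  induction h with
  | refl => exact le_rfl
  | tail _ h ih => have := h.2.2.2; omega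

theorem eq_of_upIn (h : Relation.ReflTransGen (T.UpIn ρ s) a b)
    (hd : T.dist ρ a ≤ T.dist ρ b) : a = b := by
  rcases h.cases_head with h | ⟨c, h1, h2⟩
  · exact h
  · have := h1.2.2.2
    have := dist_le_of_upIn h2
    omega

/-- A connected set of nodes has a top node, and the nodes on the path from any node of the set to
the top node belong to the set. -/
theorem IsTree.exists_top [Finite ι] (hT : T.IsTree) (ρ : ι) (hs : (T.induce s).Connected) :
    ∃ r ∈ s, ∀ t ∈ s, Relation.ReflTransGen (T.UpIn ρ s) t r := by
  have := Fintype.ofFinite ι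
  classical
  obtain ⟨⟨t₀, ht₀⟩⟩ := hs.nonempty
  obtain ⟨r, hr, hmin⟩ := (Finset.univ.filter (· ∈ s)).exists_min_image (T.dist ρ)
    ⟨t₀, by simpa using ht₀⟩
  simp only [Finset.mem_filter, Finset.mem_univ, true_and] at hr hmin
  refine ⟨r, hr, fun t ht => ?_⟩
  have hreach := (hs.preconnected ⟨r, hr⟩ ⟨t, ht⟩)
  rw [reachable_iff_reflTransGen] at hreach
  suffices H : ∀ x : s, Relation.ReflTransGen (T.induce s).Adj ⟨r, hr⟩ x →
      Relation.ReflTransGen (T.UpIn ρ s) x r from H _ hreach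
  intro x hx
  induction hx with
  | refl => exact .refl
  | @tail y z _ hyz ih =>
    have hadj : T.Adj y z := hyz
    rcases hT.dist_eq_dist_add_one_of_adj ρ hadj with hd | hd
    · rcases ih.cases_head with h | ⟨w, h1, h2⟩
      · have := hmin z z.2
        rw [h] at hd
        omega
      · have : w = z := hT.upIn_unique h1 ⟨trivial, trivial, hadj, hd.symm⟩
        rwa [← this]
    · exact .head ⟨z.2, y.2, hadj.symm, hd.symm⟩ ih

/-- A node between `t` and `a` belongs to `s`, if the path from `t` up to `a` lies in `s`. -/
theorem IsTree.mem_of_upIn (hT : T.IsTree) {r : ι} (ht : t ∈ s)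
    (hr : Relation.ReflTransGen (T.UpIn ρ Set.univ) t r)
    (ha : Relation.ReflTransGen (T.UpIn ρ s) t a) (hd : T.dist ρ a ≤ T.dist ρ r) : r ∈ s := by
  induction ha using Relation.ReflTransGen.head_induction_on with
  | refl => rwa [← eq_of_upIn hr hd]
  | head h _ ih =>
    rcases hr.cases_head with rfl | ⟨c, h1, h2⟩
    · exact ht
    · obtain rfl := hT.upIn_unique h h1
      exact ih h.2.1 h2

end SimpleGraph

section Treewidth

open SimpleGraph

variable {n : ℕ} {G : SimpleGraph (Fin n)}

/-- Ranking the vertices by the depth of their top nodes in a rooted tree decomposition, one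
obtains an elimination order: the vertices that precede a connected set `C` and are
adjacent to it lie, together with the first vertex of `C`, in one bag. -/
theorem TreeDecomposition.exists_rank (D : TreeDecomposition G) :
    ∃ r : Fin n → ℕ, ∀ (C : Fin n → Prop) (u : Fin n), C u → (∀ v, C v → r u ≤ r v) →
      (∀ v, C v → Relation.ReflTransGen (fun a b => G.Adj a b ∧ C b) u v) →
      ∀ S : Finset (Fin n), (∀ x ∈ S, ¬ C x ∧ (∃ v, C v ∧ G.Adj x v) ∧ ∀ v, C v → r x ≤ r v) →
        S.card ≤ D.width := by
  have hT := D.isTree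
  obtain ⟨ρ⟩ := hT.connected.nonempty
  choose top htop hup using fun v => hT.exists_top ρ (D.connected v)
  have toUniv : ∀ {s : Set (Fin D.nodes)} {a b}, Relation.ReflTransGen (D.tree.UpIn ρ s) a b →
      Relation.ReflTransGen (D.tree.UpIn ρ Set.univ) a b :=
    fun h => Relation.ReflTransGen.mono (fun _ _ h => h.mono (Set.subset_univ _)) _ _ h
  have hRU : Relator.RightUnique (D.tree.UpIn ρ Set.univ) := fun _ _ _ h h' =>
    hT.upIn_unique h h'
  refine ⟨fun v => D.tree.dist ρ (top v), fun C u hu hmin hconn S hS => ?_⟩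
  -- the top nodes of adjacent vertices are comparable, so all top nodes of `C` are below that of `u`
  have key : ∀ v, C v → Relation.ReflTransGen (D.tree.UpIn ρ Set.univ) (top v) (top u) := by
    intro v hv
    have := hconn v hv
    clear hv
    induction this with
    | refl => exact .refl
    | @tail v w _ hvw ih =>
      obtain ⟨t, htv, htw⟩ := D.edge_mem v w hvw.1
      have h1 := (toUniv (hup v t htv)).trans ih
      have h2 := toUniv (hup w t htw)
      rcases Relation.ReflTransGen.total_of_right_unique hRU h1 h2 with h | h
      · rw [eq_of_upIn h (hmin w hvw.2)]
      · exact h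
  -- the bags of `x ∈ S` reach from a node below `top u` to a node not below it
  have hsub : insert u S ⊆ D.bag (top u) := by
    intro x hx
    rcases Finset.mem_insert.1 hx with rfl | hx
    · exact htop x
    · obtain ⟨-, ⟨v, hv, hxv⟩, hle⟩ := hS x hx
      obtain ⟨t, htx, htv⟩ := D.edge_mem x v hxv
      exact hT.mem_of_upIn (s := {t | x ∈ D.bag t}) htx ((toUniv (hup v t htv)).trans (key v hv))
        (hup x t htx) (hle u hu)
  have huS : u ∉ S := fun h => (hS u h).1 hu
  have h1 := Finset.card_le_card hsub
  rw [Finset.card_insert_of_notMem huS] at h1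
  have h2 : (D.bag (top u)).card ≤ Finset.univ.sup fun t => (D.bag t).card :=
    Finset.le_sup (f := fun t => (D.bag t).card) (Finset.mem_univ _)
  unfold TreeDecomposition.width
  omega

/-- The decomposition with a single bag. -/
def TreeDecomposition.trivial (G : SimpleGraph (Fin n)) : TreeDecomposition G where
  nodes := 1
  tree := ⊥
  isTree := .of_subsingleton
  bag _ := Finset.univ
  vertex_mem v := ⟨0, Finset.mem_univ v⟩
  edge_mem u v _ := ⟨0, Finset.mem_univ u, Finset.mem_univ v⟩
  connected v := by
    have : Nonempty {t : Fin 1 | v ∈ (Finset.univ : Finset (Fin n))} := ⟨⟨0, by simp⟩⟩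
    exact (IsTree.of_subsingleton).connected

theorem exists_width_eq_treewidth (G : SimpleGraph (Fin n)) :
    ∃ D : TreeDecomposition G, D.width = treewidth G :=
  Nat.sInf_mem (s := Set.range fun D : TreeDecomposition G => D.width)
    ⟨_, TreeDecomposition.trivial G, rfl⟩

theorem treewidth_le (G : SimpleGraph (Fin n)) : treewidth G ≤ n - 1 := by
  refine (Nat.sInf_le (s := Set.range fun D : TreeDecomposition G => D.width)
    ⟨TreeDecomposition.trivial G, rfl⟩).trans ?_
  simp only [TreeDecomposition.width]
  refine Nat.sub_le_sub_right (Finset.sup_le fun t _ => ?_) 1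
  simp [TreeDecomposition.trivial]

theorem one_le_treewidth (hG : G ≠ ⊥) : 1 ≤ treewidth G := by
  obtain ⟨D, hD⟩ := exists_width_eq_treewidth G
  obtain ⟨u, v, huv⟩ : ∃ u v, G.Adj u v := by
    by_contra h
    push Not at h
    exact hG (eq_bot_iff_forall_not_adj.2 h)
  obtain ⟨t, hu, hv⟩ := D.edge_mem u v huv
  have h1 : 1 < (D.bag t).card := Finset.one_lt_card.2 ⟨u, hu, v, hv, huv.ne⟩
  have h2 : (D.bag t).card ≤ Finset.univ.sup fun t => (D.bag t).card :=
    Finset.le_sup (f := fun t => (D.bag t).card) (Finset.mem_univ _)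
  rw [← hD, TreeDecomposition.width]
  omega

end Treewidth

/-! ### Placing the vertices in an elimination order -/

namespace Cfg

variable {B n K M : ℕ} {adj : ℕ → ℕ → Prop} {cfg : ℕ → Cfg} {X : Cfg}

local notation "D[" X "]" => InD n K adj (Conn n K adj) X

/-- `r` is an elimination order in which fewer than `K` vertices precede and are adjacent to a
connected set of vertices. -/
def IsRank (n K : ℕ) (adj : ℕ → ℕ → Prop) (r : ℕ → ℕ) : Prop :=
  ∀ (C : ℕ → Prop) (u : ℕ), u < n → C u → (∀ v, C v → r u ≤ r v) →
    (∀ v, C v → Relation.ReflTransGen (fun a b => adj a b ∧ C b) u v) →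
    ∀ S : Finset ℕ, (∀ x ∈ S, ¬ C x ∧ (∃ v, C v ∧ adj x v) ∧ ∀ v, C v → r x ≤ r v) → S.card < K

/-- No vertex occurs twice on the boundary, and in the order `r` the boundary vertices precede the
components of pending vertices to which they are adjacent. -/
def Follows (n K : ℕ) (adj : ℕ → ℕ → Prop) (r : ℕ → ℕ) (X : Cfg) : Prop :=
  (∀ l < K, ∀ l' < K, ∀ t, X.s l = t + 1 → X.s l' = t + 1 → l = l') ∧
  ∀ x v w, X.InS K x → adj x v → InD n K adj (Conn n K adj) X v → X.Conn n K adj v w → r x ≤ r w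

/-- If there is a suitable elimination order, all pending vertices can be placed: the first vertex
of each component is placed on the boundary, where a slot is free since fewer than `K` boundary
vertices are adjacent to the component. The measure `N` decreases, because in `Y` there are fewer
pending vertices, and `Z` passes to the next vertex. -/
theorem good_of_rank (ha : IsAdj n adj) (hcod : IsCoding B K M cfg) (hnM : n < M) (hKM : K ≤ M)
    {r : ℕ → ℕ} (hr : IsRank n K adj r) (N x : ℕ) (hX : Follows n K adj r (cfg x))
    (hN : count n D[cfg x] (fun _ => 0) 0 * (n + 2) + (n - (cfg x).j) ≤ N) :
    (stepG B n K adj (Conn n K adj) cfg)^[N + 1] (fun _ => False) x := by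
  classical
  have hM0 : 0 < M := by omega
  induction N generalizing x with
  | zero =>
    rw [Function.iterate_succ_apply']
    exact .inl (by omega)
  | succ N ih =>
    rw [Function.iterate_succ_apply']
    by_cases hj : n ≤ (cfg x).j
    · exact .inl hj
    push Not at hj
    right
    obtain ⟨z, hzB, hz, -⟩ := hcod.exists_code ⟨(cfg x).i, (cfg x).j + 1, (cfg x).s, fun _ => 0,
      fun _ => 0, fun _ => 0⟩ (hcod.i_lt x) (by dsimp only; omega) fun l _ =>
        ⟨(hcod.lt x l).1, hM0, hM0, hM0⟩
    have hS : SameS K (cfg x) (cfg z) := ⟨hz.1, hz.2.2⟩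
    have hzj : (cfg z).j = (cfg x).j + 1 := hz.2.1
    have hDz : ∀ v, D[cfg z] v → D[cfg x] v := fun v hv => ((hS.inD_iff hzj hj).1 hv).1
    have hFz : Follows n K adj r (cfg z) := by
      refine ⟨fun l hl l' hl' t ht ht' => hX.1 l hl l' hl' t ?_ ?_, fun y v w hy hyv hv hw => ?_⟩
      · rw [← hS.2 l hl, ht]
      · rw [← hS.2 l' hl', ht']
      · rw [hS.inS] at hy
        rw [hS.conn] at hw
        exact hX.2 y v w hy hyv (hDz v hv) hw
    by_cases hD : D[cfg x] (cfg x).j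
    · right
      set C := (cfg x).Conn n K adj (cfg x).j with hC
      have hCD : ∀ v, C v → D[cfg x] v := fun v hv => hD.of_conn hv
      obtain ⟨u, hu, hmin⟩ := ((Finset.range n).filter C).exists_min_image r
        ⟨(cfg x).j, by simp [hj, hC, Conn.refl hj]⟩
      simp only [Finset.mem_filter, Finset.mem_range] at hu hmin
      have huS : ¬ (cfg x).InS K u := hu.2.not_inS hD.2.1
      have hmin' : ∀ v, C v → r u ≤ r v := fun v hv => hmin v ⟨hv.2.1, hv⟩
      have hconn : ∀ v, C v → Relation.ReflTransGen (fun a b => adj a b ∧ C b) u v := by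
        intro v hv
        have h1 := ((hu.2.symm ha).trans hv).2.2
        clear hv
        induction h1 with
        | refl => exact .refl
        | @tail a b hua hab ih =>
          refine ih.tail ⟨hab.1, ?_⟩
          have han := ha.left_lt hab.1
          exact (hu.2.trans ⟨hu.1, han, hua⟩).trans (.of_adj ha hab.1 hab.2.1 hab.2.2)
      -- a slot whose vertex is not adjacent to the component
      obtain ⟨i, hiK, hi⟩ : ∃ i < K, ∀ t < n, (cfg x).s i = t + 1 → ∀ v < n, C v → ¬ adj t v := by
        by_contra hcon
        push Not at hcon
        choose! t ht1 ht2 v hv1 hv2 hv3 using hcon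
        have hcard := hr C u hu.1 hu.2 hmin' hconn ((Finset.range K).image t) (by
          intro y hy
          obtain ⟨l, hl, rfl⟩ := Finset.mem_image.1 hy
          have hl := Finset.mem_range.1 hl
          have hyS : (cfg x).InS K (t l) := ⟨l, hl, ht2 l hl⟩
          refine ⟨fun h => h.not_inS hD.2.1 hyS, ⟨v l, hv2 l hl, hv3 l hl⟩, fun w hw => ?_⟩
          exact hX.2 _ _ w hyS (hv3 l hl) (hCD _ (hv2 l hl)) (((hv2 l hl).symm ha).trans hw))
        rw [Finset.card_image_of_injOn, Finset.card_range] at hcard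
        · exact lt_irrefl _ hcard
        · intro l hl l' hl' e
          have hl := Finset.mem_range.1 (Finset.mem_coe.1 hl)
          have hl' := Finset.mem_range.1 (Finset.mem_coe.1 hl')
          exact hX.1 l hl l' hl' (t l) (ht2 l hl) (by rw [e]; exact ht2 l' hl')
      obtain ⟨y, hyB, hy, -⟩ := hcod.exists_code ⟨i, 0, Function.update (cfg x).s i (u + 1),
        fun _ => 0, fun _ => 0, fun _ => 0⟩ (by dsimp only; omega) (by dsimp only; omega)
        fun l _ => ⟨by
          dsimp only; rw [Function.update_apply]
          split_ifs <;> [omega; exact (hcod.lt x l).1], hM0, hM0, hM0⟩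
      have hyi : (cfg y).i = i := hy.1
      have hys : ∀ l < K, (cfg y).s l = Function.update (cfg x).s i (u + 1) l := hy.2.2
      have hyu : (cfg y).s (cfg y).i = u + 1 := by rw [hyi, hys i hiK, Function.update_self]
      have hyl : ∀ l < K, l ≠ i → (cfg y).s l = (cfg x).s l := fun l hl hli => by
        rw [hys l hl, Function.update_of_ne hli]
      have hBr : Branch n K adj (Conn n K adj) (cfg x) (cfg y) (cfg z) :=
        ⟨hj, hD, by omega, hy.2.1, ⟨u, hu.1, hyu, hu.2⟩, fun l hl hli => hyl l hl (by omega),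
          by rwa [hyi], hS, hzj⟩
      have hcnt := hBr.count_eq ha hyu (c := fun _ => 0) (q := 0)
      rw [if_pos rfl] at hcnt
      have hDy : ∀ v, D[cfg y] v → C v := fun v hv => (hBr.conn_iff ha hyu).2 (.inr hv)
      have hFy : Follows n K adj r (cfg y) := by
        refine ⟨fun l hl l' hl' t ht ht' => ?_, fun p v w hp hpv hv hw => ?_⟩
        · by_cases hli : l = i
          · by_cases hli' : l' = i
            · omega
            · rw [hyl l' hl' hli'] at ht'
              rw [← hyi] at hli; subst hli
              exact absurd ⟨l', hl', by omega⟩ huS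
          · rw [hyl l hl hli] at ht
            by_cases hli' : l' = i
            · rw [← hyi] at hli'; subst hli'
              exact absurd ⟨l, hl, by omega⟩ huS
            · rw [hyl l' hl' hli'] at ht'
              exact hX.1 l hl l' hl' t ht ht'
        · have hw' := hDy w (hv.of_conn hw)
          have hv' := hDy v hv
          obtain ⟨l, hl, hlp⟩ := hp
          by_cases hli : l = i
          · rw [← hyi] at hli; subst hli
            rw [show p = u by omega]
            exact hmin' w hw'
          · rw [hyl l hl hli] at hlp
            exact hX.2 p v w ⟨l, hl, hlp⟩ hpv (hCD v hv') ((hv'.symm ha).trans hw')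
      refine ⟨y, hyB, ih y hFy ?_, z, hzB, ih z hFz ?_, hBr⟩
      · have h1 : count n D[cfg y] (fun _ => 0) 0 * (n + 2) + (n + 2) ≤
            count n D[cfg x] (fun _ => 0) 0 * (n + 2) := by
          rw [← Nat.succ_mul]
          exact Nat.mul_le_mul_right _ (by omega)
        omega
      · have h1 : count n D[cfg z] (fun _ => 0) 0 * (n + 2) ≤
            count n D[cfg x] (fun _ => 0) 0 * (n + 2) :=
          Nat.mul_le_mul_right _ (by omega)
        omega
    · left
      have hSk : Skip n K adj (Conn n K adj) (cfg x) (cfg z) := ⟨hj, hD, hS, hzj⟩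
      refine ⟨z, hzB, ih z hFz ?_, hSk⟩
      have : D[cfg z] = D[cfg x] := funext fun v => propext hSk.inD_iff
      rw [this, hzj]
      omega

end Cfg

namespace RAM

/-! ### The functions computed by the algorithm -/

/-- The quotient of `y` by the radix `M = b.sz 2`, if it is at most `B = b.sz 1`. -/
def quot (b : Base) (y : ℕ) : ℕ :=
  ∑ i ∈ Finset.range (b.sz 1), if b.sz 2 * (i + 1) ≤ y then 1 else 0

/-- The number `x` without its last `p` digits. -/
def shift (b : Base) (x p : ℕ) : ℕ :=
  fold (b.sz 1) x fun t acc => if t < p then quot b acc else acc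

/-- Digit `p` of `x`. The case distinction ensures that digits are less than `M` even where `x` is
larger than `B` and the quotients are wrong. -/
def digit (b : Base) (x p : ℕ) : ℕ :=
  if shift b x p < b.sz 2 * quot b (shift b x p) + b.sz 2 then
    shift b x p - b.sz 2 * quot b (shift b x p) else 0

/-- The configuration with code `x`: the first two digits are `i` and `j`, and each slot has four
further digits. The positions are written as sums because the machine cannot multiply. -/
def config (b : Base) (x : ℕ) : Cfg where
  i := digit b x 0
  j := digit b x 1
  s l := digit b x (l + l + l + l + 2)
  a l := digit b x (l + l + l + l + 3)
  m l := digit b x (l + l + l + l + 4)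
  b l := digit b x (l + l + l + l + 5)

/-- Adjacency, read off the weight matrix. The bounds on `u` and `v` matter since the cell
`n * u + v` may belong to another pair otherwise. -/
def adjacent (b : Base) (u v : ℕ) : Prop :=
  (u < b.sz 0 ∧ v < b.sz 0) ∧ ¬ b.w ((b.sz 0 * u + v : ℕ) : ℤ) = 0

/-- The power `2 ^ e`. -/
def pow2 (b : Base) (e : ℕ) : ℤ := fold (b.sz 1) 1 fun t acc => if t < e then acc + acc else acc

/-- The remainder of `V` modulo `2 ^ (q + 1)`, for `V < 2 ^ B`: the powers `2 ^ j`, `q < j < B`, are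
subtracted in decreasing order as long as possible. -/
def lowBits (b : Base) (V : ℤ) (q : ℕ) : ℤ :=
  fold (b.sz 1) V fun t acc =>
    if q < b.sz 1 - (t + 1) ∧ pow2 b (b.sz 1 - (t + 1)) ≤ acc then
      acc - pow2 b (b.sz 1 - (t + 1)) else acc

/-- Bit `q` of `V` is `1`. -/
def bit (b : Base) (V : ℤ) (q : ℕ) : Prop := pow2 b q ≤ lowBits b V q

open Classical in
/-- The set of vertices reachable from `p` along `rel`, as the sum of the powers `2 ^ v` of its
members `v`. -/
noncomputable def reachSet (b : Base) (rel : ℕ → ℕ → Prop) (p : ℕ) : ℤ :=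
  fold (b.sz 1) (pow2 b p) fun _ acc => ∑ v ∈ Finset.range (b.sz 0),
    if bit b acc v ∨ ∃ u < b.sz 0, bit b acc u ∧ rel u v then pow2 b v else 0

/-- Reachability along `rel`. -/
def reach (b : Base) (rel : ℕ → ℕ → Prop) (p q : ℕ) : Prop :=
  (p < b.sz 0 ∧ q < b.sz 0) ∧ bit b (reachSet b rel p) q

/-- The computed version of `Cfg.Conn`. -/
def conn (b : Base) (X : Cfg) (p q : ℕ) : Prop :=
  reach b (fun u v => adjacent b u v ∧ ¬ X.InS (b.sz 3) u ∧ ¬ X.InS (b.sz 3) v) p q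

/-- The value of the pair `(u, v)` in a coalition of size `m`: the weight, multiplied by `n! / m`
and by `2 ^ n²`, plus the power of two that marks the pair. -/
def value (b : Base) (u v m : ℕ) : ℤ :=
  fold (b.sz 0) (fold (b.sz 0) (b.w ((b.sz 0 * u + v : ℕ) : ℤ)) fun j acc =>
      if j + 1 = m then acc else ∑ t ∈ Finset.range (b.sz 0), if t ≤ j then acc else 0)
    (fun _ acc => fold (b.sz 0) acc fun _ a => a + a) + pow2 b (b.sz 0 * u + v)

section Computability

variable {Γ : Type} [Ctx Γ] {β : Γ → Base} {x y z l p q u v m : Γ → ℕ} {V : Γ → ℤ}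

protected theorem CompN.var {α : Type} [LocalVar α] : CompN fun p : (Γ × ℕ) × α => p.1.2 :=
  CompN.last.weaken

protected theorem CompN.quot (hβ : IsBase β) (hy : CompN y) : CompN fun γ => quot (β γ) (y γ) :=
  .sum hβ (.ite (.leN (.szMul hβ.weaken 2 (.add .last (.const 1))) hy.weaken)
    (.const 1) (.const 0))

protected theorem CompN.shift (hβ : IsBase β) (hx : CompN x) (hp : CompN p) :
    CompN fun γ => shift (β γ) (x γ) (p γ) :=
  .fold hβ hx (.ite (.ltN .var hp.weaken.weaken) (.quot hβ.weaken.weaken .last) .last)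

protected theorem CompN.digit (hβ : IsBase β) (hx : CompN x) (hp : CompN p) :
    CompN fun γ => digit (β γ) (x γ) (p γ) :=
  .ite (.ltN (.shift hβ hx hp) (.add (.szMul hβ 2 (.quot hβ (.shift hβ hx hp))) (.sz hβ 2)))
    (.sub (.shift hβ hx hp) (.szMul hβ 2 (.quot hβ (.shift hβ hx hp)))) (.const 0)

protected theorem CompN.fourMulAdd (hl : CompN l) (k : ℕ) : CompN fun γ => l γ + l γ + l γ + l γ + k :=
  .add (.add (.add (.add hl hl) hl) hl) (.const k)

protected theorem CompN.config_i (hβ : IsBase β) (hx : CompN x) : CompN fun γ => (config (β γ) (x γ)).i :=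
  .digit hβ hx (.const 0)

protected theorem CompN.config_j (hβ : IsBase β) (hx : CompN x) : CompN fun γ => (config (β γ) (x γ)).j :=
  .digit hβ hx (.const 1)

protected theorem CompN.config_s (hβ : IsBase β) (hx : CompN x) (hl : CompN l) :
    CompN fun γ => (config (β γ) (x γ)).s (l γ) :=
  .digit hβ hx (.fourMulAdd hl 2)

protected theorem CompN.config_a (hβ : IsBase β) (hx : CompN x) (hl : CompN l) :
    CompN fun γ => (config (β γ) (x γ)).a (l γ) :=
  .digit hβ hx (.fourMulAdd hl 3)

protected theorem CompN.config_m (hβ : IsBase β) (hx : CompN x) (hl : CompN l) :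
    CompN fun γ => (config (β γ) (x γ)).m (l γ) :=
  .digit hβ hx (.fourMulAdd hl 4)

protected theorem CompN.config_b (hβ : IsBase β) (hx : CompN x) (hl : CompN l) :
    CompN fun γ => (config (β γ) (x γ)).b (l γ) :=
  .digit hβ hx (.fourMulAdd hl 5)

protected theorem CompN.pair (hβ : IsBase β) (hu : CompN u) (hv : CompN v) :
    CompN fun γ => (β γ).sz 0 * u γ + v γ :=
  .add (.szMul hβ 0 hu) hv

protected theorem CompP.adjacent (hβ : IsBase β) (hu : CompN u) (hv : CompN v) :
    CompP fun γ => adjacent (β γ) (u γ) (v γ) :=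
  .and (.and (.ltN hu (.sz hβ 0)) (.ltN hv (.sz hβ 0)))
    (.not (.eq (.getW hβ (CompN.pair hβ hu hv)) (.const 0)))

protected theorem CompZ.pow2 (hβ : IsBase β) (hp : CompN p) : CompZ fun γ => pow2 (β γ) (p γ) :=
  .fold hβ (.const 1) (.ite (.ltN .var hp.weaken.weaken) (.add .last .last) .last)

protected theorem CompZ.lowBits (hβ : IsBase β) (hV : CompZ V) (hq : CompN q) :
    CompZ fun γ => lowBits (β γ) (V γ) (q γ) :=
  have hs : CompN fun p : (Γ × ℕ) × ℤ => (β p.1.1).sz 1 - (p.1.2 + 1) :=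
    .sub (.sz hβ.weaken.weaken 1) (.add .var (.const 1))
  .fold hβ hV (.ite (.and (.ltN hq.weaken.weaken hs) (.le (.pow2 hβ.weaken.weaken hs) .last))
    (.sub .last (.pow2 hβ.weaken.weaken hs)) .last)

protected theorem CompP.bit (hβ : IsBase β) (hV : CompZ V) (hq : CompN q) :
    CompP fun γ => bit (β γ) (V γ) (q γ) :=
  .le (.pow2 hβ hq) (.lowBits hβ hV hq)

open Classical in
protected theorem CompZ.reachSet {rel : Γ → ℕ → ℕ → Prop} (hβ : IsBase β)
    (hrel : CompP fun p : (((Γ × ℕ) × ℤ) × ℕ) × ℕ => rel p.1.1.1.1 p.2 p.1.2)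
    (hp : CompN p) : CompZ fun γ => reachSet (β γ) (rel γ) (p γ) :=
  .fold hβ (.pow2 hβ hp) (.sum hβ.weaken.weaken
    (.ite (.or (.bit hβ.weaken.weaken.weaken CompZ.last.weaken .last)
        (.exists hβ.weaken.weaken.weaken
          (.and (.bit hβ.weaken.weaken.weaken.weaken CompZ.last.weaken.weaken .last) hrel)))
      (.pow2 hβ.weaken.weaken.weaken .last) (.const 0)))

protected theorem CompP.reach {rel : Γ → ℕ → ℕ → Prop} (hβ : IsBase β)
    (hrel : CompP fun p : (((Γ × ℕ) × ℤ) × ℕ) × ℕ => rel p.1.1.1.1 p.2 p.1.2)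
    (hp : CompN p) (hq : CompN q) : CompP fun γ => reach (β γ) (rel γ) (p γ) (q γ) :=
  .and (.and (.ltN hp (.sz hβ 0)) (.ltN hq (.sz hβ 0))) (.bit hβ (.reachSet hβ hrel hp) hq)

protected theorem CompP.inS (hβ : IsBase β) (hx : CompN x) (hv : CompN v) :
    CompP fun γ => (config (β γ) (x γ)).InS ((β γ).sz 3) (v γ) :=
  .exists hβ (.eqN (.config_s hβ.weaken hx.weaken .last) (.add hv.weaken (.const 1)))

protected theorem CompP.conn (hβ : IsBase β) (hx : CompN x) (hp : CompN p) (hq : CompN q) :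
    CompP fun γ => conn (β γ) (config (β γ) (x γ)) (p γ) (q γ) :=
  have hβ' := hβ.weaken (α := ℕ) |>.weaken (α := ℤ) |>.weaken (α := ℕ) |>.weaken (α := ℕ)
  have hx' := hx.weaken (α := ℕ) |>.weaken (α := ℤ) |>.weaken (α := ℕ) |>.weaken (α := ℕ)
  .reach hβ (.and (.adjacent hβ' .last .var) (.and (.not (.inS hβ' hx' .last))
    (.not (.inS hβ' hx' .var)))) hp hq

protected theorem CompP.inD (hβ : IsBase β) (hx : CompN x) (hv : CompN v) :
    CompP fun γ => Cfg.InD ((β γ).sz 0) ((β γ).sz 3) (adjacent (β γ)) (conn (β γ))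
      (config (β γ) (x γ)) (v γ) :=
  .and (.ltN hv (.sz hβ 0)) (.and (.not (.inS hβ hx hv)) (.and
    (.forall hβ (.imp (.eqN .last (.config_i hβ.weaken hx.weaken))
      (.forall hβ.weaken (.imp
        (.eqN (.config_s hβ.weaken.weaken hx.weaken.weaken .var) (.add .last (.const 1)))
        (.exists hβ.weaken.weaken (.and (.adjacent hβ.weaken.weaken.weaken .var .last)
          (.conn hβ.weaken.weaken.weaken hx.weaken.weaken.weaken .last
            hv.weaken.weaken.weaken)))))))
    (.forall hβ (.imp (.ltN .last (.config_j hβ.weaken hx.weaken))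
      (.not (.conn hβ.weaken hx.weaken hv.weaken .last))))))

protected theorem CompP.sameS (hβ : IsBase β) (hx : CompN x) (hz : CompN z) :
    CompP fun γ => Cfg.SameS ((β γ).sz 3) (config (β γ) (x γ)) (config (β γ) (z γ)) :=
  .and (.eqN (.config_i hβ hz) (.config_i hβ hx))
    (.forall hβ (.eqN (.config_s hβ.weaken hz.weaken .last) (.config_s hβ.weaken hx.weaken .last)))

protected theorem CompP.skip (hβ : IsBase β) (hx : CompN x) (hz : CompN z) :
    CompP fun γ => Cfg.Skip ((β γ).sz 0) ((β γ).sz 3) (adjacent (β γ)) (conn (β γ))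
      (config (β γ) (x γ)) (config (β γ) (z γ)) :=
  .and (.ltN (.config_j hβ hx) (.sz hβ 0)) (.and (.not (.inD hβ hx (.config_j hβ hx)))
    (.and (.sameS hβ hx hz) (.eqN (.config_j hβ hz) (.add (.config_j hβ hx) (.const 1)))))

protected theorem CompP.branch (hβ : IsBase β) (hx : CompN x) (hy : CompN y) (hz : CompN z) :
    CompP fun γ => Cfg.Branch ((β γ).sz 0) ((β γ).sz 3) (adjacent (β γ)) (conn (β γ))
      (config (β γ) (x γ)) (config (β γ) (y γ)) (config (β γ) (z γ)) :=
  .and (.ltN (.config_j hβ hx) (.sz hβ 0)) (.and (.inD hβ hx (.config_j hβ hx))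
    (.and (.ltN (.config_i hβ hy) (.sz hβ 3)) (.and (.eqN (.config_j hβ hy) (.const 0))
    (.and (.exists hβ (.and (.eqN (.config_s hβ.weaken hy.weaken (.config_i hβ.weaken hy.weaken))
        (.add .last (.const 1)))
      (.conn hβ.weaken hx.weaken (.config_j hβ.weaken hx.weaken) .last)))
    (.and (.forall hβ (.imp (.not (.eqN .last (.config_i hβ.weaken hy.weaken)))
      (.eqN (.config_s hβ.weaken hy.weaken .last) (.config_s hβ.weaken hx.weaken .last))))
    (.and (.forall hβ (.imp
        (.eqN (.config_s hβ.weaken hx.weaken (.config_i hβ.weaken hy.weaken))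
          (.add .last (.const 1)))
        (.forall hβ.weaken (.imp (.conn hβ.weaken.weaken hx.weaken.weaken
          (.config_j hβ.weaken.weaken hx.weaken.weaken) .last)
          (.not (.adjacent hβ.weaken.weaken .var .last))))))
    (.and (.sameS hβ hx hz)
      (.eqN (.config_j hβ hz) (.add (.config_j hβ hx) (.const 1))))))))))

protected theorem CompP.skipB (hβ : IsBase β) (hx : CompN x) (hz : CompN z) :
    CompP fun γ => Cfg.SkipB ((β γ).sz 3) (config (β γ) (x γ)) (config (β γ) (z γ)) :=
  .forall hβ (.and (.eqN (.config_a hβ.weaken hz.weaken .last) (.config_a hβ.weaken hx.weaken .last))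
    (.and (.eqN (.config_m hβ.weaken hz.weaken .last) (.config_m hβ.weaken hx.weaken .last))
      (.leN (.config_b hβ.weaken hz.weaken .last) (.config_b hβ.weaken hx.weaken .last))))

protected theorem CompP.branchB (hβ : IsBase β) (hx : CompN x) (hy : CompN y) (hz : CompN z) :
    CompP fun γ => Cfg.BranchB ((β γ).sz 0) ((β γ).sz 3)
      (config (β γ) (x γ)) (config (β γ) (y γ)) (config (β γ) (z γ)) :=
  have h1 := hβ.weaken (α := ℕ)
  have h2 := h1.weaken (α := ℕ)
  have x1 := hx.weaken (α := ℕ)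
  have x2 := x1.weaken (α := ℕ)
  have y1 := hy.weaken (α := ℕ)
  have y2 := y1.weaken (α := ℕ)
  have z2 := (hz.weaken (α := ℕ)).weaken (α := ℕ)
  .and (.skipB hβ hx hz)
  (.and (.forall hβ (.imp (.not (.eqN .last (.config_i h1 y1)))
    (.and (.eqN (.config_a h1 y1 .last) (.config_a h1 x1 .last))
      (.eqN (.config_m h1 y1 .last) (.config_m h1 x1 .last)))))
  (.and (.forall hβ (.imp (.not (.eqN (.config_s h1 x1 .last) (.const 0)))
    (.forall h1 (.imp (.not (.eqN (.config_s h2 y2 .last) (.const 0)))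
      (.imp (.eqN (.config_a h2 y2 .last) (.config_a h2 x2 .var))
        (.leN (.add (.add (.config_b h2 y2 .last) (.config_b h2 z2 .var))
          (.ite (.eqN (.config_a h2 y2 (.config_i h2 y2)) (.config_a h2 x2 .var))
            (.const 1) (.const 0)))
          (.config_b h2 x2 .var)))))))
  (.or (.and (.eqN (.add (.config_a hβ hy (.config_i hβ hy)) (.const 1))
        (.config_s hβ hy (.config_i hβ hy)))
      (.and (.leN (.add (.config_b hβ hy (.config_i hβ hy)) (.const 1))
        (.config_m hβ hy (.config_i hβ hy)))
        (.leN (.config_m hβ hy (.config_i hβ hy)) (.sz hβ 0))))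
    (.exists hβ (.and (.not (.eqN (.config_s h1 x1 .last) (.const 0)))
      (.and (.eqN (.config_a h1 x1 .last) (.config_a h1 y1 (.config_i h1 y1)))
        (.eqN (.config_m h1 x1 .last) (.config_m h1 y1 (.config_i h1 y1)))))))))

protected theorem CompZ.value (hβ : IsBase β) (hu : CompN u) (hv : CompN v) (hm : CompN m) :
    CompZ fun γ => value (β γ) (u γ) (v γ) (m γ) :=
  .add (.fold hβ (.fold hβ (.getW hβ (CompN.pair hβ hu hv))
      (.ite (.eqN (.add .var (.const 1)) hm.weaken.weaken) .last
        (.sum hβ.weaken.weaken (.ite (.leN .last CompN.var.weaken) CompZ.last.weaken (.const 0)))))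
    (.fold hβ.weaken.weaken .last (.add .last .last)))
  (.pow2 hβ (.pair hβ hu hv))

open Classical in
protected theorem CompZ.gain (hβ : IsBase β) (hx : CompN x) (hy : CompN y) :
    CompZ fun γ => Cfg.gain ((β γ).sz 0) ((β γ).sz 3) (adjacent (β γ)) (value (β γ))
      (config (β γ) (x γ)) (config (β γ) (y γ)) :=
  have h2 := (hβ.weaken (α := ℕ)).weaken (α := ℕ)
  have h3 := h2.weaken (α := ℕ)
  have x3 := ((hx.weaken (α := ℕ)).weaken (α := ℕ)).weaken (α := ℕ)
  have y2 := (hy.weaken (α := ℕ)).weaken (α := ℕ)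
  have y3 := y2.weaken (α := ℕ)
  .sum hβ (.sum hβ.weaken (.ite
    (.and (.eqN (.config_s h2 y2 (.config_i h2 y2)) (.add .var (.const 1)))
      (.and (.adjacent h2 .var .last)
        (.exists h2 (.and (.eqN (.config_s h3 x3 .last) (.add .var (.const 1)))
          (.eqN (.config_a h3 x3 .last) (.config_a h3 y3 (.config_i h3 y3)))))))
    (.add (.value h2 .var .last (.config_m h2 y2 (.config_i h2 y2)))
      (.value h2 .last .var (.config_m h2 y2 (.config_i h2 y2))))
    (.const 0)))

protected theorem CompP.stepG (hβ : IsBase β) (hx : CompN x) :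
    CompP fun γ => Cfg.stepG ((β γ).sz 1) ((β γ).sz 0) ((β γ).sz 3) (adjacent (β γ)) (conn (β γ))
      (config (β γ)) (fun z => (β γ).G z = 1) (x γ) :=
  .or (.leN (.sz hβ 0) (.config_j hβ hx))
    (.or (.exists hβ (.and (.eq (.getG hβ.weaken CompN.last) (.const 1))
        (.skip hβ.weaken hx.weaken .last)))
      (.exists hβ (.and (.eq (.getG hβ.weaken CompN.last) (.const 1))
        (.exists hβ.weaken (.and (.eq (.getG hβ.weaken.weaken CompN.last) (.const 1))
          (.branch hβ.weaken.weaken hx.weaken.weaken .var .last))))))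

open Classical in
protected theorem CompZ.stepH (hβ : IsBase β) (hx : CompN x) :
    CompZ fun γ => Cfg.stepH ((β γ).sz 1) ((β γ).sz 0) ((β γ).sz 3) (adjacent (β γ))
      (value (β γ)) (conn (β γ)) (config (β γ)) (fun z => (β γ).H z) (x γ) :=
  have h2 := (hβ.weaken (α := ℕ)).weaken (α := ℕ)
  have x2 := (hx.weaken (α := ℕ)).weaken (α := ℕ)
  have e1 : CompZ fun γ => RAM.maxUpto ((β γ).sz 1) fun z =>
      if Cfg.Skip ((β γ).sz 0) ((β γ).sz 3) (adjacent (β γ)) (conn (β γ)) (config (β γ) (x γ))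
        (config (β γ) z) ∧ Cfg.SkipB ((β γ).sz 3) (config (β γ) (x γ)) (config (β γ) z)
      then (β γ).H z else 0 :=
    .maxUpto hβ (.ite (.and (.skip hβ.weaken hx.weaken .last) (.skipB hβ.weaken hx.weaken .last))
      (.getH hβ.weaken CompN.last) (.const 0))
  have e2 : CompZ fun γ => RAM.maxUpto ((β γ).sz 1) fun y => RAM.maxUpto ((β γ).sz 1) fun z =>
      if Cfg.Branch ((β γ).sz 0) ((β γ).sz 3) (adjacent (β γ)) (conn (β γ)) (config (β γ) (x γ))
        (config (β γ) y) (config (β γ) z) ∧ Cfg.BranchB ((β γ).sz 0) ((β γ).sz 3)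
          (config (β γ) (x γ)) (config (β γ) y) (config (β γ) z)
      then Cfg.gain ((β γ).sz 0) ((β γ).sz 3) (adjacent (β γ)) (value (β γ))
        (config (β γ) (x γ)) (config (β γ) y) + (β γ).H y + (β γ).H z else 0 :=
    .maxUpto hβ (.maxUpto hβ.weaken (.ite
      (.and (.branch h2 x2 .var .last) (.branchB h2 x2 .var .last))
      (.add (.add (.gain h2 x2 .var) (.getH h2 CompN.var)) (.getH h2 CompN.last)) (.const 0)))
  (CompZ.ite (.le e1 e2) e2 e1).congr fun _ => (max_def _ _).symm

end Computability

end RAM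

namespace RAM

/-! ### The meaning of the computed functions -/

/-- The four numbers of `b` are a number `n` of vertices, the number `B = M ^ (4 K + 2)` of codes
of configurations, the radix `M`, and the number `K` of slots. -/
structure Base.Valid (b : Base) : Prop where
  lt_radix : b.sz 0 + 1 < b.sz 2
  slots_pos : 0 < b.sz 3
  codes_eq : b.sz 1 = b.sz 2 ^ (4 * b.sz 3 + 2)

theorem sum_indicator_eq_min {M : ℕ} (hM : 0 < M) (N y : ℕ) :
    ∑ i ∈ Finset.range N, (if M * (i + 1) ≤ y then 1 else 0) = min N (y / M) := by
  induction N with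
  | zero => simp
  | succ N ih =>
    rw [Finset.sum_range_succ, ih]
    have h : M * (N + 1) ≤ y ↔ N + 1 ≤ y / M := by rw [Nat.le_div_iff_mul_le hM, mul_comm]
    split_ifs <;> omega

theorem exists_digits {M : ℕ} (hM : 0 < M) (L : ℕ) (d : ℕ → ℕ) (hd : ∀ p, d p < M) :
    ∃ x < M ^ L, ∀ p < L, x / M ^ p % M = d p := by
  induction L generalizing d with
  | zero => exact ⟨0, by simp, by simp⟩
  | succ L ih =>
    obtain ⟨x, hx, h⟩ := ih (fun p => d (p + 1)) fun p => hd _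
    refine ⟨d 0 + M * x, ?_, fun p hp => ?_⟩
    · have := hd 0
      rw [pow_succ]
      nlinarith
    · cases p with
      | zero => simp [Nat.mod_eq_of_lt (hd 0)]
      | succ p =>
        rw [pow_succ', ← Nat.div_div_eq_div_mul, Nat.add_mul_div_left _ _ hM,
          Nat.div_eq_of_lt (hd 0), zero_add]
        exact h p (by omega)

theorem pow2_eq {b : Base} {e : ℕ} (he : e ≤ b.sz 1) : pow2 b e = 2 ^ e := by
  suffices H : ∀ N, fold N (1 : ℤ) (fun t acc => if t < e then acc + acc else acc) =
      2 ^ min N e by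
    rw [pow2, H, min_eq_right he]
  intro N
  induction N with
  | zero => simp
  | succ N ih =>
    rw [fold_succ, ih]
    split_ifs with h
    · rw [min_eq_left (by omega), min_eq_left (by omega)]; ring
    · rw [min_eq_right (by omega), min_eq_right (by omega)]

theorem lowBits_eq {b : Base} {V q : ℕ} (hV : V < 2 ^ b.sz 1) (hq : q < b.sz 1) :
    lowBits b V q = (V % 2 ^ (q + 1) : ℕ) := by
  suffices H : ∀ N ≤ b.sz 1, fold N (V : ℤ) (fun t acc =>
      if q < b.sz 1 - (t + 1) ∧ pow2 b (b.sz 1 - (t + 1)) ≤ acc then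
        acc - pow2 b (b.sz 1 - (t + 1)) else acc) =
      (V % 2 ^ max (b.sz 1 - N) (q + 1) : ℕ) by
    rw [lowBits, H _ le_rfl]
    simp
  intro N hN
  induction N with
  | zero =>
    rw [fold_zero, tsub_zero, max_eq_left (by omega), Nat.mod_eq_of_lt hV]
  | succ N ih =>
    rw [fold_succ, ih (by omega)]
    set j := b.sz 1 - (N + 1) with hj
    rw [pow2_eq (e := j) (by omega)]
    by_cases h : q < j
    · rw [show max (b.sz 1 - N) (q + 1) = j + 1 by omega, show max j (q + 1) = j by omega]
      have h1 := Nat.mod_pow_succ (b := 2) (k := j) (x := V)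
      have h2 := Nat.mod_lt V (pow_pos (show 0 < 2 by omega) j)
      rcases Nat.mod_two_eq_zero_or_one (V / 2 ^ j) with h3 | h3 <;> rw [h3] at h1 <;>
        zify at h1 h2 ⊢ <;> rw [h1]
      · rw [if_neg (by omega)]; ring
      · rw [if_pos ⟨by exact_mod_cast h, by linarith [Int.emod_nonneg (V : ℤ) (pow_pos (show (0:ℤ) < 2 by omega) j).ne']⟩]
        ring
    · rw [if_neg fun h' => h h'.1, show max (b.sz 1 - N) (q + 1) = q + 1 by omega,
        show max j (q + 1) = q + 1 by omega]

theorem bit_iff {b : Base} {V q : ℕ} (hV : V < 2 ^ b.sz 1) (hq : q < b.sz 1) :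
    bit b V q ↔ V.testBit q := by
  rw [bit, lowBits_eq hV hq, pow2_eq hq.le, Nat.testBit_eq_decide_div_mod_eq,
    decide_eq_true_iff]
  have h1 := Nat.mod_pow_succ (b := 2) (k := q) (x := V)
  have h2 := Nat.mod_lt V (pow_pos (show 0 < 2 by omega) q)
  rw [h1]
  rcases Nat.mod_two_eq_zero_or_one (V / 2 ^ q) with h3 | h3 <;> rw [h3] <;> zify at h2 ⊢
  · simp [h2]
  · simp [Int.emod_nonneg (V : ℤ) (pow_pos (show (0:ℤ) < 2 by omega) q).ne']

namespace Base.Valid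

variable {b : Base} (hb : b.Valid)
include hb

theorem radix_pos : 0 < b.sz 2 := by have := hb.lt_radix; omega

theorem slots_lt_codes : 4 * b.sz 3 + 2 < b.sz 1 := by
  rw [hb.codes_eq]
  have := hb.lt_radix
  exact Nat.lt_pow_self (by omega)

theorem radix_pow_le_codes : b.sz 2 ^ 6 ≤ b.sz 1 := by
  rw [hb.codes_eq]
  have := hb.slots_pos
  exact Nat.pow_le_pow_right hb.radix_pos (by omega)

theorem sq_lt_codes : b.sz 0 * b.sz 0 < b.sz 1 := by
  have h := hb.lt_radix
  refine lt_of_lt_of_le ?_ hb.radix_pow_le_codes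
  calc b.sz 0 * b.sz 0 < b.sz 2 * b.sz 2 := by nlinarith
    _ = b.sz 2 ^ 2 := by ring
    _ ≤ _ := Nat.pow_le_pow_right hb.radix_pos (by omega)

theorem lt_codes : b.sz 0 < b.sz 1 := by
  have h := hb.lt_radix
  refine lt_of_lt_of_le (by omega) ((Nat.le_self_pow (n := 6) (by omega) _).trans
    hb.radix_pow_le_codes)

theorem pair_lt_codes {u v : ℕ} (hu : u < b.sz 0) (hv : v < b.sz 0) :
    b.sz 0 * u + v < b.sz 1 := by
  have := hb.sq_lt_codes
  nlinarith

theorem quot_eq {y : ℕ} (hy : y ≤ b.sz 1) : quot b y = y / b.sz 2 := by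
  rw [quot, sum_indicator_eq_min hb.radix_pos, min_eq_right]
  exact (Nat.div_le_self _ _).trans hy

theorem shift_eq {x p : ℕ} (hx : x ≤ b.sz 1) (hp : p ≤ b.sz 1) :
    shift b x p = x / b.sz 2 ^ p := by
  suffices H : ∀ N, fold N x (fun t acc => if t < p then quot b acc else acc) =
      x / b.sz 2 ^ min N p by
    rw [shift, H, min_eq_right hp]
  intro N
  induction N with
  | zero => simp
  | succ N ih =>
    rw [fold_succ, ih]
    split_ifs with h
    · rw [hb.quot_eq ((Nat.div_le_self _ _).trans hx), Nat.div_div_eq_div_mul, ← pow_succ]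
      congr 2
      omega
    · congr 2
      omega

theorem digit_lt (x p : ℕ) : digit b x p < b.sz 2 := by
  unfold digit
  have := hb.radix_pos
  split_ifs <;> omega

theorem digit_eq {x p : ℕ} (hx : x ≤ b.sz 1) (hp : p ≤ b.sz 1) :
    digit b x p = x / b.sz 2 ^ p % b.sz 2 := by
  unfold digit
  have h1 : x / b.sz 2 ^ p ≤ b.sz 1 := (Nat.div_le_self _ _).trans hx
  rw [hb.shift_eq hx hp, hb.quot_eq h1]
  have h2 := Nat.div_add_mod (x / b.sz 2 ^ p) (b.sz 2)
  have h3 := Nat.mod_lt (x / b.sz 2 ^ p) hb.radix_pos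
  rw [if_pos (by omega)]
  omega

theorem isCoding : Cfg.IsCoding (b.sz 1) (b.sz 3) (b.sz 2) (config b) where
  j_lt x := hb.digit_lt _ _
  i_lt x := hb.digit_lt _ _
  lt x l := ⟨hb.digit_lt _ _, hb.digit_lt _ _, hb.digit_lt _ _, hb.digit_lt _ _⟩
  exists_code X hi hj h := by
    -- the digit at position `4 l + r + 2` is item `r` of slot `l`
    obtain ⟨x, hx, hd⟩ := exists_digits hb.radix_pos (4 * b.sz 3 + 2) (fun p =>
      if p = 0 then X.i else if p = 1 then X.j else if (p - 2) / 4 < b.sz 3 then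
        if (p - 2) % 4 = 0 then X.s ((p - 2) / 4) else if (p - 2) % 4 = 1 then X.a ((p - 2) / 4)
        else if (p - 2) % 4 = 2 then X.m ((p - 2) / 4) else X.b ((p - 2) / 4) else 0) (by
      intro p
      have := hb.radix_pos
      split_ifs with h1 h2 h3
      · exact hi
      · exact hj
      · exact (h _ h3).1
      · exact (h _ h3).2.1
      · exact (h _ h3).2.2.1
      · exact (h _ h3).2.2.2
      · exact this)
    have hB := hb.slots_lt_codes
    rw [← hb.codes_eq] at hx
    have hd' : ∀ p < 4 * b.sz 3 + 2, digit b x p = _ := fun p hp =>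
      (hb.digit_eq hx.le (by omega)).trans (hd p hp)
    refine ⟨x, hx, ⟨?_, ?_, fun l hl => ?_⟩, fun l hl => ⟨?_, ?_, ?_⟩⟩
    · exact (hd' 0 (by omega)).trans (by simp)
    · exact (hd' 1 (by omega)).trans (by simp)
    all_goals
      refine (hd' _ (by omega)).trans ?_
      rw [if_neg (by omega), if_neg (by omega), if_pos (by omega)]
    · rw [if_pos (by omega)]; congr 1; omega
    · rw [if_neg (by omega), if_pos (by omega)]; congr 1; omega
    · rw [if_neg (by omega), if_neg (by omega), if_pos (by omega)]; congr 1; omega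
    · rw [if_neg (by omega), if_neg (by omega), if_neg (by omega)]; congr 1; omega

theorem config_zero : (config b 0).i = 0 ∧ (config b 0).j = 0 ∧
    ∀ l < b.sz 3, (config b 0).s l = 0 := by
  have hB := hb.slots_lt_codes
  have h : ∀ p < b.sz 1, digit b 0 p = 0 := fun p hp => by
    rw [hb.digit_eq (Nat.zero_le _) hp.le, Nat.zero_div, Nat.zero_mod]
  exact ⟨h 0 (by omega), h 1 (by omega), fun l hl => h _ (by omega)⟩

end Base.Valid

open Classical in
theorem sum_two_pow_lt (n : ℕ) (P : ℕ → Prop) :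
    ∑ v ∈ Finset.range n, (if P v then 2 ^ v else 0) < 2 ^ n := by
  induction n with
  | zero => simp
  | succ n ih =>
    rw [Finset.sum_range_succ, pow_succ]
    split_ifs <;> omega

open Classical in
theorem testBit_sum_two_pow {n q : ℕ} (P : ℕ → Prop) :
    (∑ v ∈ Finset.range n, (if P v then 2 ^ v else 0)).testBit q ↔ q < n ∧ P q := by
  induction n with
  | zero => simp
  | succ n ih =>
    have hlt := sum_two_pow_lt n P
    rw [Finset.sum_range_succ]
    by_cases hP : P n
    · rw [if_pos hP, add_comm]
      rcases lt_trichotomy q n with h | rfl | h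
      · rw [Nat.testBit_two_pow_add_gt h, ih]
        simp [h, h.trans (Nat.lt_succ_self n)]
      · rw [Nat.testBit_two_pow_add_eq, Nat.testBit_lt_two_pow hlt]
        simpa using hP
      · rw [Nat.testBit_lt_two_pow]
        · simp; omega
        · calc _ < 2 ^ n + 2 ^ n := by omega
            _ = 2 ^ (n + 1) := by ring
            _ ≤ 2 ^ q := Nat.pow_le_pow_right (by omega) h
    · rw [if_neg hP, add_zero, ih]
      refine ⟨fun h => ⟨by omega, h.2⟩, fun h => ⟨?_, h.2⟩⟩
      rcases (show q < n ∨ q = n by omega) with h' | rfl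
      · exact h'
      · exact absurd h.2 hP

/-- The vertices reachable from `p` in at most `t` steps. -/
def Within (n : ℕ) (rel : ℕ → ℕ → Prop) (p : ℕ) : ℕ → ℕ → Prop
  | 0, v => v = p
  | t + 1, v => v < n ∧ (Within n rel p t v ∨ ∃ u < n, Within n rel p t u ∧ rel u v)

theorem Within.lt {n : ℕ} {rel : ℕ → ℕ → Prop} {p : ℕ} (hp : p < n) {t v : ℕ}
    (h : Within n rel p t v) : v < n := by
  cases t with
  | zero => exact h.symm ▸ hp
  | succ t => exact h.1

theorem Within.step {n : ℕ} {rel : ℕ → ℕ → Prop} {p : ℕ} (hp : p < n) {t v : ℕ}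
    (h : Within n rel p t v) : Within n rel p (t + 1) v :=
  ⟨h.lt hp, .inl h⟩

open Classical in
/-- After `n` steps no further vertices are found. -/
theorem within_iff_reflTransGen {n : ℕ} {rel : ℕ → ℕ → Prop} (hrel : ∀ u v, rel u v → v < n)
    {p : ℕ} (hp : p < n) {t : ℕ} (ht : n ≤ t) {v : ℕ} :
    Within n rel p t v ↔ Relation.ReflTransGen rel p v := by
  constructor
  · clear ht
    intro h
    induction t generalizing v with
    | zero => exact h.symm ▸ .refl
    | succ t ih =>
      rcases h.2 with h | ⟨u, -, h, h'⟩
      · exact ih h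
      · exact (ih h).tail h'
  · let S : ℕ → Finset ℕ := fun t => (Finset.range n).filter (Within n rel p t)
    have hmem : ∀ t v, v ∈ S t ↔ Within n rel p t v := fun t v => by
      simp only [S, Finset.mem_filter, Finset.mem_range, and_iff_right_iff_imp]
      exact Within.lt hp
    have hsub : ∀ t, S t ⊆ S (t + 1) := fun t v hv =>
      (hmem _ _).2 (((hmem _ _).1 hv).step hp)
    have hstable : ∀ t, S (t + 1) = S t → ∀ k, S (t + k) = S t := by
      intro t h k
      have heq : ∀ v, Within n rel p (t + 1) v ↔ Within n rel p t v := fun v => by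
        rw [← hmem, ← hmem, h]
      suffices H : ∀ v, Within n rel p (t + k) v ↔ Within n rel p t v by
        ext v; rw [hmem, hmem, H]
      induction k with
      | zero => exact fun _ => Iff.rfl
      | succ k ih =>
        intro v
        rw [← heq v, ← add_assoc]
        simp only [Within, ih]
    obtain ⟨N, hN, hNS⟩ : ∃ N ≤ n, S (N + 1) = S N := by
      by_contra hcon
      push Not at hcon
      have hcard : ∀ N ≤ n, N + 1 ≤ (S N).card := by
        intro N hN
        induction N with
        | zero => exact Finset.card_pos.2 ⟨p, (hmem _ _).2 rfl⟩
        | succ N ih =>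
          have := Finset.card_lt_card ((hsub N).ssubset_of_ne (hcon N (by omega)).symm)
          have := ih (by omega)
          omega
      have h1 := hcard n le_rfl
      have h2 : (S n).card ≤ n := (Finset.card_filter_le _ _).trans (by simp)
      omega
    have hclosed : ∀ u v, u ∈ S t → rel u v → v ∈ S t := by
      intro u v hu huv
      have h1 : S t = S N := by rw [← hstable N hNS (t - N), show N + (t - N) = t by omega]
      rw [h1] at hu ⊢
      rw [← hNS]
      exact (hmem _ _).2 ⟨hrel u v huv, .inr ⟨u, ((hmem _ _).1 hu).lt hp, (hmem _ _).1 hu, huv⟩⟩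
    intro h
    rw [← hmem]
    induction h with
    | refl =>
      clear hclosed ht
      rw [hmem]
      induction t with
      | zero => rfl
      | succ t ih => exact ih.step hp
    | tail _ h' ih => exact hclosed _ _ ih h'

namespace Base.Valid

variable {b : Base} (hb : b.Valid)
include hb

theorem reachSet_eq (rel : ℕ → ℕ → Prop) {p : ℕ} (hp : p < b.sz 0) :
    ∃ V : ℕ, reachSet b rel p = V ∧ V < 2 ^ b.sz 0 ∧
      ∀ v, V.testBit v ↔ Within (b.sz 0) rel p (b.sz 1) v := by
  have hn := hb.lt_codes
  suffices H : ∀ N, ∃ V : ℕ, fold N (pow2 b p) (fun _ acc => ∑ v ∈ Finset.range (b.sz 0),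
      open Classical in
      if bit b acc v ∨ ∃ u < b.sz 0, bit b acc u ∧ rel u v then pow2 b v else 0) = V ∧
      V < 2 ^ b.sz 0 ∧ ∀ v, V.testBit v ↔ Within (b.sz 0) rel p N v from H _
  intro N
  induction N with
  | zero =>
    refine ⟨2 ^ p, ?_, Nat.pow_lt_pow_right (by omega) hp, fun v => ?_⟩
    · rw [fold_zero, pow2_eq (by omega)]; simp
    · rw [Nat.testBit_two_pow]
      simp [Within, eq_comm]
  | succ N ih =>
    classical
    obtain ⟨V, h1, h2, h3⟩ := ih
    have hbit : ∀ v < b.sz 0, (bit b V v ↔ Within (b.sz 0) rel p N v) := fun v hv => by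
      rw [bit_iff (h2.trans (Nat.pow_lt_pow_right (by omega) hn)) (by omega), h3]
    refine ⟨_, ?_, sum_two_pow_lt (b.sz 0) (Within (b.sz 0) rel p (N + 1)), fun v => ?_⟩
    · rw [fold_succ, h1, Nat.cast_sum]
      refine Finset.sum_congr rfl fun v hv => ?_
      have hv' := Finset.mem_range.1 hv
      have : (bit b V v ∨ ∃ u < b.sz 0, bit b V u ∧ rel u v) ↔
          Within (b.sz 0) rel p (N + 1) v := by
        simp only [Within, hv', true_and, hbit v hv']
        refine or_congr_right (exists_congr fun u => and_congr_right fun hu => ?_)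
        rw [hbit u hu]
      rw [pow2_eq (by omega)]
      simp only [this]
      split_ifs <;> simp
    · rw [testBit_sum_two_pow]
      simp only [Within]
      tauto

theorem reach_iff {rel : ℕ → ℕ → Prop} (hrel : ∀ u v, rel u v → v < b.sz 0) (p q : ℕ) :
    reach b rel p q ↔ p < b.sz 0 ∧ q < b.sz 0 ∧ Relation.ReflTransGen rel p q := by
  have hn := hb.lt_codes
  rw [reach, and_assoc]
  refine and_congr_right fun hp => and_congr_right fun hq => ?_
  obtain ⟨V, h1, h2, h3⟩ := hb.reachSet_eq rel hp
  rw [h1, bit_iff (h2.trans (Nat.pow_lt_pow_right (by omega) hn)) (by omega), h3,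
    within_iff_reflTransGen hrel hp hn.le]

theorem conn_eq : conn b = Cfg.Conn (b.sz 0) (b.sz 3) (adjacent b) := by
  funext X p q
  exact propext (hb.reach_iff (fun u v h => h.1.1.2) p q)

theorem value_eq {u v m : ℕ} (hu : u < b.sz 0) (hv : v < b.sz 0) :
    value b u v m = b.w (b.sz 0 * u + v : ℕ) *
      (∏ j ∈ Finset.range (b.sz 0), if j + 1 = m then 1 else (j + 1) : ℕ) *
      2 ^ (b.sz 0 * b.sz 0) + 2 ^ (b.sz 0 * u + v) := by
  have hdouble : ∀ (N : ℕ) (a : ℤ), fold N a (fun _ a => a + a) = a * 2 ^ N := by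
    intro N a
    induction N with
    | zero => simp
    | succ N ih => rw [fold_succ, ih]; ring
  have hdouble' : ∀ (N : ℕ) (a : ℤ), fold N a (fun _ acc => fold (b.sz 0) acc fun _ a => a + a) =
      a * 2 ^ (b.sz 0 * N) := by
    intro N a
    induction N with
    | zero => simp
    | succ N ih => rw [fold_succ, ih, hdouble]; ring
  have hprod : ∀ N ≤ b.sz 0, ∀ a : ℤ, fold N a (fun j acc =>
      if j + 1 = m then acc else ∑ t ∈ Finset.range (b.sz 0), if t ≤ j then acc else 0) =
      a * (∏ j ∈ Finset.range N, if j + 1 = m then 1 else (j + 1) : ℕ) := by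
    intro N hN a
    induction N with
    | zero => simp
    | succ N ih =>
      rw [fold_succ, ih (by omega), Finset.prod_range_succ]
      split_ifs with h
      · simp
      · rw [← Finset.sum_filter, Finset.sum_const, show
          (Finset.range (b.sz 0)).filter (· ≤ N) = Finset.range (N + 1) by
            ext t; simp only [Finset.mem_filter, Finset.mem_range]; omega, Finset.card_range,
          nsmul_eq_mul]
        push_cast
        ring
  rw [value, hprod _ le_rfl, hdouble', pow2_eq (hb.pair_lt_codes hu hv).le]

end Base.Valid

theorem prod_ite_mul {n m : ℕ} (hm : 1 ≤ m) (hmn : m ≤ n) :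
    (∏ j ∈ Finset.range n, if j + 1 = m then 1 else (j + 1)) * m = n.factorial := by
  rw [← Finset.prod_range_add_one_eq_factorial,
    ← Finset.mul_prod_erase (Finset.range n) (fun j => j + 1)
      (Finset.mem_range.2 (show m - 1 < n by omega)),
    ← Finset.mul_prod_erase (Finset.range n) (fun j => if j + 1 = m then 1 else j + 1)
      (Finset.mem_range.2 (show m - 1 < n by omega)), if_pos (by omega), one_mul, mul_comm]
  congr 1
  · omega
  · refine Finset.prod_congr rfl fun j hj => if_neg ?_
    have := Finset.ne_of_mem_erase hj
    omega

end RAM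

namespace RAM

/-! ### Programs that fill tables -/

theorem PolyBounded.exists_monotone {T : ℕ → ℕ} (hT : PolyBounded T) :
    ∃ T', PolyBounded T' ∧ Monotone T' ∧ ∀ S, T S ≤ T' S := by
  obtain ⟨c, e, h⟩ := hT
  exact ⟨fun S => c * (S + 1) ^ e, ⟨c, e, fun _ => le_rfl⟩, fun S S' hS => by dsimp only; gcongr, h⟩

/-- Execution of `p` for the values `0, 1, …, reg k - 1` of register `c`. -/
def forUpto (c k : ℕ) (p : Program) : Program :=
  .seq (.assign c (.const 0)) (.loop (.not (.le (.reg k) (.reg c)))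
    (.seq p (.assign c (.add (.reg c) (.const 1)))))

theorem Runs.forUpto {c k : ℕ} {p : Program} {N T : ℕ} (I : ℕ → State → Prop)
    (hk : ∀ i s, I i s → (s.reg k).toNat = N)
    (hset : ∀ i s v, I i s → I i (s.setReg c v))
    (hp : ∀ i < N, ∀ s : State, s.reg c = (i : ℤ) → I i s →
      Runs p s T fun s' => s'.reg c = (i : ℤ) ∧ I (i + 1) s')
    {s : State} (h0 : I 0 s) :
    Runs (forUpto c k p) s (2 + (N * (4 + (T + 4)) + 4)) (I N) := by
  refine (Runs.assign (Q := fun s' => s' = s.setReg c 0) rfl).seq ?_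
  rintro _ rfl
  refine (Runs.loop (N := N) (T := T + 4) (fun i s' => s'.reg c = i ∧ I i s') ?_ ?_ ?_).mono
    le_rfl fun _ h => h.2
  · rintro i s' ⟨h1, h2⟩ hi
    have := hk i s' h2
    simp only [Test.Holds, Expr.eval, h1]
    omega
  · rintro i s' ⟨h1, h2⟩ hi
    refine (hp i hi s' h1 h2).seq fun s'' h => Runs.assign ?_
    exact ⟨by simp [Expr.eval, h.1], hset _ _ _ h.2⟩
  · exact ⟨by simp, hset _ _ _ h0⟩

/-- `s'` differs from `s` at most in array `a`, in the auxiliary array `4` and in the registers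
from `4` on. -/
def Frame (a : ℕ) (s s' : State) : Prop :=
  (∀ a', a' ≠ a → a' ≠ 4 → s'.arr a' = s.arr a') ∧ ∀ x < 4, s'.reg x = s.reg x

theorem Frame.trans {a : ℕ} {s s' s'' : State} (h : Frame a s s') (h' : Frame a s' s'') :
    Frame a s s'' :=
  ⟨fun x h1 h2 => (h'.1 x h1 h2).trans (h.1 x h1 h2), fun x hx => (h'.2 x hx).trans (h.2 x hx)⟩

theorem Frame.sz {a : ℕ} {s s' : State} (h : Frame a s s') : s'.base.sz = s.base.sz := by
  funext k
  simp only [State.base]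
  rw [h.2 k k.2]

theorem Frame.size {a : ℕ} {s s' : State} (h : Frame a s s') : s'.base.size = s.base.size := by
  rw [Base.size, Base.size, h.sz]

theorem Frame.setReg {a x : ℕ} {s s' : State} (h : Frame a s s') (hx : 4 ≤ x) (v : ℤ) :
    Frame a s (s'.setReg x v) :=
  ⟨h.1, fun y hy => by rw [setReg_reg, Function.update_of_ne (by omega), h.2 y hy]⟩

/-- An array outside the readable part of the memory is filled with the values of `f`. -/
theorem exists_fill {f : Base → ℕ → ℤ} (hf : CompZ fun p : Base × ℕ => f p.1 p.2) (k : Fin 4)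
    {a : ℕ} (h0 : a ≠ 0) (h2 : a ≠ 2) (h3 : a ≠ 3) :
    ∃ T, PolyBounded T ∧ ∃ p, ∀ s, Runs p s (T s.base.size) fun s' =>
      (∀ a', a' ≠ a → s'.arr a' = s.arr a') ∧ (∀ x < 8, x ≠ 4 → s'.reg x = s.reg x) ∧
      ∀ i < s.base.sz k, s'.arr a i = f s.base i := by
  obtain ⟨T, hT, h⟩ := hf
  obtain ⟨q, hq⟩ := h ((), 4) 8 (by change max 8 5 ≤ 8; omega)
  refine ⟨fun S => 2 + (S * (4 + ((T S + 3) + 4)) + 4),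
    (PolyBounded.const 2).add ((PolyBounded.id.mul ((PolyBounded.const 4).add
      ((hT.add (.const 3)).add (.const 4)))).add (.const 4)),
    forUpto 4 k (.seq q (.store a (.reg 4) (.reg 8))), fun s => ?_⟩
  have hbase : ∀ s' : State, (∀ a', a' ≠ a → s'.arr a' = s.arr a') →
      (∀ x < 8, x ≠ 4 → s'.reg x = s.reg x) → s'.base = s.base := by
    intro s' h1 h2'
    simp only [State.base, h1 _ h0.symm, h1 _ h2.symm, h1 _ h3.symm]
    congr 1
    funext k
    rw [h2' k (by omega) (by omega)]
  refine (Runs.forUpto (N := s.base.sz k) (T := T s.base.size + 3) (fun i s' =>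
    (∀ a', a' ≠ a → s'.arr a' = s.arr a') ∧ (∀ x < 8, x ≠ 4 → s'.reg x = s.reg x) ∧
      ∀ j < i, s'.arr a j = f s.base j) ?_ ?_ ?_ ?_).mono ?_ fun _ h => h
  · rintro i s' ⟨-, h, -⟩
    rw [h k (by omega) (by omega)]
    rfl
  · rintro i s' v ⟨h1, h2, h3⟩
    refine ⟨h1, fun x hx hx' => ?_, h3⟩
    rw [setReg_reg, Function.update_of_ne hx', h2 x hx hx']
  · rintro i hi s' h4 ⟨h1, h2, h3⟩
    have hqs := hq s'
    rw [hbase s' h1 h2] at hqs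
    refine hqs.seq fun s'' hs'' => Runs.store ?_
    have hread : Ctx.read (Γ := Base × ℕ) ((), 4) s' = (s.base, i) := by
      change (s'.base, (s'.reg 4).toNat) = _
      rw [hbase s' h1 h2, h4]; simp
    rw [hread] at hs''
    have h4' : s''.reg 4 = i := by rw [hs''.1.2 4 (by omega), h4]
    refine ⟨h4', fun a' ha' => ?_, fun x hx hx' => ?_, fun j hj => ?_⟩
    · rw [setCell_arr, Function.update_of_ne ha', hs''.1.1, h1 a' ha']
    · rw [setCell_reg, hs''.1.2 x hx, h2 x hx hx']
    · simp only [setCell_arr, Expr.eval, Function.update_self, h4', hs''.2]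
      by_cases hji : j = i
      · subst hji; rw [Function.update_self]
      · rw [Function.update_of_ne (by exact_mod_cast hji), hs''.1.1, h3 j (by omega)]
  · exact ⟨fun _ _ => rfl, fun _ _ _ => rfl, fun j hj => by omega⟩
  · have := Nat.mul_le_mul_right (4 + ((T s.base.size + 3) + 4)) (Base.sz_le_size s.base k)
    dsimp only
    omega

/-- A table (array `2` or `3`) is replaced by the values of `f`, which are stored in the auxiliary
array in the meantime since `f` may depend on the table. -/
theorem exists_update {f : Base → ℕ → ℤ} (hf : CompZ fun p : Base × ℕ => f p.1 p.2)
    {a : ℕ} (ha : a ≠ 4) :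
    ∃ T, PolyBounded T ∧ ∃ p, ∀ s, Runs p s (T s.base.size) fun s' =>
      Frame a s s' ∧ s'.reg 5 = s.reg 5 ∧ ∀ i < s.base.sz 1, s'.arr a i = f s.base i := by
  obtain ⟨T, hT, q, hq⟩ := exists_fill hf 1 (a := 4) (by omega) (by omega) (by omega)
  refine ⟨fun S => T S + (2 + (S * (4 + (4 + 4)) + 4)), hT.add ((PolyBounded.const 2).add
    ((PolyBounded.id.mul (.const _)).add (.const 4))),
    .seq q (forUpto 4 1 (.store a (.reg 4) (.get 4 (.reg 4)))), fun s => (hq s).seq ?_⟩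
  rintro s₁ ⟨h1, h2, h3⟩
  refine (Runs.forUpto (N := s.base.sz 1) (T := 4) (fun i s' =>
    (Frame a s s' ∧ s'.reg 5 = s.reg 5) ∧ s'.arr 4 = s₁.arr 4 ∧
      ∀ j < i, s'.arr a j = f s.base j) ?_ ?_ ?_ ?_).mono ?_
      fun _ h => ⟨h.1.1, h.1.2, h.2.2⟩
  · rintro i s' ⟨⟨h, -⟩, -⟩
    rw [h.2 1 (by omega)]
    rfl
  · rintro i s' v ⟨⟨h1, h2⟩, h3, h4⟩
    refine ⟨⟨h1.setReg le_rfl v, ?_⟩, h3, h4⟩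
    rw [setReg_reg, Function.update_of_ne (by omega), h2]
  · rintro i hi s' h4 ⟨⟨e1, e2⟩, e3, e4⟩
    refine Runs.store ⟨h4, ⟨⟨fun a' ha' ha'' => ?_, e1.2⟩, e2⟩, ?_, fun j hj => ?_⟩
    · rw [setCell_arr, Function.update_of_ne ha', e1.1 a' ha' ha'']
    · rw [setCell_arr, Function.update_of_ne ha.symm, e3]
    · simp only [setCell_arr, Expr.eval, Function.update_self, h4, e3]
      by_cases hji : j = i
      · subst hji; rw [Function.update_self, h3 j hi]
      · rw [Function.update_of_ne (by exact_mod_cast hji), e4 j (by omega)]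
  · refine ⟨⟨⟨fun a' _ ha' => h1 a' ha', fun x hx => h2 x (by omega) (by omega)⟩,
      h2 5 (by omega) (by omega)⟩, rfl, fun j hj => by omega⟩
  · have := Base.sz_le_size s.base 1
    omega

/-- A table is set to `0` and then replaced `B` times by the values of `f`. -/
theorem exists_iterate {f : Base → ℕ → ℤ} (hf : CompZ fun p : Base × ℕ => f p.1 p.2)
    {a : ℕ} (ha : a ≠ 4) :
    ∃ T, PolyBounded T ∧ ∃ p, ∀ s (F : ℕ → ℕ → ℤ), (∀ i, F 0 i = 0) →
      (∀ t s', Frame a s s' → (∀ i < s.base.sz 1, s'.arr a i = F t i) →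
        ∀ i < s.base.sz 1, f s'.base i = F (t + 1) i) →
      Runs p s (T s.base.size) fun s' =>
        Frame a s s' ∧ ∀ i < s.base.sz 1, s'.arr a i = F (s.base.sz 1) i := by
  obtain ⟨T₀, hT₀, q₀, hq₀⟩ := exists_update (f := fun _ _ => 0) (CompZ.const 0) ha
  obtain ⟨T, hT, q, hq⟩ := exists_update hf ha
  refine ⟨fun S => T₀ S + (2 + (S * (4 + (T S + 4)) + 4)), hT₀.add ((PolyBounded.const 2).add
    ((PolyBounded.id.mul ((PolyBounded.const 4).add (hT.add (.const 4)))).add (.const 4))),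
    .seq q₀ (forUpto 5 1 q), fun s F hF₀ hF => (hq₀ s).seq ?_⟩
  rintro s₁ ⟨h1, -, h3⟩
  refine (Runs.forUpto (N := s.base.sz 1) (T := T s.base.size) (fun i s' =>
    Frame a s s' ∧ ∀ j < s.base.sz 1, s'.arr a j = F i j) ?_ ?_ ?_ ?_).mono ?_
      fun _ h => h
  · rintro i s' ⟨h, -⟩
    rw [h.2 1 (by omega)]
    rfl
  · rintro i s' v ⟨h1, h2⟩
    exact ⟨h1.setReg (by omega) v, h2⟩
  · rintro i hi s' h5 ⟨e1, e2⟩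
    rw [← e1.size]
    refine (hq s').mono le_rfl ?_
    rintro s'' ⟨g1, g2, g3⟩
    rw [e1.sz] at g3
    exact ⟨g2.trans h5, e1.trans g1, fun j hj => (g3 j hj).trans (hF i s' e1 e2 j hj)⟩
  · exact ⟨h1, fun j hj => (h3 j hj).trans (hF₀ j).symm⟩
  · have := Nat.mul_le_mul_right (4 + (T s.base.size + 4)) (Base.sz_le_size s.base 1)
    omega

/-- Register `k` is set to the value of `f`. -/
theorem exists_set {f : Base → ℤ} (hf : CompZ f) (k : ℕ) :
    ∃ T, PolyBounded T ∧ ∃ p, ∀ s, Runs p s (T s.base.size) fun s' =>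
      s'.arr = s.arr ∧ s'.reg k = f s.base ∧ ∀ x < 4, x ≠ k → s'.reg x = s.reg x := by
  obtain ⟨T, hT, h⟩ := hf
  obtain ⟨q, hq⟩ := h () 8 le_rfl
  refine ⟨fun S => T S + 2, hT.add (.const 2), .seq q (.assign k (.reg 8)), fun s =>
    (hq s).seq fun s' hs' => Runs.assign ⟨hs'.1.1, ?_, fun x hx hxk => ?_⟩⟩
  · rw [setReg_reg, Function.update_self]
    exact hs'.2
  · rw [setReg_reg, Function.update_of_ne hxk, hs'.1.2 x (by omega)]

end RAM

namespace RAM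

/-! ### The program -/

/-- The configurations recognised in `t` rounds as having pending vertices that can be placed one
by one on the boundary. -/
def placeable (b : Base) (t : ℕ) : ℕ → Prop :=
  (Cfg.stepG (b.sz 1) (b.sz 0) (b.sz 3) (adjacent b) (conn b) (config b))^[t] fun _ => False

/-- The values of the configurations after `t` rounds. -/
noncomputable def optimum (b : Base) (t : ℕ) : ℕ → ℤ :=
  (Cfg.stepH (b.sz 1) (b.sz 0) (b.sz 3) (adjacent b) (value b) (conn b) (config b))^[t] fun _ => 0

/-- The output: the set of vertices reachable from `v` along edges whose bit in `V` is `1`. -/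
noncomputable def label (b : Base) (V : ℤ) (v : ℕ) : ℤ :=
  reachSet b (fun u v => adjacent b u v ∧ bit b V (b.sz 0 * u + v)) v

/-- A radix that exceeds the number of vertices and all weights. -/
def radix (w : ℤ → ℤ) (n : ℕ) : ℕ :=
  n + 2 + ∑ u ∈ Finset.range n, ∑ v ∈ Finset.range n, (w ((n * u + v : ℕ) : ℤ)).natAbs

/-- The readable part of the memory for `n` vertices, radix `M` and `K` slots. -/
def baseOf (w : ℤ → ℤ) (n M K : ℕ) : Base :=
  ⟨w, fun _ => 0, fun _ => 0, ![n, M ^ (4 * K + 2), M, K]⟩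

theorem baseOf_valid {w : ℤ → ℤ} {n M K : ℕ} (hM : n + 1 < M) (hK : 0 < K) :
    (baseOf w n M K).Valid := ⟨hM, hK, rfl⟩

theorem placeable_congr {b b' : Base} (hw : b.w = b'.w) (hsz : b.sz = b'.sz) :
    placeable b = placeable b' := by
  obtain ⟨w, G, H, sz⟩ := b
  obtain ⟨w', G', H', sz'⟩ := b'
  obtain rfl : w = w' := hw
  obtain rfl : sz = sz' := hsz
  rfl

theorem optimum_congr {b b' : Base} (hw : b.w = b'.w) (hsz : b.sz = b'.sz) :
    optimum b = optimum b' := by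
  obtain ⟨w, G, H, sz⟩ := b
  obtain ⟨w', G', H', sz'⟩ := b'
  obtain rfl : w = w' := hw
  obtain rfl : sz = sz' := hsz
  rfl

theorem label_congr {b b' : Base} (hw : b.w = b'.w) (hsz : b.sz = b'.sz) :
    label b = label b' := by
  obtain ⟨w, G, H, sz⟩ := b
  obtain ⟨w', G', H', sz'⟩ := b'
  obtain rfl : w = w' := hw
  obtain rfl : sz = sz' := hsz
  rfl

open Classical in
/-- Array `2` can be filled with the truth values of `placeable` after `B` rounds. -/
theorem exists_placeable :
    ∃ T, PolyBounded T ∧ ∃ p, ∀ s, Runs p s (T s.base.size) fun s' => Frame 2 s s' ∧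
      ∀ i < s.base.sz 1, s'.arr 2 i = if placeable s.base (s.base.sz 1) i then 1 else 0 := by
  obtain ⟨T, hT, p, hp⟩ := exists_iterate (a := 2)
    (f := fun b x => if Cfg.stepG (b.sz 1) (b.sz 0) (b.sz 3) (adjacent b) (conn b) (config b)
      (fun z => b.G z = 1) x then 1 else 0) (CompP.stepG (Γ := Base × ℕ) (β := Prod.fst) (x := Prod.snd) IsBase.id.weaken .last) (by omega)
  refine ⟨T, hT, p, fun s => hp s (fun t i => if placeable s.base t i then 1 else 0)
    (fun i => if_neg (by simp [placeable])) fun t s' hs' hF i _ => ?_⟩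
  congr 1
  have hsz := hs'.sz
  have hw : s'.base.w = s.base.w := hs'.1 0 (by omega) (by omega)
  rw [← placeable_congr hw hsz, placeable, Function.iterate_succ_apply']
  have hG : ∀ z < s'.base.sz 1, s'.base.G z = 1 ↔ placeable s'.base t z := fun z hz => by
    rw [hsz] at hz
    rw [placeable_congr hw hsz]
    have := hF z hz
    change s'.arr 2 z = 1 ↔ _
    rw [this]
    split_ifs with h <;> simp [h]
  unfold Cfg.stepG
  refine propext (or_congr_right (or_congr (exists_congr fun z => and_congr_right fun hz =>
    and_congr_left fun _ => hG z hz) (exists_congr fun y => and_congr_right fun hy =>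
    and_congr (hG y hy) (exists_congr fun z => and_congr_right fun hz =>
    and_congr_left fun _ => hG z hz))))

theorem maxUpto_congr {N : ℕ} {f g : ℕ → ℤ} (h : ∀ i < N, f i = g i) :
    maxUpto N f = maxUpto N g := by
  unfold maxUpto
  induction N with
  | zero => rfl
  | succ N ih => rw [fold_succ, fold_succ, ih fun i hi => h i (by omega), h N (by omega)]

theorem stepH_congr {B n K : ℕ} {adj : ℕ → ℕ → Prop} {val : ℕ → ℕ → ℕ → ℤ}
    {R : Cfg → ℕ → ℕ → Prop} {cfg : ℕ → Cfg} {h h' : ℕ → ℤ} (hh : ∀ z < B, h z = h' z) {x : ℕ} :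
    Cfg.stepH B n K adj val R cfg h x = Cfg.stepH B n K adj val R cfg h' x := by
  unfold Cfg.stepH
  congr 1
  · exact maxUpto_congr fun z hz => by rw [hh z hz]
  · exact maxUpto_congr fun y hy => maxUpto_congr fun z hz => by rw [hh y hy, hh z hz]

/-- Array `3` can be filled with the values of `optimum` after `B` rounds. -/
theorem exists_optimum :
    ∃ T, PolyBounded T ∧ ∃ p, ∀ s, Runs p s (T s.base.size) fun s' => Frame 3 s s' ∧
      ∀ i < s.base.sz 1, s'.arr 3 i = optimum s.base (s.base.sz 1) i := by
  classical
  obtain ⟨T, hT, p, hp⟩ := exists_iterate (a := 3)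
    (f := fun b => Cfg.stepH (b.sz 1) (b.sz 0) (b.sz 3) (adjacent b) (value b) (conn b) (config b)
      fun z => b.H z) (CompZ.stepH (Γ := Base × ℕ) (β := Prod.fst) (x := Prod.snd) IsBase.id.weaken .last) (by omega)
  refine ⟨T, hT, p, fun s => hp s (optimum s.base) (fun _ => rfl) fun t s' hs' hF i _ => ?_⟩
  have hsz := hs'.sz
  have hw : s'.base.w = s.base.w := hs'.1 0 (by omega) (by omega)
  rw [← optimum_congr hw hsz, optimum, Function.iterate_succ_apply']
  have hH : ∀ z < s'.base.sz 1, s'.base.H z = optimum s'.base t z := fun z hz => by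
    rw [hsz] at hz
    rw [optimum_congr hw hsz]
    exact hF z hz
  exact stepH_congr hH

theorem compZ_radix : CompZ fun b : Base => (radix b.w (b.sz 0) : ℤ) := by
  have h2 : IsBase fun p : (Base × ℕ) × ℕ => p.1.1 := IsBase.id.weaken.weaken
  have hw : CompZ fun p : (Base × ℕ) × ℕ => p.1.1.w ((p.1.1.sz 0 * p.1.2 + p.2 : ℕ) : ℤ) :=
    .getW h2 (CompN.pair h2 .var .last)
  have habs : CompZ fun p : (Base × ℕ) × ℕ => |p.1.1.w ((p.1.1.sz 0 * p.1.2 + p.2 : ℕ) : ℤ)| :=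
    (CompZ.ite (.le (.const 0) hw) hw (.sub (.const 0) hw)).congr fun p => by
      split_ifs with h
      · exact (abs_of_nonneg h).symm
      · rw [abs_of_neg (not_le.1 h), zero_sub]
  have hsum : CompZ fun p : Base × ℕ => ∑ v ∈ Finset.range (p.1.sz 0),
      |p.1.w ((p.1.sz 0 * p.2 + v : ℕ) : ℤ)| :=
    .sum (f := fun (p : Base × ℕ) v => |p.1.w ((p.1.sz 0 * p.2 + v : ℕ) : ℤ)|) IsBase.id.weaken habs
  refine CompZ.congr (.add (CompN.add (.sz IsBase.id 0) (.const 2)) (.sum (f := fun (b : Base) u =>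
    ∑ v ∈ Finset.range (b.sz 0), |b.w ((b.sz 0 * u + v : ℕ) : ℤ)|) IsBase.id (k := 0) hsum)) ?_
  intro b
  rw [radix]
  push_cast
  rfl

/-- The output can be written to array `1`, once array `3` contains the optimum. -/
theorem exists_label :
    ∃ T, PolyBounded T ∧ ∃ p, ∀ s, Runs p s (T s.base.size) fun s' =>
      ∀ v < s.base.sz 0, s'.arr 1 v = label s.base (s.base.H 0) v := by
  have h4 : IsBase fun p : ((((Base × ℕ) × ℕ) × ℤ) × ℕ) × ℕ => p.1.1.1.1.1 :=
    IsBase.id.weaken.weaken.weaken.weaken.weaken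
  have hf : CompZ fun p : Base × ℕ => label p.1 (p.1.H 0) p.2 :=
    .reachSet (rel := fun (p : Base × ℕ) u v =>
        adjacent p.1 u v ∧ bit p.1 (p.1.H 0) (p.1.sz 0 * u + v)) IsBase.id.weaken
      (.and (.adjacent h4 .last .var) (.bit h4 (.getH h4 (.const 0)) (.pair h4 .last .var))) .last
  obtain ⟨T, hT, p, hp⟩ := exists_fill (f := fun b => label b (b.H 0)) hf 0 (a := 1) (by omega) (by omega) (by omega)
  exact ⟨T, hT, p, fun s => (hp s).mono le_rfl fun s' h => h.2.2⟩

/-- The memory holds `b` up to the contents of the tables. -/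
def Holds (s : State) (b : Base) : Prop := s.arr 0 = b.w ∧ ∀ k : Fin 4, s.reg k = b.sz k

theorem Holds.sz {s : State} {b : Base} (h : Holds s b) : s.base.sz = b.sz := by
  funext k
  simp [State.base, h.2 k]

theorem Holds.size {s : State} {b : Base} (h : Holds s b) : s.base.size = b.size := by
  rw [Base.size, Base.size, h.sz]

theorem Holds.frame {s s' : State} {b : Base} {a : ℕ} (h : Holds s b) (hs : Frame a s s')
    (ha : a ≠ 0) : Holds s' b :=
  ⟨(hs.1 0 ha.symm (by omega)).trans h.1, fun k => (hs.2 k k.2).trans (h.2 k)⟩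

/-- One program for all games: the number of slots is increased until the pending vertices of the
configuration with code `0`, i.e. all vertices, can be placed one by one on the boundary. -/
theorem exists_program : ∃ T, PolyBounded T ∧ ∃ p, ∀ (w : ℤ → ℤ) (n K : ℕ) (b : Base),
    b = baseOf w n (radix w n) K → 0 < K → placeable b (b.sz 1) 0 →
    (∀ K', 0 < K' → K' < K → ¬ placeable (baseOf w n (radix w n) K')
      ((baseOf w n (radix w n) K').sz 1) 0) →
    ∀ s : State, s.arr 0 = w → s.reg 0 = n → (∀ x, x ≠ 0 → s.reg x = 0) →
    Runs p s (T b.size) fun s' => ∀ v < n, s'.arr 1 v = label b (optimum b (b.sz 1) 0) v := by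
  classical
  obtain ⟨T₁, hT₁, p₁, hp₁⟩ := exists_set compZ_radix 2
  obtain ⟨T₂, hT₂, p₂, hp₂⟩ := exists_set (f := fun b : Base => ((b.sz 2 * (b.sz 2 * (b.sz 2 *
    (b.sz 2 * (b.sz 2 * b.sz 2)))) : ℕ) : ℤ)) (CompN.szMul IsBase.id 2 (.szMul IsBase.id 2
      (.szMul IsBase.id 2 (.szMul IsBase.id 2 (.szMul IsBase.id 2 (.sz IsBase.id 2)))))) 1
  obtain ⟨T₃, hT₃, p₃, hp₃⟩ := exists_set (f := fun b : Base => ((b.sz 2 * (b.sz 2 * (b.sz 2 *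
    (b.sz 2 * b.sz 1))) : ℕ) : ℤ)) (CompN.szMul IsBase.id 2 (.szMul IsBase.id 2
      (.szMul IsBase.id 2 (.szMul IsBase.id 2 (.sz IsBase.id 1))))) 1
  obtain ⟨T₄, hT₄, p₄, hp₄⟩ := exists_placeable
  obtain ⟨T₅, hT₅, p₅, hp₅⟩ := exists_optimum
  obtain ⟨T₆, hT₆, p₆, hp₆⟩ := exists_label
  obtain ⟨U₁, hU₁, m₁, le₁⟩ := hT₁.exists_monotone
  obtain ⟨U₂, hU₂, m₂, le₂⟩ := hT₂.exists_monotone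
  obtain ⟨U₃, hU₃, m₃, le₃⟩ := hT₃.exists_monotone
  obtain ⟨U₄, hU₄, m₄, le₄⟩ := hT₄.exists_monotone
  refine ⟨fun S => U₁ S + (2 + (U₂ S + (U₄ S + ((S * (5 + (4 + (U₃ S + U₄ S))) + 5) +
    (T₅ S + T₆ S))))), hU₁.add ((PolyBounded.const 2).add (hU₂.add (hU₄.add
      (((PolyBounded.id.mul ((PolyBounded.const 5).add ((PolyBounded.const 4).add
        (hU₃.add hU₄)))).add (.const 5)).add (hT₅.add hT₆))))),
    .seq p₁ (.seq (.assign 3 (.const 1)) (.seq p₂ (.seq p₄ (.seq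
      (.loop (.not (.eq (.get 2 (.const 0)) (.const 1)))
        (.seq (.assign 3 (.add (.reg 3) (.const 1))) (.seq p₃ p₄)))
      (.seq p₅ p₆))))), ?_⟩
  intro w n K b hbK hK hgood hbad s hw hn hzero
  set M := radix w n with hM
  have hMn : n + 1 < M := by rw [hM, radix]; omega
  -- the numbers in the registers never exceed their final values
  have hsize : ∀ b' : Base, (∀ k, b'.sz k ≤ b.sz k) → b'.size ≤ b.size := fun b' h =>
    Finset.sum_le_sum fun k _ => h k
  have hBK : ∀ K' ≤ K, M ^ (4 * K' + 2) ≤ M ^ (4 * K + 2) := fun K' hK' =>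
    Nat.pow_le_pow_right (by omega) (by omega)
  have hsz : b.sz = ![n, M ^ (4 * K + 2), M, K] := by rw [hbK]; rfl
  have hMB : M ≤ M ^ (4 * K + 2) := Nat.le_self_pow (by omega) _
  have hsizeK : ∀ K' ≤ K, (baseOf w n M K').size ≤ b.size := fun K' hK' => hsize _ fun k => by
    rw [hsz]
    have := hBK K' hK'
    fin_cases k <;> simp [baseOf, this, hK']
  -- the table of the placeable configurations is correct at code `0`
  have hplace : ∀ K', 0 < K' → K' ≤ K → ∀ s', Holds s' (baseOf w n M K') →
      Runs p₄ s' (U₄ b.size) fun s'' => Holds s'' (baseOf w n M K') ∧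
        (s''.arr 2 0 = 1 ↔ placeable (baseOf w n M K') ((baseOf w n M K').sz 1) 0) := by
    intro K' hK' hKK s' hs'
    refine (hp₄ s').mono ?_ ?_
    · rw [hs'.size]
      exact (le₄ _).trans (m₄ (hsizeK K' hKK))
    · rintro s'' ⟨h1, h2⟩
      refine ⟨hs'.frame h1 (by omega), ?_⟩
      have h0 : 0 < s'.base.sz 1 := by
        rw [hs'.sz]
        exact pow_pos (show 0 < M by omega) _
      have := h2 0 h0
      rw [Nat.cast_zero] at this
      rw [this, placeable_congr (b' := baseOf w n M K') hs'.1 hs'.sz, hs'.sz]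
      split_ifs with h <;> simp [h]
  have hs0 : s.base.sz 0 = n := by simp [State.base, hn]
  refine ((hp₁ s).mono (T' := U₁ b.size) ((le₁ _).trans (m₁ (hsize _ fun k => ?_)))
    fun _ h => h).seq ?_
  · rw [hsz]
    fin_cases k <;> simp [State.base, hn, hzero]
  rintro s₁ ⟨a1, a2, a3⟩
  rw [hs0, show s.base.w = w from hw, ← hM] at a2
  refine (Runs.assign (Q := fun s' => s' = s₁.setReg 3 1) rfl).seq ?_
  rintro _ rfl
  have r0 : s₁.reg 0 = n := (a3 0 (by omega) (by omega)).trans hn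
  have r1 : s₁.reg 1 = 0 := (a3 1 (by omega) (by omega)).trans (hzero 1 (by omega))
  refine ((hp₂ _).mono (T' := U₂ b.size) ((le₂ _).trans (m₂ (hsize _ fun k => ?_)))
    fun _ h => h).seq ?_
  · rw [hsz]
    fin_cases k
    · simp [State.base, r0]
    · simp [State.base, r1]
    · simp [State.base, a2]
    · simpa [State.base] using Nat.succ_le_of_lt hK
  rintro s₂ ⟨b1, b2, b3⟩
  have hs₂ : Holds s₂ (baseOf w n M 1) := by
    refine ⟨by rw [b1, setReg_arr, a1, hw]; rfl, fun k => ?_⟩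
    fin_cases k
    · simpa [r0, baseOf] using b3 0 (by omega) (by omega)
    · refine b2.trans ?_
      simp [State.base, a2, baseOf]
      ring
    · simpa [a2, baseOf] using b3 2 (by omega) (by omega)
    · simpa [baseOf] using b3 3 (by omega) (by omega)
  refine (hplace 1 (by omega) (by omega) s₂ hs₂).seq fun s₃ hs₃ => ?_
  refine ((Runs.loop (N := K - 1) (T := 4 + (U₃ b.size + U₄ b.size))
    (fun i s' => Holds s' (baseOf w n M (i + 1)) ∧ (s'.arr 2 0 = 1 ↔
      placeable (baseOf w n M (i + 1)) ((baseOf w n M (i + 1)).sz 1) 0)) ?_ ?_ hs₃).mono ?_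
      fun _ h => h).seq ?_
  · rintro i s' ⟨-, h⟩ hi
    simp only [Test.Holds, Expr.eval]
    rw [h]
    rcases hi.lt_or_eq with h1 | h1
    · simp [h1, hbad (i + 1) (by omega) (by omega)]
    · have : b = baseOf w n M (i + 1) := by rw [hbK, show K = i + 1 by omega]
      rw [← this]
      simp [h1, hgood]
  · rintro i s' ⟨h, -⟩ hi
    refine (Runs.assign (Q := fun s'' => s'' = s'.setReg 3 (s'.reg 3 + 1)) rfl).seq ?_
    rintro _ rfl
    have e : ∀ k : Fin 4, k ≠ 3 → (s'.setReg 3 (s'.reg 3 + 1)).base.sz k =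
        (baseOf w n M (i + 1)).sz k := fun k hk => by
      have hk' : (k : ℕ) ≠ 3 := fun h' => hk (Fin.ext h')
      simp [State.base, Function.update_of_ne hk', h.2 k]
    refine ((hp₃ _).mono (T' := U₃ b.size) ((le₃ _).trans (m₃ (hsize _ fun k => ?_)))
      fun _ h => h).seq ?_
    · by_cases hk : k = 3
      · subst hk
        have : s'.reg 3 = i + 1 := by simpa [baseOf] using h.2 3
        rw [hsz]
        simp [State.base, this]
        omega
      · rw [e k hk, hsz]
        have := hBK (i + 1) (by omega)
        fin_cases k <;> simp [baseOf, this]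
        exact absurd rfl hk
    · rintro s'' ⟨c1, c2, c3⟩
      refine hplace (i + 1 + 1) (by omega) (by omega) s'' ⟨by rw [c1, setReg_arr, h.1]; rfl,
        fun k => ?_⟩
      rw [e 2 (by decide), e 1 (by decide)] at c2
      fin_cases k
      · simpa [baseOf, h.2 0] using (c3 0 (by omega) (by omega)).trans (h.2 0)
      · refine c2.trans ?_
        simp [baseOf]
        ring
      · simpa [baseOf] using (c3 2 (by omega) (by omega)).trans (h.2 2)
      · have : s'.reg 3 = i + 1 := by simpa [baseOf] using h.2 3
        simpa [baseOf, this] using c3 3 (by omega) (by omega)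
  · have h1 : K - 1 ≤ b.size := (Nat.sub_le _ _).trans
      ((show K = b.sz 3 by rw [hsz]; rfl) ▸ b.sz_le_size 3)
    have := Nat.mul_le_mul_right (5 + (4 + (U₃ b.size + U₄ b.size))) h1
    exact Nat.add_le_add_right this 5
  · rintro s₄ ⟨h, -⟩
    rw [show K - 1 + 1 = K by omega, ← hbK] at h
    rw [← h.size]
    refine (hp₅ s₄).seq ?_
    rintro s₅ ⟨d1, d2⟩
    have h' := h.frame d1 (by omega)
    rw [← d1.size]
    refine (hp₆ s₅).mono le_rfl fun s₆ h₆ v hv => ?_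
    rw [h₆ v (by rw [h'.sz, hsz]; exact hv), label_congr h'.1 h'.sz]
    congr 1
    have := d2 0 (by rw [h.sz, hsz]; exact pow_pos (show 0 < M by omega) _)
    rw [Nat.cast_zero] at this
    change s₅.arr 3 0 = _
    rw [this, optimum_congr h.1 h.sz, h.sz]

end RAM

/-! ### Optimal coalitions -/

section Relaxation

open Finset

variable {n : ℕ} {ω : Fin n → Fin n → ℚ} {c : Fin n → ℕ} {μ : ℕ → ℕ}

/-- The value of the coalitions with names `c v`, computed with the claimed sizes `μ`. -/
def relaxedWelfare (ω : Fin n → Fin n → ℚ) (c : Fin n → ℕ) (μ : ℕ → ℕ) : ℚ :=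
  ∑ u, ∑ v, if c u = c v then ω u v / μ (c u) else 0

/-- The claimed sizes are at least the sizes of the coalitions, and at most `n`. -/
def Claims (c : Fin n → ℕ) (μ : ℕ → ℕ) : Prop :=
  (∀ q, μ q ≤ n) ∧ ∀ v, #{u | c u = c v} ≤ μ (c v)

/-- If a coalition of a relaxed optimum decomposes into classes without edges between them, then
no class has negative weight, since otherwise its members would be better off alone. -/
theorem class_weight_nonneg (h0 : ∀ u, ω u u = 0) (hcn : ∀ v, c v < n) (hcl : Claims c μ)
    (hmax : ∀ c' μ', Claims c' μ' → relaxedWelfare ω c' μ' ≤ relaxedWelfare ω c μ)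
    (s : Setoid (Fin n)) [DecidableRel s.r] (hs : ∀ u v, s u v → c u = c v)
    (hedge : ∀ u v, c u = c v → ω u v ≠ 0 → s u v) (x : Fin n) :
    0 ≤ ∑ u, ∑ v, if s.r u x ∧ s.r v x then ω u v else 0 := by
  have hμ : 0 < μ (c x) := lt_of_lt_of_le (card_pos.2 ⟨x, by simp⟩) (hcl.2 x)
  set c' : Fin n → ℕ := fun v => if s.r v x then n + v else c v with hc'
  set μ' : ℕ → ℕ := fun q => if q < n then μ q else 1 with hμ'
  have hcl' : Claims c' μ' := by
    refine ⟨fun q => ?_, fun v => ?_⟩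
    · simp only [hμ']
      split_ifs
      · exact hcl.1 q
      · have := x.2; omega
    · by_cases hv : s.r v x
      · have e : c' v = n + v := if_pos hv
        rw [e, hμ']
        simp only [not_lt.2 (Nat.le_add_right n v), if_false]
        refine card_le_one.2 fun a ha b hb => ?_
        have key : ∀ a : Fin n, c' a = n + v → a = v := fun a ha => by
          simp only [hc'] at ha
          split_ifs at ha
          · exact Fin.ext (by omega)
          · have := hcn a; omega
        rw [key a (by simpa using ha), key b (by simpa using hb)]
      · have e : c' v = c v := if_neg hv
        rw [e, hμ']
        simp only [hcn v, if_true]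
        refine le_trans (card_le_card fun a ha => ?_) (hcl.2 v)
        simp only [mem_filter, mem_univ, true_and, hc'] at ha ⊢
        split_ifs at ha
        · have := hcn v; omega
        · exact ha
  have hdiff : relaxedWelfare ω c μ - relaxedWelfare ω c' μ' =
      (∑ u, ∑ v, if s.r u x ∧ s.r v x then ω u v else 0) / μ (c x) := by
    simp only [relaxedWelfare, ← sum_sub_distrib, sum_div]
    refine sum_congr rfl fun u _ => sum_congr rfl fun v _ => ?_
    by_cases hu : s.r u x <;> by_cases hv : s.r v x
    · have h1 : c u = c v := (hs _ _ hu).trans (hs _ _ hv).symm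
      have hk : s.r u x ∧ s.r v x := ⟨hu, hv⟩
      rw [if_pos h1, if_pos hk, hs _ _ hu]
      by_cases huv : u = v
      · simp [huv, h0]
      · have : c' u ≠ c' v := by
          simp only [hc', if_pos hu, if_pos hv]
          intro h
          exact huv (Fin.ext (by omega))
        rw [if_neg this, sub_zero]
    · have h1 : c' u ≠ c' v := by
        simp only [hc', if_pos hu, if_neg hv]
        have := hcn v; omega
      have hk : ¬ (s.r u x ∧ s.r v x) := fun h => hv h.2
      rw [if_neg h1, if_neg hk]
      split_ifs with h
      · by_cases hω : ω u v = 0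
        · simp [hω]
        · exact absurd (s.trans (s.symm (hedge u v h hω)) hu) hv
      · simp
    · have h1 : c' u ≠ c' v := by
        simp only [hc', if_neg hu, if_pos hv]
        have := hcn u; omega
      have hk : ¬ (s.r u x ∧ s.r v x) := fun h => hu h.1
      rw [if_neg h1, if_neg hk]
      split_ifs with h
      · by_cases hω : ω u v = 0
        · simp [hω]
        · exact absurd (s.trans (hedge u v h hω) hv) hu
      · simp
    · have h1 : c' u = c u := if_neg hu
      have h2 : c' v = c v := if_neg hv
      have hk : ¬ (s.r u x ∧ s.r v x) := fun h => hu h.1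
      rw [h1, h2, if_neg hk]
      simp [hμ', hcn u]
  have h := hmax c' μ' hcl'
  have h2 : 0 ≤ (∑ u, ∑ v, if s.r u x ∧ s.r v x then ω u v else 0) / (μ (c x) : ℚ) := by
    rw [← hdiff]; linarith
  by_contra hneg
  have : (∑ u, ∑ v, if s.r u x ∧ s.r v x then ω u v else 0) / (μ (c x) : ℚ) < 0 :=
    div_neg_of_neg_of_pos (not_le.1 hneg) (by exact_mod_cast hμ)
  linarith

/-- The classes of a relaxed optimum, with their true sizes, are at least as good. -/
theorem relaxedWelfare_le_classes (h0 : ∀ u, ω u u = 0) (hcn : ∀ v, c v < n) (hcl : Claims c μ)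
    (hmax : ∀ c' μ', Claims c' μ' → relaxedWelfare ω c' μ' ≤ relaxedWelfare ω c μ)
    (s : Setoid (Fin n)) [DecidableRel s.r] (hs : ∀ u v, s u v → c u = c v)
    (hedge : ∀ u v, c u = c v → ω u v ≠ 0 → s u v) :
    relaxedWelfare ω c μ ≤ ∑ u, ∑ v, if s.r u v then ω u v / #{x | s.r x u} else 0 := by
  have hcard : ∀ u v, s.r u v → #{x | s.r x u} = #{x | s.r x v} := fun u v huv => by
    congr 1
    ext x
    simp only [mem_filter, mem_univ, true_and]
    exact ⟨fun h => s.trans h huv, fun h => s.trans h (s.symm huv)⟩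
  have hpos : ∀ u, 0 < #{x | s.r x u} := fun u => card_pos.2 ⟨u, by simp⟩
  have hle : ∀ u, #{x | s.r x u} ≤ μ (c u) := fun u => (card_le_card fun x hx => by
    simp only [mem_filter, mem_univ, true_and] at hx ⊢
    exact hs _ _ hx).trans (hcl.2 u)
  -- the surplus per unit of weight; it is constant on classes
  set h : Fin n → ℚ := fun u => 1 / #{x | s.r x u} - 1 / μ (c u) with hh
  have hh0 : ∀ u, 0 ≤ h u := fun u => sub_nonneg.2
    (one_div_le_one_div_of_le (by exact_mod_cast hpos u) (by exact_mod_cast hle u))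
  have hhc : ∀ u v, s.r u v → h u = h v := fun u v huv => by
    simp only [hh, hcard u v huv, hs u v huv]
  have hdiff : (∑ u, ∑ v, if s.r u v then ω u v / #{x | s.r x u} else 0) - relaxedWelfare ω c μ =
      ∑ u, h u * ∑ v, if s.r u v then ω u v else 0 := by
    simp only [relaxedWelfare, ← sum_sub_distrib, mul_sum]
    refine sum_congr rfl fun u _ => sum_congr rfl fun v _ => ?_
    by_cases huv : s.r u v
    · rw [if_pos huv, if_pos huv, if_pos (hs _ _ huv), hh]
      ring
    · rw [if_neg huv, if_neg huv]
      split_ifs with hc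
      · by_cases hω : ω u v = 0
        · simp [hω]
        · exact absurd (hedge u v hc hω) huv
      · simp
  -- averaging over the class of `u` turns the sum over `u` into a sum over classes
  have hswap : ∑ u, h u * ∑ v, (if s.r u v then ω u v else 0) =
      ∑ x, h x / #{y | s.r y x} * ∑ u, ∑ v, if s.r u x ∧ s.r v x then ω u v else 0 := by
    simp only [mul_sum]
    rw [sum_comm (s := univ) (t := univ) (f := fun x u => ∑ v, _)]
    refine sum_congr rfl fun u _ => ?_
    rw [sum_comm]
    refine sum_congr rfl fun v _ => ?_
    by_cases huv : s.r u v
    · have : ∀ x, h x / (#{y | s.r y x} : ℚ) * (if s.r u x ∧ s.r v x then ω u v else 0) =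
          if s.r x u then h u / #{y | s.r y u} * ω u v else 0 := fun x => by
        by_cases hx : s.r x u
        · rw [if_pos ⟨s.symm hx, s.trans (s.symm huv) (s.symm hx)⟩, if_pos hx, hhc x u hx,
            hcard x u hx]
        · rw [if_neg fun h' => hx (s.symm h'.1), if_neg hx, mul_zero]
      simp only [this]
      rw [← sum_filter, sum_const, nsmul_eq_mul, if_pos huv]
      have := (hpos u).ne'
      field_simp
    · rw [if_neg huv, mul_zero]
      refine (sum_eq_zero fun x _ => ?_).symm
      rw [if_neg fun h' => huv (s.trans h'.1 (s.symm h'.2)), mul_zero]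
  rw [← sub_nonneg, hdiff, hswap]
  exact sum_nonneg fun x _ => mul_nonneg (div_nonneg (hh0 x) (Nat.cast_nonneg _))
    (class_weight_nonneg h0 hcn hcl hmax s hs hedge x)

end Relaxation

section Welfare

open Finset

variable {n : ℕ}

theorem Finpartition.sum_parts_eq (P : CoalitionStructure n) (f : Fin n → Finset (Fin n) → ℚ) :
    ∑ C ∈ P.parts, ∑ v ∈ C, f v C = ∑ v, f v (P.part v) := by
  have h1 : ∑ C ∈ P.parts, ∑ v ∈ C, f v C = ∑ C ∈ P.parts, ∑ v ∈ C, f v (P.part v) :=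
    sum_congr rfl fun C hC => sum_congr rfl fun v hv => by rw [P.part_eq_of_mem hC hv]
  have h2 := sum_biUnion (s := P.parts) (t := id) (f := fun v => f v (P.part v)) P.disjoint
  rw [P.biUnion_parts] at h2
  exact h1.trans h2.symm

theorem FractionalHedonicGame.welfare_eq (g : FractionalHedonicGame n) (P : CoalitionStructure n) :
    g.utilitarianWelfare P = ∑ u, ∑ v, if P.part u = P.part v then
      (g.weight u v : ℚ) / (P.part u).card else 0 := by
  classical
  rw [utilitarianWelfare, P.sum_parts_eq fun v C => g.utility v C]
  refine sum_congr rfl fun u _ => ?_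
  rw [utility, sum_div, sum_filter, ← sum_filter_add_sum_filter_not univ (· ∈ P.part u)]
  have h1 : ∀ v, P.part u = P.part v ↔ v ∈ P.part u := fun v => by
    rw [P.mem_part_iff_part_eq_part (mem_univ _) (mem_univ _)]
    exact eq_comm
  rw [sum_eq_zero (s := univ.filter (· ∉ P.part u)), add_zero, filter_mem_eq_inter, univ_inter]
  · refine sum_congr rfl fun v hv => ?_
    rw [if_pos ((h1 v).2 hv)]
    split_ifs with h
    · rfl
    · have : g.weight u v = 0 := by
        by_contra h'
        exact h ((g.weight_ne_zero_iff u v).1 h')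
      simp [this]
  · intro v hv
    rw [if_neg fun h => (mem_filter.1 hv).2 ((h1 v).1 h)]

theorem simple_welfare_eq (G : SimpleGraph (Fin n)) (P : CoalitionStructure n) :
    (FractionalHedonicGame.simple G).utilitarianWelfare P = 2 * totalDensity G P := by
  classical
  rw [FractionalHedonicGame.utilitarianWelfare, totalDensity, mul_sum]
  refine sum_congr rfl fun C _ => ?_
  simp only [FractionalHedonicGame.utility]
  rw [← sum_div, ← mul_div_assoc]
  congr 1
  have h := (G.induce (C : Set (Fin n))).sum_degrees_eq_twice_card_edges
  rw [← SimpleGraph.coe_edgeFinset, Set.ncard_coe_finset]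
  have h' : (∑ v ∈ C, ∑ u ∈ C with G.Adj v u, (1 : ℚ)) =
      ((∑ v, (G.induce (C : Set (Fin n))).degree v : ℕ) : ℚ) := by
    push_cast
    rw [← sum_coe_sort C]
    refine sum_congr rfl fun v _ => ?_
    rw [← SimpleGraph.card_neighborFinset_eq_degree, sum_const, nsmul_eq_mul, mul_one]
    congr 1
    refine (card_bij (fun (a : (C : Set (Fin n))) _ => (a : Fin n)) ?_ ?_ ?_).symm
    · intro a ha
      simpa using ha
    · intro a _ b _ hab
      exact Subtype.ext hab
    · intro b hb
      simp only [mem_filter] at hb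
      exact ⟨⟨b, hb.1⟩, by simpa using hb.2, rfl⟩
  rw [h] at h'
  push_cast at h'
  rw [← h']
  refine sum_congr rfl fun v _ => sum_congr ?_ fun u hu => ?_
  · rfl
  · have : G.Adj v u := (mem_filter.1 hu).2
    simp [FractionalHedonicGame.simple, this]

end Welfare

/-! ### Correctness of the program -/

/-- The cells `n * u + v` of an `m × n` matrix are numbered consecutively. -/
theorem sum_range_pair {α : Type*} [AddCommMonoid α] (m n : ℕ) (f : ℕ → α) :
    ∑ u ∈ Finset.range m, ∑ v ∈ Finset.range n, f (n * u + v) = ∑ k ∈ Finset.range (n * m), f k := by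
  induction m with
  | zero => simp
  | succ m ih => rw [Finset.sum_range_succ, ih, mul_add, mul_one, Finset.sum_range_add]

theorem pair_div_mod {n u v : ℕ} (hv : v < n) : (n * u + v) / n = u ∧ (n * u + v) % n = v := by
  constructor
  · rw [Nat.mul_add_div (by omega), Nat.div_eq_of_lt hv, add_zero]
  · rw [Nat.mul_add_mod, Nat.mod_eq_of_lt hv]

open Classical in
theorem sum_two_pow_pair (n : ℕ) (P : ℕ → ℕ → Prop) :
    ∃ X < 2 ^ (n * n), (∑ u ∈ Finset.range n, ∑ v ∈ Finset.range n,
      if P u v then 2 ^ (n * u + v) else 0) = X ∧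
      ∀ u < n, ∀ v < n, X.testBit (n * u + v) ↔ P u v := by
  refine ⟨_, RAM.sum_two_pow_lt (n * n) fun k => P (k / n) (k % n), ?_, fun u hu v hv => ?_⟩
  · rw [← sum_range_pair n n fun k => if P (k / n) (k % n) then 2 ^ k else 0]
    refine Finset.sum_congr rfl fun u _ => Finset.sum_congr rfl fun v hv => ?_
    obtain ⟨h1, h2⟩ := pair_div_mod (u := u) (Finset.mem_range.1 hv)
    rw [h1, h2]
  · obtain ⟨h1, h2⟩ := pair_div_mod (u := u) hv
    rw [RAM.testBit_sum_two_pow, h1, h2]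
    have : n * u + v < n * n := by nlinarith
    simp [this]

namespace RAM.Base.Valid

variable {b : Base} (hb : b.Valid)
include hb

theorem inD_root {v : ℕ} : Cfg.InD (b.sz 0) (b.sz 3) (adjacent b)
    (Cfg.Conn (b.sz 0) (b.sz 3) (adjacent b)) (config b 0) v ↔ v < b.sz 0 := by
  obtain ⟨-, h2, h3⟩ := hb.config_zero
  refine ⟨fun h => h.1, fun h => ⟨h, ?_, fun l hl _ u _ hs => ?_, fun w _ hw => ?_⟩⟩
  · rintro ⟨l, hl, h'⟩
    rw [h3 l hl] at h'
    omega
  · rw [h3 l hl] at hs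
    omega
  · omega

theorem compat_root (c μ : ℕ → ℕ) :
    Cfg.Compat (b.sz 0) (b.sz 3) (adjacent b) c μ (config b 0) := by
  obtain ⟨-, -, h3⟩ := hb.config_zero
  refine ⟨fun l hl l' hl' t t' ht => ?_, fun l hl t ht => ?_⟩
  · rw [h3 l hl] at ht; omega
  · rw [h3 l hl] at ht; omega

/-- The value of the root, with scaled welfare `A` and edge bits `X`, has at most `B` binary
digits, so all its bits can be read. -/
theorem lt_two_pow_codes {V : ℕ} {A : ℤ} {X : ℕ} (hA : |A| ≤ (b.sz 2 - 2 : ℕ) * (b.sz 0).factorial)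
    (hX : X < 2 ^ (b.sz 0 * b.sz 0)) (hV : (V : ℤ) = A * 2 ^ (b.sz 0 * b.sz 0) + X) :
    V < 2 ^ b.sz 1 := by
  set n := b.sz 0 with hn
  set M := b.sz 2 with hM
  have hnM : n + 1 < M := hb.lt_radix
  have h1 : (M - 2) * n.factorial + 1 ≤ 2 ^ (M * M) := by
    have h2 : n.factorial ≤ (2 ^ M) ^ n :=
      (Nat.factorial_le_pow n).trans (Nat.pow_le_pow_left (by
        have := Nat.lt_two_pow_self (n := M); omega) n)
    have h3 : 1 ≤ n.factorial := Nat.factorial_pos n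
    calc (M - 2) * n.factorial + 1 ≤ (M - 2) * n.factorial + 2 * n.factorial := by omega
      _ = M * n.factorial := by rw [← add_mul]; congr 1; omega
      _ ≤ 2 ^ M * (2 ^ M) ^ n := Nat.mul_le_mul Nat.lt_two_pow_self.le h2
      _ = 2 ^ (M * (n + 1)) := by rw [← pow_mul, ← pow_add]; congr 1; ring
      _ ≤ 2 ^ (M * M) := Nat.pow_le_pow_right (by omega) (Nat.mul_le_mul_left _ (by omega))
  have h4 : V < 2 ^ (M * M) * 2 ^ (M * M) := by
    have h5 : (2 : ℤ) ^ (n * n) ≤ 2 ^ (M * M) :=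
      pow_le_pow_right₀ (by norm_num) (Nat.mul_le_mul (by omega) (by omega))
    have h6 : (X : ℤ) < 2 ^ (n * n) := by exact_mod_cast hX
    have h7 : A + 1 ≤ 2 ^ (M * M) := by
      have := (le_abs_self A).trans hA
      have h1' : (((M - 2) * n.factorial + 1 : ℕ) : ℤ) ≤ (2 ^ (M * M) : ℕ) := by exact_mod_cast h1
      push_cast at h1' this
      linarith
    have h8 : (V : ℤ) < 2 ^ (M * M) * 2 ^ (M * M) := by
      rw [hV]
      have h9 : (0 : ℤ) < 2 ^ (n * n) := by positivity
      have h10 : (0 : ℤ) < 2 ^ (M * M) := by positivity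
      nlinarith
    exact_mod_cast h8
  refine h4.trans_le ?_
  rw [← pow_add]
  refine Nat.pow_le_pow_right (by omega) (le_trans ?_ hb.radix_pow_le_codes)
  calc M * M + M * M = 2 * M ^ 2 := by ring
    _ ≤ M ^ 4 * M ^ 2 := Nat.mul_le_mul_right _ ((show 2 ≤ M by omega).trans
        (Nat.le_self_pow (by omega) _))
    _ = M ^ 6 := by ring

end RAM.Base.Valid

section Correctness

open RAM

variable {n : ℕ}

theorem FractionalHedonicGame.input_arr (g : FractionalHedonicGame n) (u v : Fin n) :
    g.input.arr 0 ((n * u + v : ℕ) : ℤ) = g.weight u v := by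
  have hlt : n * (u : ℕ) + v < n * n := by
    have h1 := u.2
    have h2 := v.2
    nlinarith
  obtain ⟨h1, h2⟩ := pair_div_mod (u := u) v.2
  have hc : (0 : ℕ) = 0 ∧ 0 ≤ ((n * u + v : ℕ) : ℤ) ∧ ((n * u + v : ℕ) : ℤ).toNat < n * n :=
    ⟨rfl, Int.natCast_nonneg _, by rw [Int.toNat_natCast]; exact hlt⟩
  rw [FractionalHedonicGame.input]
  dsimp only
  rw [dif_pos hc]
  congr 1 <;> refine Fin.ext ?_
  · change ((n * u + v : ℕ) : ℤ).toNat / n = u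
    rw [Int.toNat_natCast, h1]
  · change ((n * u + v : ℕ) : ℤ).toNat % n = v
    rw [Int.toNat_natCast, h2]

/-- The readable part of the memory for the game `g` and `K` slots. -/
def FractionalHedonicGame.base (g : FractionalHedonicGame n) (K : ℕ) : Base :=
  baseOf (g.input.arr 0) n (radix (g.input.arr 0) n) K

theorem FractionalHedonicGame.base_valid (g : FractionalHedonicGame n) {K : ℕ} (hK : 0 < K) :
    (g.base K).Valid :=
  baseOf_valid (by rw [radix]; omega) hK

theorem FractionalHedonicGame.adjacent_iff (g : FractionalHedonicGame n) {K u v : ℕ} :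
    adjacent (g.base K) u v ↔ ∃ (hu : u < n) (hv : v < n), g.graph.Adj ⟨u, hu⟩ ⟨v, hv⟩ := by
  constructor
  · rintro ⟨⟨hu, hv⟩, h⟩
    refine ⟨hu, hv, (g.weight_ne_zero_iff _ _).1 fun h' => h ?_⟩
    rw [← g.input_arr] at h'
    exact h'
  · rintro ⟨hu, hv, h⟩
    refine ⟨⟨hu, hv⟩, fun h' => (g.weight_ne_zero_iff _ _).2 h ?_⟩
    rw [← g.input_arr]
    exact h'

theorem FractionalHedonicGame.isAdj (g : FractionalHedonicGame n) (K : ℕ) :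
    IsAdj n (adjacent (g.base K)) where
  symm := by
    intro u v h
    obtain ⟨hu, hv, h⟩ := g.adjacent_iff.1 h
    exact g.adjacent_iff.2 ⟨hv, hu, h.symm⟩
  irrefl u h := by
    obtain ⟨hu, hv, h⟩ := g.adjacent_iff.1 h
    exact h.ne rfl
  left_lt h := h.1.1

/-- If there is a suitable elimination order, all vertices can be placed on the boundary. -/
theorem FractionalHedonicGame.placeable_of_rank (g : FractionalHedonicGame n) {K : ℕ} (hK : 0 < K)
    (hKn : K ≤ n + 1) {r : ℕ → ℕ} (hr : Cfg.IsRank n K (adjacent (g.base K)) r) :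
    placeable (g.base K) ((g.base K).sz 1) 0 := by
  have hb := g.base_valid hK
  set b := g.base K with hbdef
  have hn : b.sz 0 = n := rfl
  have hMn := hb.lt_radix
  have h3 := hb.config_zero.2.2
  have hfollows : Cfg.Follows n K (adjacent b) r (config b 0) := by
    refine ⟨fun l hl l' hl' t ht => ?_, fun x v w hx => ?_⟩
    · rw [h3 l hl] at ht; omega
    · obtain ⟨l, hl, h⟩ := hx
      rw [h3 l hl] at h; omega
  have hB : n * (n + 2) + n < b.sz 1 := by
    have h1 := hb.radix_pow_le_codes
    have h4 : b.sz 2 ^ 2 * 2 ≤ b.sz 2 ^ 6 := by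
      calc b.sz 2 ^ 2 * 2 ≤ b.sz 2 ^ 2 * b.sz 2 ^ 4 := Nat.mul_le_mul_left _
            ((show 2 ≤ b.sz 2 by omega).trans (Nat.le_self_pow (by omega) _))
        _ = b.sz 2 ^ 6 := by ring
    nlinarith
  have hcount : Cfg.count n (Cfg.InD n K (adjacent b) (Cfg.Conn n K (adjacent b)) (config b 0))
      (fun _ => 0) 0 ≤ n := by
    refine (Finset.sum_le_card_nsmul (Finset.range n) _ 1 fun v _ => ?_).trans (by simp)
    split_ifs <;> omega
  have hN : Cfg.count n (Cfg.InD n K (adjacent b) (Cfg.Conn n K (adjacent b)) (config b 0))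
      (fun _ => 0) 0 * (n + 2) + (n - (config b 0).j) ≤ b.sz 1 - 1 := by
    have := Nat.mul_le_mul_right (n + 2) hcount
    omega
  have := Cfg.good_of_rank (g.isAdj K) hb.isCoding (show n < b.sz 2 by omega)
    (show K ≤ b.sz 2 by omega) hr (b.sz 1 - 1) 0 hfollows hN
  rw [show b.sz 1 - 1 + 1 = b.sz 1 by omega] at this
  rw [placeable, hb.conn_eq]
  exact this

/-- If there are more slots than the treewidth, all vertices can be placed on the boundary. -/
theorem FractionalHedonicGame.placeable_treewidth (g : FractionalHedonicGame n) :
    placeable (g.base (treewidth g.graph + 1)) ((g.base (treewidth g.graph + 1)).sz 1) 0 := by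
  set K := treewidth g.graph + 1 with hK
  have htw := treewidth_le g.graph
  obtain ⟨D, hD⟩ := exists_width_eq_treewidth g.graph
  obtain ⟨r, hr⟩ := D.exists_rank
  refine g.placeable_of_rank (by omega) (by omega) (r := fun v => if h : v < n then r ⟨v, h⟩ else 0)
    ?_
  intro C u hun hu hmin hconn S hS
  have hSn : ∀ x ∈ S, x < n := fun x hx => by
    obtain ⟨-, ⟨v, -, h⟩, -⟩ := hS x hx
    exact h.1.1
  have hlift : ∀ v (h : v < n),
      Relation.ReflTransGen (fun a b => adjacent (g.base K) a b ∧ C b) u v →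
      Relation.ReflTransGen (fun a b : Fin n => g.graph.Adj a b ∧ C b) ⟨u, hun⟩ ⟨v, h⟩ := by
    intro v h h'
    induction h' with
    | refl => exact .refl
    | @tail a c h1 h2 ih =>
      obtain ⟨ha, hc, hadj⟩ := g.adjacent_iff.1 h2.1
      exact (ih ha).tail ⟨hadj, h2.2⟩
  have key := hr (fun v => C v) ⟨u, hun⟩ hu (fun v hv => by simpa [hun] using hmin v hv)
    (fun v hv => hlift v v.2 (hconn v hv)) (Finset.univ.filter fun x : Fin n => (x : ℕ) ∈ S) (by
      intro x hx
      simp only [Finset.mem_filter, Finset.mem_univ, true_and] at hx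
      obtain ⟨h1, ⟨v, hv, h2⟩, h3⟩ := hS x hx
      obtain ⟨_, hv', h2⟩ := g.adjacent_iff.1 h2
      exact ⟨h1, ⟨⟨v, hv'⟩, hv, h2⟩, fun v hv => by simpa using h3 v hv⟩)
  have hcard : (Finset.univ.filter fun x : Fin n => (x : ℕ) ∈ S).card = S.card := by
    refine Finset.card_bij (fun x _ => (x : ℕ)) (fun x hx => by simpa using hx)
      (fun x _ y _ h => Fin.ext h) fun x hx => ⟨⟨x, hSn x hx⟩, by simpa using hx, rfl⟩
  omega

end Correctness

/-! ### Optimality of the output -/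

section Optimality

open RAM

variable {n : ℕ}

namespace FractionalHedonicGame

/-- The relaxed welfare, multiplied by `n!`, which makes it an integer. -/
def scaledWelfare (g : FractionalHedonicGame n) (c μ : ℕ → ℕ) : ℤ :=
  ∑ u ∈ Finset.range n, ∑ v ∈ Finset.range n, if c u = c v then
    g.input.arr 0 (n * u + v : ℕ) *
      (∏ j ∈ Finset.range n, if j + 1 = μ (c u) then 1 else (j + 1) : ℕ) else 0

theorem scaledWelfare_eq (g : FractionalHedonicGame n) {c μ : ℕ → ℕ}
    (h : Claims (fun v : Fin n => c v) μ) : (g.scaledWelfare c μ : ℚ) =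
      n.factorial * relaxedWelfare (fun u v => (g.weight u v : ℚ)) (fun v : Fin n => c v) μ := by
  simp only [scaledWelfare, relaxedWelfare, Finset.sum_range, Finset.mul_sum, Int.cast_sum]
  refine Finset.sum_congr rfl fun u _ => Finset.sum_congr rfl fun v _ => ?_
  split_ifs with hc
  · have h1 : 1 ≤ μ (c u) := le_trans (Finset.card_pos.2 ⟨u, by simp⟩) (h.2 u)
    have h2 := prod_ite_mul h1 (h.1 (c u))
    have h3 : (μ (c u) : ℚ) ≠ 0 := by positivity
    rw [g.input_arr, eq_comm, mul_div_assoc', div_eq_iff h3, ← h2]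
    push_cast
    ring
  · simp

theorem abs_scaledWelfare_le (g : FractionalHedonicGame n) (c μ : ℕ → ℕ) :
    |g.scaledWelfare c μ| ≤ (radix (g.input.arr 0) n - 2 : ℕ) * n.factorial := by
  have h1 : |g.scaledWelfare c μ| ≤ ∑ u ∈ Finset.range n, ∑ v ∈ Finset.range n,
      (((g.input.arr 0 (n * u + v : ℕ)).natAbs : ℕ) : ℤ) * n.factorial := by
    refine (Finset.abs_sum_le_sum_abs _ _).trans (Finset.sum_le_sum fun u _ =>
      (Finset.abs_sum_le_sum_abs _ _).trans (Finset.sum_le_sum fun v _ => ?_))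
    split_ifs
    · rw [abs_mul, ← Int.natCast_natAbs, Nat.abs_cast]
      refine mul_le_mul_of_nonneg_left ?_ (Int.natCast_nonneg _)
      rw [← Finset.prod_range_add_one_eq_factorial]
      exact_mod_cast Finset.prod_le_prod' fun j _ => by split_ifs <;> omega
    · rw [abs_zero]; positivity
  refine h1.trans ?_
  rw [radix, show ∀ a, n + 2 + a - 2 = n + a by omega]
  push_cast
  simp only [← Finset.sum_mul]
  refine mul_le_mul_of_nonneg_right ?_ (by positivity)
  linarith [Int.natCast_nonneg n]

/-- The value of a choice of coalitions in the dynamic program consists of the scaled welfare and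
of a bit for each pair of adjacent vertices in the same coalition. -/
theorem pairSum_root (g : FractionalHedonicGame n) {K : ℕ} (hK : 0 < K) (c μ : ℕ → ℕ) :
    ∃ X : ℕ, X < 2 ^ (n * n) ∧ Cfg.pairSum n (adjacent (g.base K)) (value (g.base K))
      (Cfg.InD n K (adjacent (g.base K)) (Cfg.Conn n K (adjacent (g.base K)))
        (config (g.base K) 0)) c μ = g.scaledWelfare c μ * 2 ^ (n * n) + X ∧
      ∀ u < n, ∀ v < n, X.testBit (n * u + v) ↔ adjacent (g.base K) u v ∧ c u = c v := by
  classical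
  have hb := g.base_valid hK
  obtain ⟨X, hX, hsum, hbit⟩ := sum_two_pow_pair n fun u v => adjacent (g.base K) u v ∧ c u = c v
  refine ⟨X, hX, ?_, hbit⟩
  rw [← hsum, Cfg.pairSum, scaledWelfare]
  push_cast
  simp only [Finset.sum_mul, ← Finset.sum_add_distrib]
  refine Finset.sum_congr rfl fun u hu => Finset.sum_congr rfl fun v hv => ?_
  rw [Finset.mem_range] at hu hv
  have hD := hb.inD_root.2 hu
  by_cases h : adjacent (g.base K) u v ∧ c u = c v
  · rw [if_pos ⟨h.1, h.2, .inl hD⟩, if_pos h.2, if_pos h, hb.value_eq hu hv]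
    simp [base, baseOf]
  · rw [if_neg fun h' => h ⟨h'.1, h'.2.1⟩, if_neg h, add_zero]
    split_ifs with hc
    · have : g.input.arr 0 (n * u + v : ℕ) = 0 := by
        by_contra h0
        exact h ⟨⟨⟨hu, hv⟩, h0⟩, hc⟩
      push_cast at this
      rw [this]
      simp
    · simp

theorem count_eq_card {c : ℕ → ℕ} {D : ℕ → Prop} (hD : ∀ v < n, D v) (q : ℕ) :
    Cfg.count n D c q = (Finset.univ.filter fun u : Fin n => c u = q).card := by
  rw [Cfg.count, Finset.sum_range, Finset.card_filter]
  exact Finset.sum_congr rfl fun v _ => by simp [hD v v.2]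

/-- The output of the program is the partition into the components of the graph of those edges
that lie within the coalitions of a relaxed optimum. -/
theorem exists_isMaxUtilitarian (g : FractionalHedonicGame n) {K : ℕ} (hK : 0 < K)
    (hg : placeable (g.base K) ((g.base K).sz 1) 0) :
    ∃ P : CoalitionStructure n, (∀ u v : Fin n,
      label (g.base K) (optimum (g.base K) ((g.base K).sz 1) 0) u =
        label (g.base K) (optimum (g.base K) ((g.base K).sz 1) 0) v ↔ P.part u = P.part v) ∧
      g.IsMaxUtilitarian P := by
  classical
  have hb := g.base_valid hK
  have ha := g.isAdj K
  set b := g.base K with hbdef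
  have hb0 : b.sz 0 = n := rfl
  have hMn := hb.lt_radix
  rw [placeable, hb.conn_eq] at hg
  have hVdef : optimum b (b.sz 1) 0 = (Cfg.stepH (b.sz 1) n K (adjacent b) (value b)
    (Cfg.Conn n K (adjacent b)) (config b))^[b.sz 1] (fun _ => 0) 0 := by
    rw [optimum, hb.conn_eq]; rfl
  -- the computed value is attained by a choice `c` of coalitions with claimed sizes `μ`
  obtain ⟨c, μ, -, hμn, hcD, -, hcount, hval⟩ := Cfg.attains_iterate (B := b.sz 1) (K := K)
    (val := value b) (cfg := config b) ha (b.sz 1) 0 id (fun _ => 0) (fun l hl u hu => by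
      rw [hb.config_zero.2.2 l hl] at hu; omega) (fun _ => Nat.zero_le _)
  rw [← hVdef] at hval
  have hcn : ∀ v < n, c v < n := fun v hv => by
    rcases hcD v (hb.inD_root.2 hv) with h | ⟨l, hl, h, -⟩
    · exact h.1
    · exact absurd (hb.config_zero.2.2 l hl) h
  have hcl : Claims (fun v : Fin n => c v) μ := by
    refine ⟨hμn, fun v => ?_⟩
    have := hcount (c v) (hb.inD_root.2 (hcn v v.2))
    exact (count_eq_card (D := Cfg.InD n K (adjacent b) (Cfg.Conn n K (adjacent b)) (config b 0))
      (fun v hv => hb.inD_root.2 hv) _).symm.le.trans this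
  obtain ⟨X, hX, hsum, hbit⟩ := g.pairSum_root hK c μ
  rw [hval] at hsum
  set V := optimum b (b.sz 1) 0 with hV
  -- it is an upper bound for the values of all such choices
  have hmax : ∀ (c' : Fin n → ℕ) (μ' : ℕ → ℕ), Claims c' μ' →
      relaxedWelfare (fun u v => (g.weight u v : ℚ)) c' μ' ≤
        relaxedWelfare (fun u v => (g.weight u v : ℚ)) (fun v : Fin n => c v) μ := by
    intro c' μ' hcl'
    set c'' : ℕ → ℕ := fun v => if h : v < n then c' ⟨v, h⟩ else 0 with hc''
    have hcc : (fun v : Fin n => c'' v) = c' := by funext v; simp [hc'']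
    rw [← hcc] at hcl' ⊢
    have h1 := Cfg.pairSum_le_iterate (val := value b) (c := c'') (μ := μ') ha hb.isCoding
      (show n < b.sz 2 by omega) hcl'.1 (fun v hv => by
        rw [count_eq_card fun _ _ => trivial]
        exact hcl'.2 ⟨v, hv⟩) hg (hb.compat_root _ _)
    obtain ⟨X', hX', hsum', -⟩ := g.pairSum_root hK c'' μ'
    have h2 : g.scaledWelfare c'' μ' * 2 ^ (n * n) + X' ≤ V := by
      rw [← hsum', hVdef]
      exact h1
    rw [hsum] at h2
    have h3 : g.scaledWelfare c'' μ' ≤ g.scaledWelfare c μ := by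
      have h4 : (X : ℤ) < 2 ^ (n * n) := by exact_mod_cast hX
      by_contra hlt
      nlinarith [Int.natCast_nonneg X']
    have h5 : (g.scaledWelfare c'' μ' : ℚ) ≤ g.scaledWelfare c μ := by exact_mod_cast h3
    rw [g.scaledWelfare_eq hcl', g.scaledWelfare_eq hcl] at h5
    exact le_of_mul_le_mul_left h5 (by exact_mod_cast n.factorial_pos)
  -- the low bits of the value mark the edges within coalitions
  have hV0 : 0 ≤ V := by rw [hVdef]; exact Cfg.iterate_stepH_nonneg _ _ _
  obtain ⟨W, hW⟩ := Int.eq_ofNat_of_zero_le hV0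
  have hA0 : 0 ≤ g.scaledWelfare c μ := by
    have h4 : (X : ℤ) < 2 ^ (n * n) := by exact_mod_cast hX
    by_contra hlt
    nlinarith
  obtain ⟨A, hA⟩ := Int.eq_ofNat_of_zero_le hA0
  have hWA : W = 2 ^ (n * n) * A + X := by
    have : (W : ℤ) = (2 ^ (n * n) * A + X : ℕ) := by
      rw [← hW, hsum, hA]; push_cast; ring
    exact_mod_cast this
  have hWlt : W < 2 ^ b.sz 1 :=
    hb.lt_two_pow_codes (g.abs_scaledWelfare_le c μ) hX (by rw [← hW, hsum]; rfl)
  have hrel : (fun u v => adjacent b u v ∧ bit b V (b.sz 0 * u + v)) =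
      fun u v => adjacent b u v ∧ c u = c v := by
    funext u v
    refine propext (and_congr_right fun huv => ?_)
    have hu := huv.1.1
    have hv := huv.1.2
    have hlt : n * u + v < n * n := by
      have : u < n := hu
      have : v < n := hv
      nlinarith
    rw [hW, bit_iff hWlt (hb.pair_lt_codes hu hv), hWA,
      hb0, Nat.testBit_two_pow_mul_add _ hX, if_pos hlt, hbit u hu v hv]
    exact and_iff_right huv
  set rel : ℕ → ℕ → Prop := fun u v => adjacent b u v ∧ c u = c v with hreldef
  have hsymm : ∀ {u v}, Relation.ReflTransGen rel u v → Relation.ReflTransGen rel v u :=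
    fun h => Relation.ReflTransGen.mono (fun _ _ h => ⟨ha.symm h.1, h.2.symm⟩) _ _
      (Relation.reflTransGen_swap.1 h)
  have hlabel : ∀ u v : Fin n, label b V u = label b V v ↔ Relation.ReflTransGen rel u v := by
    intro u v
    obtain ⟨Lu, h1, -, h2⟩ := hb.reachSet_eq rel (p := u) u.2
    obtain ⟨Lv, h3, -, h4⟩ := hb.reachSet_eq rel (p := v) v.2
    have hwithin : ∀ p x : Fin n, Within (b.sz 0) rel p (b.sz 1) x ↔
        Relation.ReflTransGen rel p x := fun p x =>
      within_iff_reflTransGen (fun _ _ h => h.1.1.2) p.2 hb.lt_codes.le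
    rw [label, label, hrel, h1, h3]
    constructor
    · intro h
      have : Lu = Lv := by exact_mod_cast h
      rw [← hwithin, ← h2, this, h4, hwithin]
    · intro h
      have : Lu = Lv := by
        refine Nat.eq_of_testBit_eq fun i => ?_
        rw [Bool.eq_iff_iff, h2, h4]
        by_cases hi : i < n
        · rw [hwithin u ⟨i, hi⟩, hwithin v ⟨i, hi⟩]
          exact ⟨(hsymm h).trans, h.trans⟩
        · exact ⟨fun h' => absurd (h'.lt u.2) hi, fun h' => absurd (h'.lt v.2) hi⟩
      rw [this]
  let s : Setoid (Fin n) := ⟨fun u v => Relation.ReflTransGen rel u v,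
    ⟨fun _ => .refl, hsymm, Relation.ReflTransGen.trans⟩⟩
  have hpart : ∀ u v, v ∈ (Finpartition.ofSetoid s).part u ↔ s u v := fun u v =>
    Finpartition.mem_part_ofSetoid_iff_rel
  have hpart' : ∀ u v, (Finpartition.ofSetoid s).part u = (Finpartition.ofSetoid s).part v ↔
      s u v := fun u v => by
    rw [eq_comm, ← hpart,
      (Finpartition.ofSetoid s).mem_part_iff_part_eq_part (Finset.mem_univ _) (Finset.mem_univ _)]
  refine ⟨Finpartition.ofSetoid s, fun u v => (hlabel u v).trans (hpart' u v).symm, fun Q => ?_⟩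
  have hs : ∀ u v, s u v → c u = c v := by
    intro u v h
    have : ∀ a b' : ℕ, Relation.ReflTransGen rel a b' → c a = c b' := by
      intro a b' h
      induction h with
      | refl => rfl
      | tail _ h ih => exact ih.trans h.2
    exact this _ _ h
  -- every coalition structure is a choice with correctly claimed sizes
  set cQ : Fin n → ℕ := fun v => Fintype.equivFin (Finset (Fin n)) (Q.part v) with hcQ
  have hcQ' : ∀ u v, cQ u = cQ v ↔ Q.part u = Q.part v := fun u v => by
    simp only [hcQ, ← Fin.ext_iff, EmbeddingLike.apply_eq_iff_eq]
  have hQcard : ∀ v, (Finset.univ.filter fun u => cQ u = cQ v) = Q.part v := fun v => by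
    ext u
    rw [Finset.mem_filter, hcQ',
      Q.mem_part_iff_part_eq_part (Finset.mem_univ _) (Finset.mem_univ _)]
    simp
  have hQ : g.utilitarianWelfare Q = relaxedWelfare (fun u v => (g.weight u v : ℚ)) cQ
      fun q => (Finset.univ.filter fun u => cQ u = q).card := by
    rw [g.welfare_eq, relaxedWelfare]
    refine Finset.sum_congr rfl fun u _ => Finset.sum_congr rfl fun v _ => ?_
    rw [hQcard]
    simp only [hcQ']
  rw [hQ]
  refine (hmax _ _ ⟨fun q => ?_, fun v => le_rfl⟩).trans ?_
  · exact (Finset.card_le_univ _).trans (by simp)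
  refine (relaxedWelfare_le_classes (fun u => ?_) (fun v => hcn v v.2) hcl hmax s hs ?_).trans
    (le_of_eq ?_)
  · have : g.weight u u = 0 := by
      by_contra h
      exact ((g.weight_ne_zero_iff u u).1 h).ne rfl
    simp [this]
  · intro u v hc hω
    exact .single ⟨g.adjacent_iff.2 ⟨u.2, v.2, (g.weight_ne_zero_iff u v).1
      (by exact_mod_cast hω)⟩, hc⟩
  · rw [g.welfare_eq]
    refine Finset.sum_congr rfl fun u _ => Finset.sum_congr rfl fun v _ => ?_
    have hcard : (Finset.univ.filter fun x => s.r x u) = (Finpartition.ofSetoid s).part u := by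
      ext x
      rw [Finset.mem_filter, hpart]
      exact ⟨fun h => s.symm h.2, fun h => ⟨Finset.mem_univ _, s.symm h⟩⟩
    rw [hcard]
    simp only [hpart']

end FractionalHedonicGame

end Optimality

/-! ### The running time -/

section Time

open RAM

variable {n : ℕ}

theorem FractionalHedonicGame.size_le (g : FractionalHedonicGame n) {K : ℕ} (hK : 0 < K)
    (hKn : K ≤ n + 1) : (g.base K).size + 1 ≤ radix (g.input.arr 0) n ^ (4 * K + 4) := by
  have hMn : n + 2 ≤ radix (g.input.arr 0) n := by rw [radix]; omega
  have hsize : (g.base K).size = n + radix (g.input.arr 0) n ^ (4 * K + 2) +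
      radix (g.input.arr 0) n + K := by
    simp [Base.size, Fin.sum_univ_succ, base, baseOf]
    ring
  set M := radix (g.input.arr 0) n
  have h1 : M ≤ M ^ (4 * K + 2) := Nat.le_self_pow (by omega) _
  have h2 : M ^ (4 * K + 4) = M ^ (4 * K + 2) * M ^ 2 := by ring
  have h3 : 4 ≤ M ^ 2 := by nlinarith
  have h4 := Nat.mul_le_mul_left (M ^ (4 * K + 2)) h3
  rw [hsize, h2]
  omega

theorem FractionalHedonicGame.radix_le (g : FractionalHedonicGame n) :
    radix (g.input.arr 0) n ≤ n + 2 + n * n * g.maxAbsWeight := by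
  rw [radix]
  refine Nat.add_le_add_left ?_ _
  simp only [Finset.sum_range]
  have : ∀ u v : Fin n, (g.input.arr 0 ((n * u + v : ℕ) : ℤ)).natAbs ≤ g.maxAbsWeight :=
    fun u v => by
      rw [g.input_arr]
      exact Finset.le_sup (f := fun p : Fin n × Fin n => (g.weight p.1 p.2).natAbs)
        (Finset.mem_univ (u, v))
  calc _ ≤ ∑ _ : Fin n, ∑ _ : Fin n, g.maxAbsWeight :=
        Finset.sum_le_sum fun u _ => Finset.sum_le_sum fun v _ => this u v
    _ = n * n * g.maxAbsWeight := by simp [mul_assoc]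

theorem FractionalHedonicGame.two_le_and_one_le_maxAbsWeight (g : FractionalHedonicGame n) (hG : g.graph ≠ ⊥) :
    2 ≤ n ∧ 1 ≤ g.maxAbsWeight := by
  obtain ⟨u, v, huv⟩ : ∃ u v, g.graph.Adj u v := by
    by_contra h
    push Not at h
    exact hG (SimpleGraph.eq_bot_iff_forall_not_adj.2 h)
  constructor
  · have h1 := u.2
    have h2 := v.2
    have h3 : (u : ℕ) ≠ v := fun h => huv.ne (Fin.ext h)
    omega
  · refine le_trans ?_ (Finset.le_sup (f := fun p : Fin n × Fin n => (g.weight p.1 p.2).natAbs)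
      (Finset.mem_univ (u, v)))
    exact Int.natAbs_pos.2 ((g.weight_ne_zero_iff u v).2 huv)

/-- The program works for all games. Its running time is polynomial in `M ^ K`, where the final
number `K` of slots exceeds the treewidth at most by one, and `M` is polynomial in `n W`. -/
theorem FractionalHedonicGame.exists_run : ∃ (prog : Program) (C : ℕ),
    ∀ (n : ℕ) (g : FractionalHedonicGame n),
      ∃ (t : ℕ) (s : State) (P : CoalitionStructure n),
        Exec prog g.input t s ∧ s.Outputs P ∧ g.IsMaxUtilitarian P ∧
        (g.graph ≠ ⊥ → t ≤ (n * g.maxAbsWeight) ^ (C * treewidth g.graph)) ∧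
        (g.graph = ⊥ → t ≤ C * (n + 1) ^ C) := by
  classical
  obtain ⟨T, ⟨c, e, hT⟩, prog, hprog⟩ := exists_program
  refine ⟨prog, c + 48 * e + c * 256 ^ e, fun n g => ?_⟩
  -- the least sufficient number of slots
  have hex : ∃ K, 0 < K ∧ placeable (g.base K) ((g.base K).sz 1) 0 :=
    ⟨_, Nat.succ_pos _, g.placeable_treewidth⟩
  let K := Nat.find hex
  obtain ⟨hK, hgood⟩ : 0 < K ∧ placeable (g.base K) ((g.base K).sz 1) 0 := Nat.find_spec hex
  have hbad : ∀ K', 0 < K' → K' < K → ¬ placeable (g.base K') ((g.base K').sz 1) 0 :=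
    fun K' h1 h2 h3 => Nat.find_min hex h2 ⟨h1, h3⟩
  have htw : K ≤ treewidth g.graph + 1 := Nat.find_min' hex ⟨Nat.succ_pos _, g.placeable_treewidth⟩
  have htwn := treewidth_le g.graph
  obtain ⟨P, hP, hPmax⟩ := g.exists_isMaxUtilitarian hK hgood
  obtain ⟨t, s, h1, h2, h3⟩ := hprog (g.input.arr 0) n K (g.base K) rfl hK hgood hbad g.input rfl
    (by simp [FractionalHedonicGame.input]) fun x hx => by simp [FractionalHedonicGame.input, hx]
  refine ⟨t, s, P, h1, fun u v => ?_, hPmax, fun hG => ?_, fun hG => ?_⟩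
  · rw [h3 u u.2, h3 v v.2]
    exact hP u v
  · obtain ⟨hn, hW⟩ := g.two_le_and_one_le_maxAbsWeight hG
    have htw1 := one_le_treewidth hG
    set N := n * g.maxAbsWeight with hN
    have hnN : n ≤ N := Nat.le_mul_of_pos_right _ hW
    have hN2 : 2 ≤ N := hn.trans hnN
    have hM : radix (g.input.arr 0) n ≤ N ^ 4 := by
      have h4 : n * n * g.maxAbsWeight ≤ N * N := by
        rw [mul_assoc, ← hN]
        exact Nat.mul_le_mul_right _ hnN
      have h5 : 4 ≤ N * N := Nat.mul_le_mul hN2 hN2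
      have h6 : 4 * (N * N) ≤ N ^ 4 := by
        calc 4 * (N * N) ≤ (N * N) * (N * N) := Nat.mul_le_mul_right _ h5
          _ = N ^ 4 := by ring
      have := g.radix_le
      nlinarith
    have hS : (g.base K).size + 1 ≤ N ^ (48 * treewidth g.graph) := by
      refine (g.size_le hK (by omega)).trans ((Nat.pow_le_pow_left hM _).trans ?_)
      rw [← pow_mul]
      exact Nat.pow_le_pow_right (by omega) (by omega)
    -- `c ≤ 2 ^ c ≤ N ^ c`, and positive treewidth absorbs constant exponents
    calc t ≤ c * ((g.base K).size + 1) ^ e := h2.trans (hT _)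
      _ ≤ N ^ (c * treewidth g.graph) * (N ^ (48 * treewidth g.graph)) ^ e := by
        refine Nat.mul_le_mul ?_ (Nat.pow_le_pow_left hS e)
        calc c ≤ 2 ^ c := Nat.lt_two_pow_self.le
          _ ≤ N ^ c := Nat.pow_le_pow_left hN2 c
          _ ≤ _ := Nat.pow_le_pow_right (by omega) (Nat.le_mul_of_pos_right _ htw1)
      _ = N ^ ((c + 48 * e) * treewidth g.graph) := by
        rw [← pow_mul, ← pow_add]
        congr 1
        ring
      _ ≤ _ := Nat.pow_le_pow_right (by omega) (Nat.mul_le_mul_right _ (Nat.le_add_right _ _))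
  · have hno : ∀ K' u v, ¬ adjacent (g.base K') u v := fun K' u v h => by
      obtain ⟨hu, hv, h⟩ := g.adjacent_iff.1 h
      rw [hG] at h
      exact h
    -- without edges one slot suffices
    have hK1 : K = 1 := by
      refine le_antisymm (Nat.find_min' hex ⟨one_pos, g.placeable_of_rank one_pos (by omega)
        (r := fun _ => 0) ?_⟩) hK
      intro C u _ _ _ _ S hS
      rw [Nat.lt_one_iff, Finset.card_eq_zero, Finset.eq_empty_iff_forall_notMem]
      intro x hx
      obtain ⟨-, ⟨v, -, h⟩, -⟩ := hS x hx
      exact hno _ _ _ h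
    have hW : g.maxAbsWeight = 0 := by
      rw [← Nat.le_zero, maxAbsWeight]
      refine Finset.sup_le fun p _ => ?_
      have : g.weight p.1 p.2 = 0 := by
        by_contra h
        have := (g.weight_ne_zero_iff _ _).1 h
        rw [hG] at this
        exact this
      simp [this]
    have hM : radix (g.input.arr 0) n ≤ 2 * (n + 1) := by
      have := g.radix_le
      rw [hW] at this
      omega
    have hS : (g.base K).size + 1 ≤ (2 * (n + 1)) ^ 8 := by
      refine (g.size_le hK (by omega)).trans ((Nat.pow_le_pow_left hM _).trans ?_)
      rw [hK1]
    calc t ≤ c * ((g.base K).size + 1) ^ e := h2.trans (hT _)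
      _ ≤ c * ((2 * (n + 1)) ^ 8) ^ e := Nat.mul_le_mul_left _ (Nat.pow_le_pow_left hS e)
      _ = c * 256 ^ e * (n + 1) ^ (8 * e) := by
        rw [mul_pow, mul_pow, ← pow_mul (n + 1)]
        norm_num [mul_assoc]
      _ ≤ _ := Nat.mul_le_mul (by omega) (Nat.pow_le_pow_right (by omega) (by omega))

theorem FractionalHedonicGame.maxAbsWeight_simple_le (G : SimpleGraph (Fin n)) :
    (FractionalHedonicGame.simple G).maxAbsWeight ≤ 1 := by
  classical
  refine Finset.sup_le fun p _ => ?_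
  simp only [simple]
  split_ifs <;> simp

end Time

theorem theorem5 :
    ∃ (prog : RAM.Program) (c : ℕ),
      (∀ (n : ℕ) (g : FractionalHedonicGame n),
        ∃ (t : ℕ) (s : RAM.State) (P : CoalitionStructure n),
          RAM.Exec prog g.input t s ∧ s.Outputs P ∧ g.IsMaxUtilitarian P ∧
          (g.graph ≠ ⊥ → t ≤ (n * g.maxAbsWeight) ^ (c * treewidth g.graph)) ∧
          (g.graph = ⊥ → t ≤ c * (n + 1) ^ c)) ∧
      (∀ (n : ℕ) (G : SimpleGraph (Fin n)),
        ∃ (t : ℕ) (s : RAM.State) (P : CoalitionStructure n),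
          RAM.Exec prog (FractionalHedonicGame.simple G).input t s ∧ s.Outputs P ∧
          (∀ Q : CoalitionStructure n, totalDensity G Q ≤ totalDensity G P) ∧
          (G ≠ ⊥ → t ≤ n ^ (c * treewidth G)) ∧
          (G = ⊥ → t ≤ c * (n + 1) ^ c)) := by

  obtain ⟨prog, C, h⟩ := FractionalHedonicGame.exists_run
  refine ⟨prog, C, h, fun n G => ?_⟩
  obtain ⟨t, s, P, h1, h2, h3, h4, h5⟩ := h n (FractionalHedonicGame.simple G)
  refine ⟨t, s, P, h1, h2, fun Q => ?_, fun hG => (h4 hG).trans (Nat.pow_le_pow_left ?_ _), h5⟩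
  · have := h3 Q
    rw [simple_welfare_eq, simple_welfare_eq] at this
    linarith
  · have := Nat.mul_le_mul_left n (FractionalHedonicGame.maxAbsWeight_simple_le G)
    omega
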